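/- Let $n\ge 1$, let $m_1,\dots,m_n\ge 0$, and write $\xi_i=(k_i,\lambda_i)\in\mathbb R^3\times\{-\frac12,\frac12\}$, $\int d\xi_i=\sum_{\lambda_i}\int_{\mathbb R^3}dk_i$. Let $\mathcal F=\mathbb C\oplus\bigoplus_{l\ge1}\otimes_a^l L^2(\mathbb R^3\times\{-\frac12,\frac12\})$ be the antisymmetric Fock space, $\mathcal H=\bigotimes_{i=1}^n\mathcal F$, and let $b_i^*(\xi_i)$, $b_i(\xi_i)$ be the fermionic creation and annihilation operators on the $i$-th factor, with $\{b_i(\xi),b_i^*(\xi')\}=\delta(\xi-\xi')$, all other anticommutators (also those between different species) being $0$. Let $H_{f,i}=\mathrm d\Gamma(\omega_i)$ with $\omega_i(k)=\sqrt{k^2+m_i^2}$, acting on the $i$-th factor. For $0\le p\le n$ and $G\in L^2((\mathbb R^3\times\{-\frac12,\frac12\})^n)$ let $H_I(G)$ be the operator on $\mathcal H$ associated with the quadratic form $$\int G(\xi_1,\dots,\xi_n)\,b_1^*(\xi_1)\cdots b_p^*(\xi_p)\,b_{p+1}(\xi_{p+1})\cdots b_n(\xi_n)\,d\xi_1\cdots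 d\xi_n ,$$ that is, $\varphi\in\mathcal D(H_I(G))$ and $H_I(G)\varphi=\chi$ if $\langle\psi,\chi\rangle$ is the value of the form at $(\psi,\varphi)$ for all finite-particle vectors $\psi$. For $1\le j\le3$ let $\mathrm h_i^j=-\partial_{k_{i,j}}^2+k_{i,j}^2$ be the harmonic oscillator in the variable $k_{i,j}$. Let $s>1/2$ and $0\le\theta\le1$. There is a constant $C_{s,\theta}>0$ (which may depend on $n$ and on the masses, but not on $p$, $i_0$, $G$, $\varphi$) such that for all $0\le p\le n$, all $i_0\in\{1,\dots,n\}$, all $$G\in\mathcal D\Big(\prod_{\substack{i\ne i_0,\ m_i>0\\ 1\le j\le3}}(\mathrm h_i^j)^{\theta s}\prod_{\substack{i\ne i_0,\ m_i=0\\ 1\le j\le3}}(\mathrm h_i^j)^{\frac1{12}+\theta(s-\frac1{12})}\Big)$$ and all $\varphi\in\mathcal D\big((\sum_{i\ne i_0}H_{f,i})^{\frac{n-1}2(1-\theta)}\big)$, the vector $\varphi$ is in the domain of $H_I(G)$ and $$\|H_I(G)\varphi\|\le C_{s,\theta}\,\Big\|\prod_{\substack{i\ne i_0,\ m_i>0\\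 1\le j\le3}}(\mathrm h_i^j)^{\theta s}\prod_{\substack{i\ne i_0,\ m_i=0\\ 1\le j\le3}}(\mathrm h_i^j)^{\frac1{12}+\theta(s-\frac1{12})}\,G\Big\|_2\,\Big\|\Big(\sum_{i\ne i_0}H_{f,i}+1\Big)^{\frac{n-1}2(1-\theta)}\varphi\Big\| .$$ -/

import Mathlib

open MeasureTheory
open scoped ComplexConjugate SchwartzMap

noncomputable section

namespace FermionFields

/-! ### One-particle space -/

/-- The one-particle variable `ξ = (k, λ)`: a momentum `k ∈ ℝ³` and a spin label `λ`, the two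
values of `Bool` standing for `-1/2` and `1/2`. -/
abbrev Xi : Type := (Fin 3 → ℝ) × Bool

/-- `∫ f dξ = ∑_λ ∫_{ℝ³} f(k, λ) dk`: Lebesgue measure times counting measure. -/
def xiMeasure : Measure Xi := (volume : Measure (Fin 3 → ℝ)).prod Measure.count

instance : SigmaFinite xiMeasure := by unfold xiMeasure; infer_instance

/-- The relativistic dispersion relation `ω(k) = √(k² + m²)`. -/
def dispersion (m : ℝ) (k : Fin 3 → ℝ) : ℝ := Real.sqrt ((∑ j, k j ^ 2) + m ^ 2)

/-! ### The Hilbert space: `n`-fold tensor product of antisymmetric Fock spaces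

Since `⨂ᵢ ⨁_{lᵢ} ⊗ₐ^{lᵢ} L²(Xi) = ⨁_{(l₁,…,lₙ)} ⨂ᵢ ⊗ₐ^{lᵢ} L²(Xi)`, a vector is a square-summable
family, indexed by the particle numbers `l = (l₁,…,lₙ)`, of square-integrable functions of
`l₁ + ⋯ + lₙ` variables, antisymmetric under permutations of the variables of each species. -/

/-- Positions in `Xi` of `l i` particles of each species `i`. -/
abbrev Conf {n : ℕ} (l : Fin n → ℕ) : Type := (i : Fin n) → Fin (l i) → Xi

def confMeasure {n : ℕ} (l : Fin n → ℕ) : Measure (Conf l) :=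
  Measure.pi fun _ => Measure.pi fun _ => xiMeasure

instance {n : ℕ} (l : Fin n → ℕ) : SigmaFinite (confMeasure l) := by
  unfold confMeasure; infer_instance

/-- Permute the particles inside each species. -/
def permConf {n : ℕ} {l : Fin n → ℕ} (σ : (i : Fin n) → Equiv.Perm (Fin (l i)))
    (X : Conf l) : Conf l := fun i => X i ∘ σ i

theorem measurePreserving_permConf {n : ℕ} {l : Fin n → ℕ}
    (σ : (i : Fin n) → Equiv.Perm (Fin (l i))) :
    MeasurePreserving (permConf σ) (confMeasure l) (confMeasure l) := by
  refine measurePreserving_pi (fun _ => Measure.pi fun _ => xiMeasure)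
    (fun _ => Measure.pi fun _ => xiMeasure) (f := fun i x => x ∘ σ i) fun i => ?_
  have h := measurePreserving_piCongrLeft (fun _ : Fin (l i) => xiMeasure) (σ i).symm
  convert h using 1
  ext x a : 2
  have := MeasurableEquiv.piCongrLeft_apply_apply (β := fun _ : Fin (l i) => Xi)
    (σ i).symm x (σ i a)
  simp only [Equiv.symm_apply_apply] at this
  simp [this]

/-- Product over the species of the signs of the permutations. -/
def permSign {n : ℕ} {l : Fin n → ℕ} (σ : (i : Fin n) → Equiv.Perm (Fin (l i))) : ℂ :=
  ∏ i, ((Equiv.Perm.sign (σ i) : ℤ) : ℂ)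

/-- The sector `⨂ᵢ ⊗ₐ^{lᵢ} L²(Xi)` with `l i` particles of species `i`. -/
def sector {n : ℕ} (l : Fin n → ℕ) : Submodule ℂ (Lp ℂ 2 (confMeasure l)) where
  carrier := {f | ∀ σ : (i : Fin n) → Equiv.Perm (Fin (l i)),
    ∀ᵐ X ∂confMeasure l, f (permConf σ X) = permSign σ * f X}
  zero_mem' := by
    intro σ
    have h0 := Lp.coeFn_zero ℂ 2 (confMeasure l)
    filter_upwards [h0, (measurePreserving_permConf σ).quasiMeasurePreserving.ae h0]
      with X h1 h2
    rw [h1, h2, Pi.zero_apply, Pi.zero_apply, mul_zero]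
  add_mem' := by
    intro f g hf hg σ
    have h0 := Lp.coeFn_add f g
    filter_upwards [h0, (measurePreserving_permConf σ).quasiMeasurePreserving.ae h0, hf σ, hg σ]
      with X h1 h2 h3 h4
    rw [h1, h2, Pi.add_apply, Pi.add_apply, h3, h4, mul_add]
  smul_mem' := by
    intro c f hf σ
    have h0 := Lp.coeFn_smul c f
    filter_upwards [h0, (measurePreserving_permConf σ).quasiMeasurePreserving.ae h0, hf σ]
      with X h1 h2 h3
    rw [h1, h2, Pi.smul_apply, Pi.smul_apply, h3, smul_eq_mul, smul_eq_mul, mul_left_comm]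

/-- The total Hilbert space `ℋ = ⨂_{i=1}^n ℱ`. -/
abbrev Fock (n : ℕ) : Type := lp (fun l : Fin n → ℕ => sector l) 2

/-- The wave functions of a vector, one for each sector. -/
def wave {n : ℕ} (φ : Fock n) (l : Fin n → ℕ) : Conf l → ℂ := ((φ l : Lp ℂ 2 (confMeasure l)))

/-- Vectors with only finitely many non-zero sectors. -/
def IsFiniteParticle {n : ℕ} (ψ : Fock n) : Prop := {l | ψ l ≠ 0}.Finite

/-! ### Free energy -/

/-- `H_{f,i} = dΓ(ω_i)` multiplies the wave functions by `∑ₐ ω_i(k_{i,a})`, the sum running over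
the particles of species `i`. -/
def freeEnergy {n : ℕ} (m : Fin n → ℝ) (i : Fin n) (l : Fin n → ℕ) (X : Conf l) : ℝ :=
  ∑ a, dispersion (m i) (X i a).1

/-- The graph of the self-adjoint operator `(∑_{i ≠ i₀} H_{f,i} + c)^α`: `η` is the image of `φ`.
The power is given by the functional calculus of multiplication operators; `φ` is in the domain
when the product is again the family of wave functions of a vector of `ℋ`. -/
def IsEnergyPow {n : ℕ} (m : Fin n → ℝ) (i₀ : Fin n) (c α : ℝ) (φ η : Fock n) : Prop :=
  ∀ l, ∀ᵐ X ∂confMeasure l, wave η l X =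
    ((((∑ i ∈ Finset.univ.erase i₀, freeEnergy m i l X) + c) ^ α : ℝ) : ℂ) * wave φ l X

/-! ### Interaction -/

/-- Add a particle at `ξ`, as the first one of species `i`. -/
def insertConf {n : ℕ} {l : Fin n → ℕ} (i : Fin n) (ξ : Xi) (X : Conf l) :
    Conf (Function.update l i (l i + 1)) := fun j a =>
  if h : j = i then
    (Fin.cons ξ (X i) : Fin (l i + 1) → Xi) (Fin.cast (by subst h; simp) a)
  else X j (Fin.cast (by simp [h]) a)

/-- The annihilation operator `b_i(ξ)` on families of wave functions,
`(b_i(ξ) f)_l (X) = (-1)^{∑_{j<i} l_j} √(l_i + 1) f_{l + e_i}(ξ, X)`.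
The sign makes operators of different species anticommute. -/
def annihilate {n : ℕ} (i : Fin n) (ξ : Xi) (f : (l : Fin n → ℕ) → Conf l → ℂ)
    (l : Fin n → ℕ) (X : Conf l) : ℂ :=
  (-1) ^ (∑ j ∈ Finset.univ.filter (· < i), l j) * (Real.sqrt (l i + 1) : ℂ) *
    f (Function.update l i (l i + 1)) (insertConf i ξ X)

/-- `b_{i₁}(ξ_{i₁}) ⋯ b_{i_r}(ξ_{i_r}) f` for the list `[i₁, …, i_r]`. -/
def annihilateList {n : ℕ} (L : List (Fin n)) (ξ : Fin n → Xi)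
    (f : (l : Fin n → ℕ) → Conf l → ℂ) : (l : Fin n → ℕ) → Conf l → ℂ :=
  L.foldr (fun i g => annihilate i (ξ i) g) f

/-- The measure `dξ₁ ⋯ dξₙ`. -/
def kernelMeasure (n : ℕ) : Measure (Fin n → Xi) := Measure.pi fun _ => xiMeasure

instance (n : ℕ) : SigmaFinite (kernelMeasure n) := by unfold kernelMeasure; infer_instance

/-- Square-integrable kernels `G(ξ₁, …, ξₙ)`. -/
abbrev Kernel (n : ℕ) : Type := Lp ℂ 2 (kernelMeasure n)

/-- In the sector `l`, the integrand of
`∫ G(ξ) ⟨b_p(ξ_p) ⋯ b_1(ξ_1) ψ, b_{p+1}(ξ_{p+1}) ⋯ b_n(ξ_n) φ⟩ dξ₁ ⋯ dξₙ`,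
the quadratic form of `∫ G b_1^* ⋯ b_p^* b_{p+1} ⋯ b_n`. -/
def formIntegrand {n : ℕ} (p : ℕ) (G : Kernel n) (ψ φ : Fock n) (l : Fin n → ℕ)
    (z : (Fin n → Xi) × Conf l) : ℂ :=
  G z.1 *
    (conj (annihilateList ((List.finRange n).filter (fun i => i.val < p)).reverse
        z.1 (wave ψ) l z.2) *
      annihilateList ((List.finRange n).filter (fun i => p ≤ i.val)) z.1 (wave φ) l z.2)

/-- The graph of the operator `H_I(G)` defined by this quadratic form: `φ` is in the domain and
`H_I(G) φ = χ` when `⟨ψ, χ⟩` is the value of the form at `(ψ, φ)`, for all finite-particle `ψ`. -/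
def IsInteraction {n : ℕ} (p : ℕ) (G : Kernel n) (φ χ : Fock n) : Prop :=
  ∀ ψ : Fock n, IsFiniteParticle ψ →
    (∀ l, Integrable (formIntegrand p G ψ φ l) ((kernelMeasure n).prod (confMeasure l))) ∧
    HasSum (fun l => ∫ z, formIntegrand p G ψ φ l z ∂((kernelMeasure n).prod (confMeasure l)))
      (inner ℂ ψ χ)

/-! ### Powers of the harmonic oscillators -/

/-- The one-dimensional harmonic oscillator `-d²/dx² + x²` on smooth functions. -/
def harmonicOscillator (f : ℝ → ℂ) (x : ℝ) : ℂ := -deriv (deriv f) x + (x : ℂ) ^ 2 * f x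

/-- Replace the momentum coordinate `k_{i,j}` by `x`. -/
def setCoord {n : ℕ} (ξ : Fin n → Xi) (i : Fin n) (j : Fin 3) (x : ℝ) : Fin n → Xi :=
  Function.update ξ i (Function.update (ξ i).1 j x, (ξ i).2)

/-- The graph of `(h_i^j)^a` on kernels: `F = (h_i^j)^a G`. The harmonic oscillator has pure point
spectrum, with Schwartz eigenfunctions spanning `L²(ℝ)`, so its power is characterised by
`⟨e, h^a u⟩ = μ^a ⟨e, u⟩` for every eigenfunction `e` with eigenvalue `μ`; here the scalar product
is taken in the variable `k_{i,j}`, for almost all values of the other variables. -/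
def IsOscillatorPow {n : ℕ} (i : Fin n) (j : Fin 3) (a : ℝ) (G F : Kernel n) : Prop :=
  ∀ (e : 𝓢(ℝ, ℂ)) (μ : ℝ), (∀ x, harmonicOscillator e x = (μ : ℂ) * e x) →
    ∀ᵐ ξ ∂kernelMeasure n,
      ∫ x, conj (e x) * F (setCoord ξ i j x) =
        ((μ ^ a : ℝ) : ℂ) * ∫ x, conj (e x) * G (setCoord ξ i j x)

/-- `F = A₁ ⋯ A_r G` for the list of operators `A_t = (h_{i_t}^{j_t})^a`, with the usual
domain of a product of unbounded operators. -/
def IsOscillatorProd {n : ℕ} (a : ℝ) : List (Fin n × Fin 3) → Kernel n → Kernel n → Prop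
  | [], G, F => F = G
  | t :: L, G, F => ∃ F', IsOscillatorProd a L G F' ∧ IsOscillatorPow t.1 t.2 a F' F

/-- The pairs `(i, j)` with `i` a massive species other than `i₀`. -/
def massivePairs {n : ℕ} (m : Fin n → ℝ) (i₀ : Fin n) : List (Fin n × Fin 3) :=
  ((List.finRange n).filter (fun i => i ≠ i₀ ∧ 0 < m i)).product (List.finRange 3)

/-- The pairs `(i, j)` with `i` a massless species other than `i₀`. -/
def masslessPairs {n : ℕ} (m : Fin n → ℝ) (i₀ : Fin n) : List (Fin n × Fin 3) :=
  ((List.finRange n).filter (fun i => i ≠ i₀ ∧ m i = 0)).product (List.finRange 3)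

/-- `F = (∏_{massive} (h_i^j)^{θ s}) (∏_{massless} (h_i^j)^{1/12 + θ (s - 1/12)}) G`. -/
def IsWeighted {n : ℕ} (m : Fin n → ℝ) (i₀ : Fin n) (s θ : ℝ) (G F : Kernel n) : Prop :=
  ∃ F', IsOscillatorProd (1 / 12 + θ * (s - 1 / 12)) (masslessPairs m i₀) G F' ∧
    IsOscillatorProd (θ * s) (massivePairs m i₀) F' F

end FermionFields

end

/-! In the basis of products of Hermite functions and spin states the oscillator powers are
diagonal. If `g β` are the coefficients of the kernel, the squared norm of the weighted kernel is
the sum over `β` of `∏_{i ≠ i₀} v_i(β_i) |g β|²`, where `v_i = modeWeight²`, and up to a phase on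
each sector the form is the sum of `g β ⟨∏_{i<p} b ψ, ∏_{i≥p} b φ⟩`. It remains to bound this
fermionic polynomial.

The anticommutation relations alone give `IsCAR.norm_wickOp_sq_le`. The species `i₀` costs nothing,
since a smeared fermionic operator is bounded by the `ℓ²` norm of its coefficients. An annihilated
species is handled by Cauchy–Schwarz with weight `v`, a created one by normal ordering and a
weighted AM–GM inequality. What remains on `φ` is, for each set `R` of species other than `i₀`, the
sum of `∏_{i ∈ R} v_i(β_i)⁻¹ ‖∏_{i ∈ R} b_{i,β_i} φ‖²`.

By `inv_modeWeight_sq`, `v⁻¹ = A^θ B^(1-θ)`. The weight `A` is summable because `s > 1/2`, so the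
exclusion principle `‖b‖ ≤ 1` settles `θ = 1` without energy (`tsum_listWeight_le_of_sum_le`). At `θ
= 0` the sum is controlled by products of free energies (`tsum_listWeight_le_energy`): a massive
particle satisfies `1 ≤ ω / m`, and a massless one satisfies `∏_j h_j^(-1/6) ≤ C |k|`. The latter
follows from the one-dimensional Hardy-type inequality `h^(-1/6) ≤ 34 |x|^(1/3)`
(`weightedBessel_hermite`), and it is the source of the exponent `1/12`. Since at most `n - 1`
species occur in `R`, the product of energies is at most a constant times the power `n - 1` of the
total energy plus one. Intermediate `θ` follow by real interpolation (`tsum_interpolate`): `φ` is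
cut at the levels of the energy, which is a multiplication operator and commutes with permutations.

The operator estimates are proved for finitely supported alternating functions on lists of modes,
where no domain question arises, and carried to each sector by truncation (`norm_form_coef_le`).
Cauchy–Schwarz over the sectors and the Riesz theorem then produce the vector `H_I(G) φ`. -/

open MeasureTheory
open scoped ComplexConjugate SchwartzMap ENNReal

noncomputable section

namespace FermionFields

/-! ### Norm estimates from the canonical anticommutation relations -/

section CAR

set_option linter.unusedSectionVars false

variable {ι κ H : Type*} [DecidableEq ι] [DecidableEq κ] [NormedAddCommGroup H]
  [InnerProductSpace ℂ H]

/-- Annihilation operators `b i a` and creation operators `bd i a` of mutually commuting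
fermionic species `i`, on a pre-Hilbert space. -/
structure IsCAR (b bd : ι → κ → H →ₗ[ℂ] H) : Prop where
  adj : ∀ i a x y, inner ℂ (b i a x) y = inner ℂ x (bd i a y)
  car : ∀ i a c x, b i a (bd i c x) + bd i c (b i a x) = if a = c then x else 0
  comm : ∀ i j, i ≠ j → ∀ a c x, b i a (b j c x) = b j c (b i a x)
  comm' : ∀ i j, i ≠ j → ∀ a c x, b i a (bd j c x) = bd j c (b i a x)

variable {b bd : ι → κ → H →ₗ[ℂ] H}

theorem inner_self_eq_ofReal (x : H) : inner ℂ x x = ((‖x‖ ^ 2 : ℝ) : ℂ) := by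
  rw [inner_self_eq_norm_sq_to_K]
  norm_cast

theorem IsCAR.adj' (h : IsCAR b bd) (i : ι) (a : κ) (x y : H) :
    inner ℂ (bd i a x) y = inner ℂ x (b i a y) := by
  rw [← inner_conj_symm, ← h.adj, inner_conj_symm]

/-- Expanding both squares, the off-diagonal terms cancel by anticommutation and the diagonal ones
add up to `b b* + b* b = 1`. Dropping either square gives the energy-free bound used for the species
`i₀`. -/
theorem IsCAR.smeared (h : IsCAR b bd) (i : ι) (J : Finset κ) (g : κ → ℂ) (φ : H) :
    ‖∑ x ∈ J, g x • bd i x φ‖ ^ 2 + ‖∑ x ∈ J, conj (g x) • b i x φ‖ ^ 2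
      = (∑ x ∈ J, ‖g x‖ ^ 2) * ‖φ‖ ^ 2 := by
  have key : (inner ℂ (∑ x ∈ J, g x • bd i x φ) (∑ x ∈ J, g x • bd i x φ) : ℂ) +
      inner ℂ (∑ x ∈ J, conj (g x) • b i x φ) (∑ x ∈ J, conj (g x) • b i x φ) =
      (∑ x ∈ J, (‖g x‖ : ℂ) ^ 2) * inner ℂ φ φ := by
    simp only [sum_inner, inner_sum, inner_smul_left, inner_smul_right, h.adj, h.adj',
      Finset.mul_sum]
    rw [Finset.sum_comm, ← Finset.sum_add_distrib, Finset.sum_mul]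
    refine Finset.sum_congr rfl fun x hx => ?_
    rw [← Finset.sum_add_distrib, Finset.sum_eq_single_of_mem x hx]
    · have := h.car i x x φ
      rw [if_pos rfl] at this
      have e : inner ℂ φ (b i x (bd i x φ)) + inner ℂ φ (bd i x (b i x φ)) = inner ℂ φ φ := by
        rw [← inner_add_right, this]
      rw [← e, ← Complex.mul_conj', starRingEnd_self_apply]
      ring
    · intro y _ hy
      have := h.car i x y φ
      rw [if_neg (Ne.symm hy)] at this
      rw [eq_neg_of_add_eq_zero_left this]
      simp only [inner_neg_right, starRingEnd_self_apply]
      ring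
  rw [inner_self_eq_ofReal, inner_self_eq_ofReal, inner_self_eq_ofReal] at key
  exact_mod_cast key

theorem IsCAR.norm_annihilate_le (h : IsCAR b bd) (i : ι) (a : κ) (φ : H) : ‖b i a φ‖ ≤ ‖φ‖ := by
  have := h.smeared i {a} (fun _ => 1) φ
  simp only [Finset.sum_singleton, one_smul, map_one, norm_one, one_pow, one_mul] at this
  nlinarith [norm_nonneg φ, norm_nonneg (b i a φ), sq_nonneg ‖bd i a φ‖]

/-- Normal ordering turns the square into the diagonal part minus the sum of `⟨b_y f_x, b_x f_y⟩`.
The weights make the remaining double sum factorise later, into a sum weighted by `v` over `x` and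
one weighted by `v⁻¹` over `y`. -/
theorem IsCAR.norm_sum_create_sq_le (h : IsCAR b bd) (i : ι) (J : Finset κ) (v : κ → ℝ) (hv : ∀ x, 0 < v x)
    (f : κ → H) :
    ‖∑ x ∈ J, bd i x (f x)‖ ^ 2 ≤
      ∑ x ∈ J, ‖f x‖ ^ 2 + ∑ x ∈ J, ∑ y ∈ J, v x * (v y)⁻¹ * ‖b i y (f x)‖ ^ 2 := by
  have key : ((‖∑ x ∈ J, bd i x (f x)‖ ^ 2 : ℝ) : ℂ) =
      ∑ x ∈ J, ((‖f x‖ ^ 2 : ℝ) : ℂ) - ∑ x ∈ J, ∑ y ∈ J, inner ℂ (b i y (f x)) (b i x (f y)) := by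
    rw [← inner_self_eq_ofReal]
    simp only [sum_inner, inner_sum, h.adj']
    rw [Finset.sum_comm, ← Finset.sum_sub_distrib]
    refine Finset.sum_congr rfl fun x hx => ?_
    have : ∀ y ∈ J, inner ℂ (f x) (b i x (bd i y (f y))) =
        (if y = x then ((‖f x‖ ^ 2 : ℝ) : ℂ) else 0) - inner ℂ (b i y (f x)) (b i x (f y)) := by
      intro y _
      rw [eq_sub_of_add_eq (h.car i x y (f y)), inner_sub_right, h.adj]
      congr 1
      by_cases hxy : x = y
      · subst hxy
        rw [if_pos rfl, if_pos rfl, inner_self_eq_ofReal]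
      · rw [if_neg hxy, if_neg (Ne.symm hxy), inner_zero_right]
    rw [Finset.sum_congr rfl this, Finset.sum_sub_distrib, Finset.sum_ite_eq' J x, if_pos hx]
  have h1 : ‖∑ x ∈ J, bd i x (f x)‖ ^ 2 ≤
      ∑ x ∈ J, ‖f x‖ ^ 2 + ∑ x ∈ J, ∑ y ∈ J, ‖b i y (f x)‖ * ‖b i x (f y)‖ := by
    have h2 : ‖((‖∑ x ∈ J, bd i x (f x)‖ ^ 2 : ℝ) : ℂ)‖ = ‖∑ x ∈ J, bd i x (f x)‖ ^ 2 := by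
      simp
    rw [← h2, key]
    refine (norm_sub_le _ _).trans (add_le_add ?_ ?_)
    · refine (norm_sum_le _ _).trans (le_of_eq (Finset.sum_congr rfl fun x _ => by simp))
    · refine (norm_sum_le _ _).trans (Finset.sum_le_sum fun x _ => ?_)
      exact (norm_sum_le _ _).trans (Finset.sum_le_sum fun y _ => norm_inner_le_norm _ _)
  refine h1.trans (add_le_add_right ?_ _)
  -- Weighted AM–GM with ratio `c = v x / v y`. The two halves have the same double sum after
  -- exchanging `x` and `y`.
  have hxy : ∀ x y, ‖b i y (f x)‖ * ‖b i x (f y)‖ ≤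
      (v x * (v y)⁻¹ * ‖b i y (f x)‖ ^ 2 + v y * (v x)⁻¹ * ‖b i x (f y)‖ ^ 2) / 2 := by
    intro x y
    have e : v x * (v y)⁻¹ * (v y * (v x)⁻¹) = 1 := by
      have := (hv x).ne'
      have := (hv y).ne'
      field_simp
    set c := v x * (v y)⁻¹
    set d := v y * (v x)⁻¹
    have hc : 0 < c := mul_pos (hv x) (inv_pos.2 (hv y))
    have hd : d = c⁻¹ := eq_inv_of_mul_eq_one_right e
    rw [hd]
    set p := ‖b i y (f x)‖
    set q := ‖b i x (f y)‖
    have : 0 ≤ c⁻¹ * (c * p - q) ^ 2 := by positivity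
    have e2 : c⁻¹ * (c * p - q) ^ 2 = c * p ^ 2 + c⁻¹ * q ^ 2 - 2 * (p * q) := by
      field_simp
      ring
    linarith
  have hs : ∑ x ∈ J, ∑ y ∈ J, v y * (v x)⁻¹ * ‖b i x (f y)‖ ^ 2 =
      ∑ x ∈ J, ∑ y ∈ J, v x * (v y)⁻¹ * ‖b i y (f x)‖ ^ 2 := Finset.sum_comm
  calc _ ≤ ∑ x ∈ J, ∑ y ∈ J,
        (v x * (v y)⁻¹ * ‖b i y (f x)‖ ^ 2 + v y * (v x)⁻¹ * ‖b i x (f y)‖ ^ 2) / 2 :=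
        Finset.sum_le_sum fun x _ => Finset.sum_le_sum fun y _ => hxy x y
    _ = _ := by
        simp only [add_div, Finset.sum_add_distrib, ← Finset.sum_div]
        rw [hs]; ring

/-- The operator `∑ g(α) ∏ b^*_{i,αᵢ} ∏ b_{i,αᵢ}` over the species in `i₀ :: L`, the values `α i`
for the other species being frozen; the species in `S` are created, the others annihilated. -/
def wickOp (b bd : ι → κ → H →ₗ[ℂ] H) (S : ι → Prop) [DecidablePred S] (J : Finset κ) (i₀ : ι)
    (g : (ι → κ) → ℂ) : List ι → (ι → κ) → H → H
  | [], α, φ => ∑ x ∈ J, g (Function.update α i₀ x) • (if S i₀ then bd i₀ x φ else b i₀ x φ)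
  | i :: L, α, φ => if S i
      then ∑ x ∈ J, bd i x (wickOp b bd S J i₀ g L (Function.update α i x) φ)
      else ∑ x ∈ J, wickOp b bd S J i₀ g L (Function.update α i x) (b i x φ)

/-- Weighted `ℓ²`-norm squared of the coefficients, over the species in `i₀ :: L`. -/
def wickWeight (v : ι → κ → ℝ) (J : Finset κ) (i₀ : ι) (g : (ι → κ) → ℂ) :
    List ι → (ι → κ) → ℝ
  | [], α => ∑ x ∈ J, ‖g (Function.update α i₀ x)‖ ^ 2
  | i :: L, α => ∑ x ∈ J, v i x * wickWeight v J i₀ g L (Function.update α i x)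

/-- The quadratic form `∑_R ∑_β ∏_{i ∈ R} v_i(β_i)⁻¹ ‖∏_{i ∈ R} b_{i,β_i} φ‖²`. -/
def wickForm (b : ι → κ → H →ₗ[ℂ] H) (v : ι → κ → ℝ) (J : Finset κ) : List ι → H → ℝ
  | [], φ => ‖φ‖ ^ 2
  | i :: L, φ => wickForm b v J L φ + ∑ y ∈ J, (v i y)⁻¹ * wickForm b v J L (b i y φ)

theorem wickForm_nonneg {v : ι → κ → ℝ} (hv : ∀ i x, 0 < v i x) (J : Finset κ) (L : List ι)
    (φ : H) : 0 ≤ wickForm b v J L φ := by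
  induction L generalizing φ with
  | nil => exact sq_nonneg _
  | cons i L ih =>
    exact add_nonneg (ih φ) (Finset.sum_nonneg fun y _ =>
      mul_nonneg (inv_nonneg.2 (hv i y).le) (ih _))

theorem wickWeight_nonneg {v : ι → κ → ℝ} (hv : ∀ i x, 0 < v i x) (J : Finset κ) (i₀ : ι)
    (g : (ι → κ) → ℂ) (L : List ι) (α : ι → κ) : 0 ≤ wickWeight v J i₀ g L α := by
  induction L generalizing α with
  | nil => exact Finset.sum_nonneg fun _ _ => sq_nonneg _
  | cons i L ih => exact Finset.sum_nonneg fun y _ => mul_nonneg (hv i y).le (ih _)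

/-- Different species commute, so an annihilator created by normal ordering in species `i` passes
through the remaining operators and lands on `φ`. -/
theorem IsCAR.annihilate_wickOp (h : IsCAR b bd) (S : ι → Prop) [DecidablePred S] (J : Finset κ) (i₀ : ι)
    (g : (ι → κ) → ℂ) (L : List ι) (i : ι) (hi : i ≠ i₀) (hL : i ∉ L) (y : κ) (α : ι → κ) (φ : H) :
    b i y (wickOp b bd S J i₀ g L α φ) = wickOp b bd S J i₀ g L α (b i y φ) := by
  induction L generalizing α φ with
  | nil =>
    simp only [wickOp, map_sum, map_smul]
    refine Finset.sum_congr rfl fun x _ => ?_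
    split_ifs
    · rw [h.comm' i i₀ hi]
    · rw [h.comm i i₀ hi]
  | cons j L ih =>
    have hj : i ≠ j := fun e => hL (by simp [e])
    have hL' : i ∉ L := fun e => hL (by simp [e])
    simp only [wickOp]
    split_ifs
    · rw [map_sum]
      exact Finset.sum_congr rfl fun x _ => by rw [h.comm' i j hj, ih hL']
    · rw [map_sum]
      exact Finset.sum_congr rfl fun x _ => by rw [ih hL', h.comm i j hj]

/-- Induction over the species, with `IsCAR.smeared` for `i₀` at the bottom. For a created species
the two terms of `IsCAR.norm_sum_create_sq_le` match the two terms of `wickForm`; the first of them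
needs `v ≥ 1`. For an annihilated species Cauchy–Schwarz yields the second term alone. -/
theorem IsCAR.norm_wickOp_sq_le (h : IsCAR b bd) (S : ι → Prop) [DecidablePred S] (J : Finset κ) (i₀ : ι)
    (g : (ι → κ) → ℂ) {v : ι → κ → ℝ} (hv : ∀ i x, 1 ≤ v i x) (L : List ι) (hi₀ : i₀ ∉ L)
    (hL : L.Nodup) (α : ι → κ) (φ : H) :
    ‖wickOp b bd S J i₀ g L α φ‖ ^ 2 ≤ wickWeight v J i₀ g L α * wickForm b v J L φ := by
  have hv0 : ∀ i x, 0 < v i x := fun i x => zero_lt_one.trans_le (hv i x)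
  induction L generalizing α φ with
  | nil =>
    simp only [wickOp, wickWeight, wickForm]
    split_ifs
    · have := h.smeared i₀ J (fun x => g (Function.update α i₀ x)) φ
      nlinarith [sq_nonneg ‖∑ x ∈ J, conj (g (Function.update α i₀ x)) • b i₀ x φ‖]
    · have := h.smeared i₀ J (fun x => conj (g (Function.update α i₀ x))) φ
      simp only [starRingEnd_self_apply, RCLike.norm_conj] at this
      nlinarith [sq_nonneg ‖∑ x ∈ J, conj (g (Function.update α i₀ x)) • bd i₀ x φ‖]
  | cons i L ih =>
    have hi : i ≠ i₀ := fun e => hi₀ (by simp [e])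
    have hi₀' : i₀ ∉ L := fun e => hi₀ (by simp [e])
    have hiL : i ∉ L := (List.nodup_cons.1 hL).1
    have hL' := (List.nodup_cons.1 hL).2
    have hW := wickWeight_nonneg hv0 J i₀ g L
    have hQ := wickForm_nonneg (b := b) hv0 J L
    simp only [wickOp, wickWeight, wickForm]
    split_ifs
    · refine (h.norm_sum_create_sq_le i J (v i) (hv0 i) _).trans ?_
      rw [mul_add]
      refine add_le_add ?_ ?_
      · rw [Finset.sum_mul]
        refine Finset.sum_le_sum fun x _ => (ih hi₀' hL' _ _).trans ?_
        exact mul_le_mul_of_nonneg_right (le_mul_of_one_le_left (hW _) (hv i x)) (hQ _)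
      · rw [Finset.sum_mul_sum]
        refine Finset.sum_le_sum fun x _ => Finset.sum_le_sum fun y _ => ?_
        rw [h.annihilate_wickOp S J i₀ g L i hi hiL]
        have := mul_le_mul_of_nonneg_left (ih hi₀' hL' (Function.update α i x) (b i y φ))
          (mul_pos (hv0 i x) (inv_pos.2 (hv0 i y))).le
        refine this.trans (le_of_eq (by ring))
    · have h1 : ‖∑ x ∈ J, wickOp b bd S J i₀ g L (Function.update α i x) (b i x φ)‖ ≤
          ∑ x ∈ J, Real.sqrt (v i x * wickWeight v J i₀ g L (Function.update α i x)) *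
            Real.sqrt ((v i x)⁻¹ * wickForm b v J L (b i x φ)) := by
        refine (norm_sum_le _ _).trans (Finset.sum_le_sum fun x _ => ?_)
        rw [← Real.sqrt_mul (mul_nonneg (hv0 i x).le (hW _))]
        refine Real.le_sqrt_of_sq_le ((ih hi₀' hL' _ _).trans (le_of_eq ?_))
        have := (hv0 i x).ne'
        field_simp
      have h2 := pow_le_pow_left₀ (norm_nonneg _) h1 2
      refine (h2.trans (Finset.sum_mul_sq_le_sq_mul_sq _ _ _)).trans ?_
      have e1 : ∀ x ∈ J, Real.sqrt (v i x * wickWeight v J i₀ g L (Function.update α i x)) ^ 2 =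
          v i x * wickWeight v J i₀ g L (Function.update α i x) := fun x _ =>
        Real.sq_sqrt (mul_nonneg (hv0 i x).le (hW _))
      have e2 : ∀ x ∈ J, Real.sqrt ((v i x)⁻¹ * wickForm b v J L (b i x φ)) ^ 2 =
          (v i x)⁻¹ * wickForm b v J L (b i x φ) := fun x _ =>
        Real.sq_sqrt (mul_nonneg (inv_pos.2 (hv0 i x)).le (hQ _))
      rw [Finset.sum_congr rfl e1, Finset.sum_congr rfl e2]
      refine mul_le_mul_of_nonneg_left (le_add_of_nonneg_left (hQ φ)) ?_
      exact Finset.sum_nonneg fun x _ => mul_nonneg (hv0 i x).le (hW _)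

end CAR

/-! ### Fermionic operators on alternating functions of lists -/

section Lists

variable {κ : Type*} [DecidableEq κ]

/-- Alternating functions on lists. -/
def IsAlt {κ : Type*} (f : List κ → ℂ) : Prop :=
  ∀ l₁ x y l₂, f (l₁ ++ x :: y :: l₂) = -f (l₁ ++ y :: x :: l₂)

theorem IsAlt.cons {κ : Type*} {f : List κ → ℂ} (hf : IsAlt f) (x : κ) :
    IsAlt fun L => f (x :: L) :=
  fun l₁ y z l₂ => hf (x :: l₁) y z l₂

/-- `∑ₐ (-1)^a [Lₐ = β] f (L without its a-th entry)`. -/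
def creL (β : κ) : List κ → (List κ → ℂ) → ℂ
  | [], _ => 0
  | x :: L, f => (if x = β then f L else 0) - creL β L fun M => f (x :: M)

theorem creL_add (β : κ) (L : List κ) (f g : List κ → ℂ) :
    creL β L (fun M => f M + g M) = creL β L f + creL β L g := by
  induction L generalizing f g with
  | nil => simp [creL]
  | cons x L ih =>
    simp only [creL, ih]
    split_ifs <;> ring

theorem creL_smul (β : κ) (L : List κ) (c : ℂ) (f : List κ → ℂ) :
    creL β L (fun M => c * f M) = c * creL β L f := by
  induction L generalizing f with
  | nil => simp [creL]
  | cons x L ih =>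
    simp only [creL, ih]
    split_ifs <;> ring

theorem creL_length_smul (β : κ) (L : List κ) (c : ℕ → ℂ) (f : List κ → ℂ) :
    creL β L (fun M => c (M.length + 1) * f M) = c L.length * creL β L f := by
  induction L generalizing f c with
  | nil => simp [creL]
  | cons x L ih =>
    simp only [creL, List.length_cons, ih (fun k => c (k + 1))]
    split_ifs <;> ring

/-- If the exchanged entries stand at the head, the two terms deleting one of them are interchanged
with opposite signs, and the deeper terms change sign because `f` does. Otherwise the first entry is
peeled off. -/
theorem creL_isAlt (β : κ) {f : List κ → ℂ} (hf : IsAlt f) : IsAlt fun L => creL β L f := by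
  intro l₁ x y l₂
  induction l₁ generalizing f with
  | nil =>
    have h : (fun M => f (y :: x :: M)) = fun M => (-1) * f (x :: y :: M) := by
      funext M
      rw [show f (y :: x :: M) = -f (x :: y :: M) from hf [] y x M]
      ring
    simp only [List.nil_append, creL, h, creL_smul]
    ring
  | cons z l₁ ih =>
    have e := hf.cons z
    have h1 := ih e
    simp only [List.cons_append, creL] at h1 ⊢
    rw [h1, hf l₁ x y l₂]
    split_ifs <;> ring

theorem exists_of_creL_ne_zero (β : κ) (L : List κ) (f : List κ → ℂ) (h : creL β L f ≠ 0) :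
    ∃ M₁ M₂, L = M₁ ++ β :: M₂ ∧ f (M₁ ++ M₂) ≠ 0 := by
  induction L generalizing f with
  | nil => simp [creL] at h
  | cons x L ih =>
    simp only [creL] at h
    by_cases h0 : creL β L (fun M => f (x :: M)) = 0
    · rw [h0, sub_zero] at h
      split_ifs at h with hx
      · exact ⟨[], L, by simp [hx], h⟩
      · exact absurd rfl h
    · obtain ⟨M₁, M₂, h1, h2⟩ := ih _ h0
      exact ⟨x :: M₁, M₂, by simp [h1], h2⟩

theorem tsum_list_eq {h : List κ → ℂ} (hh : h.support.Finite) :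
    ∑' L, h L = h [] + ∑' x, ∑' L, h (x :: L) := by
  have hs : Summable h := summable_of_hasFiniteSupport hh
  have hinj : Function.Injective fun z : κ × List κ => z.1 :: z.2 := by
    rintro ⟨x, L⟩ ⟨y, M⟩ e
    simpa using e
  rw [hs.tsum_eq_add_tsum_ite []]
  congr 1
  rw [← hinj.tsum_eq]
  · have : Summable fun z : κ × List κ => h (z.1 :: z.2) := hs.comp_injective hinj
    simp only [reduceCtorEq, if_false]
    rw [this.tsum_prod]
  · intro L hL
    cases L with
    | nil => simp at hL
    | cons x L => exact ⟨(x, L), rfl⟩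

theorem finite_support_cons {κ : Type*} {f : List κ → ℂ} (hf : f.support.Finite) (x : κ) :
    (fun L => f (x :: L)).support.Finite :=
  hf.preimage (f := fun L => x :: L) fun _ _ _ _ e => (List.cons.inj e).2

theorem finite_support_mul_left {α : Type*} {f g : α → ℂ} (hf : f.support.Finite) :
    (fun a => f a * g a).support.Finite :=
  hf.subset fun a ha h => ha (by simp [Function.notMem_support.1 (by simpa using h)])

/-- This is the adjointness of creation and annihilation before normalisation. Moving the deleted
`β` to the front of an alternating `ψ` compensates the sign of its position, so all `length + 1`
positions contribute equally. The weight `v` is arbitrary so that the induction can shift it. -/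
theorem tsum_mul_creL (β : κ) {ψ : List κ → ℂ} (hψ : ψ.support.Finite) (ha : IsAlt ψ)
    (f : List κ → ℂ) (v : ℕ → ℂ) :
    ∑' L, ψ L * (v L.length * creL β L f) =
      ∑' L, ψ (β :: L) * (v (L.length + 1) * ((L.length + 1 : ℕ) : ℂ) * f L) := by
  -- Lengths are bounded on the finite support of `ψ`; the induction is on this bound, since fixing
  -- the first entry shortens the lists.
  obtain ⟨N, hN⟩ : ∃ N, ∀ L, ψ L ≠ 0 → L.length < N := by
    obtain ⟨N, hN⟩ := (hψ.image List.length).bddAbove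
    exact ⟨N + 1, fun L hL => Nat.lt_succ_of_le (hN ⟨L, hL, rfl⟩)⟩
  induction N generalizing ψ f v with
  | zero =>
    have : ψ = 0 := by
      funext L
      by_contra h
      exact absurd (hN L h) (by simp)
    simp [this]
  | succ N ih =>
    rw [tsum_list_eq (finite_support_mul_left hψ),
      tsum_list_eq (finite_support_mul_left (finite_support_cons hψ β))]
    have hcons : ∀ x, (fun L => ψ (x :: L)).support.Finite := finite_support_cons hψ
    -- Either the first entry is the deleted `β`, or the deletion occurs further on; in the second
    -- case exchanging `x` and `β` in `ψ` absorbs the minus sign of `creL`.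
    have step : ∀ x, ∑' L, ψ (x :: L) * (v (x :: L).length * creL β (x :: L) f) =
        (if x = β then ∑' L, ψ (β :: L) * (v (L.length + 1) * f L) else 0) +
        ∑' L, ψ (β :: x :: L) * (v (L.length + 2) * ((L.length + 1 : ℕ) : ℂ) * f (x :: L)) := by
      intro x
      have h1 : ∀ L, ψ (x :: L) * (v (x :: L).length * creL β (x :: L) f) =
          (if x = β then ψ (β :: L) * (v (L.length + 1) * f L) else 0) -
          ψ (x :: L) * (v (L.length + 1) * creL β L fun M => f (x :: M)) := by
        intro L
        simp only [creL, List.length_cons]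
        split_ifs with hx
        · rw [hx]; ring
        · ring
      simp only [h1]
      rw [Summable.tsum_sub]
      · have h2 := ih (hcons x) (ha.cons x) (fun M => f (x :: M)) (fun k => v (k + 1)) (by
          intro L hL
          have := hN _ hL
          simpa using this)
        rw [h2, sub_eq_add_neg, ← tsum_neg]
        congr 1
        · split_ifs <;> simp
        · refine tsum_congr fun L => ?_
          rw [show ψ (x :: β :: L) = -ψ (β :: x :: L) from ha [] x β L]
          ring_nf
      · refine summable_of_hasFiniteSupport ((hcons β).subset fun L hL h => hL ?_)
        have : ψ (β :: L) = 0 := by simpa using h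
        simp [this]
      · exact summable_of_hasFiniteSupport (finite_support_mul_left (hcons x))
    simp only [step]
    have hψβ := hcons β
    have hsum2 : Summable fun x => ∑' L, ψ (β :: x :: L) *
        (v (L.length + 2) * ((L.length + 1 : ℕ) : ℂ) * f (x :: L)) := by
      have hinj : Function.Injective fun z : κ × List κ => z.1 :: z.2 := by
        rintro ⟨x, L⟩ ⟨y, M⟩ e
        simpa using e
      have : Summable fun z : κ × List κ => ψ (β :: z.1 :: z.2) *
        (v (z.2.length + 2) * ((z.2.length + 1 : ℕ) : ℂ) * f (z.1 :: z.2)) :=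
        summable_of_hasFiniteSupport (finite_support_mul_left
          (hψβ.preimage (f := fun z : κ × List κ => z.1 :: z.2) hinj.injOn))
      exact this.prod
    rw [Summable.tsum_add _ hsum2, tsum_ite_eq]
    · have hs1 : Summable fun L => ψ (β :: L) * (v (L.length + 1) * f L) :=
        summable_of_hasFiniteSupport (finite_support_mul_left hψβ)
      rw [tsum_list_eq (finite_support_mul_left hψβ)]
      simp only [creL, mul_zero, zero_add, List.length_nil, List.length_cons, Nat.cast_one,
        mul_one]
      rw [add_assoc]
      congr 1
      have hsum3 : Summable fun x => ∑' L, ψ (β :: x :: L) *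
          (v (L.length + 1 + 1) * f (x :: L)) := by
        have hinj : Function.Injective fun z : κ × List κ => z.1 :: z.2 := by
          rintro ⟨x, L⟩ ⟨y, M⟩ e
          simpa using e
        exact (hs1.comp_injective hinj).prod
      rw [← Summable.tsum_add hsum3 hsum2]
      refine tsum_congr fun x => ?_
      rw [← Summable.tsum_add]
      · refine tsum_congr fun L => ?_
        push_cast
        ring
      · exact summable_of_hasFiniteSupport
          (finite_support_mul_left (finite_support_cons hψβ x))
      · exact summable_of_hasFiniteSupport
          (finite_support_mul_left (finite_support_cons hψβ x))
    · exact summable_of_hasFiniteSupport ((Set.finite_singleton β).subset fun x hx => by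
        by_contra h
        exact hx (if_neg h))

end Lists

/-! ### The pre-Hilbert space of alternating functions and its anticommutation relations -/

section AltSpace

set_option linter.unusedSectionVars false

variable {n : ℕ} {κ : Type*} [DecidableEq κ]

/-- Lists of one-particle states, one for each species. -/
abbrev Occ (n : ℕ) (κ : Type*) : Type _ := Fin n → List κ

/-- Alternating in the list of each species. -/
def IsAltOcc {n : ℕ} {κ : Type*} (f : Occ n κ → ℂ) : Prop :=
  ∀ i A, IsAlt fun L => f (Function.update A i L)

/-- The pre-Hilbert space of finitely supported alternating functions. -/
def altSpace (n : ℕ) (κ : Type*) : Submodule ℂ (lp (fun _ : Occ n κ => ℂ) 2) where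
  carrier := {f | (Function.support (f : Occ n κ → ℂ)).Finite ∧ IsAltOcc (f : Occ n κ → ℂ)}
  zero_mem' := ⟨Set.finite_empty.subset fun A hA => hA rfl, fun i A l₁ x y l₂ => by simp⟩
  add_mem' := by
    rintro f g ⟨hf, hf'⟩ ⟨hg, hg'⟩
    refine ⟨(hf.union hg).subset (Function.support_add _ _), fun i A l₁ x y l₂ => ?_⟩
    have h1 := hf' i A l₁ x y l₂
    have h2 := hg' i A l₁ x y l₂
    simp only [lp.coeFn_add, Pi.add_apply] at h1 h2 ⊢
    rw [h1, h2]; ring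
  smul_mem' := by
    rintro c f ⟨hf, hf'⟩
    refine ⟨hf.subset (Function.support_const_smul_subset _ _), fun i A l₁ x y l₂ => ?_⟩
    have h1 := hf' i A l₁ x y l₂
    simp only [lp.coeFn_smul, Pi.smul_apply, smul_eq_mul] at h1 ⊢
    rw [h1]; ring

/-- The underlying function. -/
def altFun (f : altSpace n κ) : Occ n κ → ℂ := (f : lp (fun _ : Occ n κ => ℂ) 2)

theorem altFun_finite (f : altSpace n κ) : (altFun f).support.Finite := f.2.1

theorem altFun_isAlt (f : altSpace n κ) : IsAltOcc (altFun f) := f.2.2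

/-- A finitely supported alternating function as a vector. -/
def altMk (f : Occ n κ → ℂ) (hf : f.support.Finite) (hf' : IsAltOcc f) : altSpace n κ :=
  ⟨⟨f, memℓp_gen (summable_of_hasFiniteSupport (hf.subset fun A hA h => hA (by
    have : f A = 0 := by simpa using h
    simp [this])))⟩, hf, hf'⟩

theorem altFun_mk (f : Occ n κ → ℂ) (hf : f.support.Finite) (hf' : IsAltOcc f) :
    altFun (altMk f hf hf') = f := rfl

theorem altFun_ext {f g : altSpace n κ} (h : ∀ A, altFun f A = altFun g A) : f = g :=
  Subtype.ext (lp.ext (funext h))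

theorem altFun_add (f g : altSpace n κ) (A : Occ n κ) :
    altFun (f + g) A = altFun f A + altFun g A := rfl

theorem altFun_smul (c : ℂ) (f : altSpace n κ) (A : Occ n κ) :
    altFun (c • f) A = c * altFun f A := rfl

theorem altFun_zero (A : Occ n κ) : altFun (0 : altSpace n κ) A = 0 := rfl

theorem inner_altSpace (f g : altSpace n κ) :
    inner ℂ f g = ∑' A, conj (altFun f A) * altFun g A := by
  rw [Submodule.coe_inner, lp.inner_eq_tsum]
  refine tsum_congr fun A => ?_
  rw [RCLike.inner_apply, mul_comm]
  rfl

theorem norm_altSpace_sq (f : altSpace n κ) : ‖f‖ ^ 2 = ∑' A, ‖altFun f A‖ ^ 2 := by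
  have h := inner_altSpace f f
  rw [inner_self_eq_ofReal] at h
  have : ((∑' A, ‖altFun f A‖ ^ 2 : ℝ) : ℂ) = ∑' A, conj (altFun f A) * altFun f A := by
    push_cast
    exact tsum_congr fun A => by rw [Complex.conj_mul']
  rw [← this] at h
  exact_mod_cast h

/-- The annihilation operator on functions of lists, without the signs between species. -/
def annFun (i : Fin n) (α : κ) (f : Occ n κ → ℂ) (A : Occ n κ) : ℂ :=
  (Real.sqrt ((A i).length + 1) : ℂ) * f (Function.update A i (α :: A i))

/-- The creation operator on functions of lists, without the signs between species. -/
def creFun (i : Fin n) (α : κ) (f : Occ n κ → ℂ) (A : Occ n κ) : ℂ :=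
  (Real.sqrt (A i).length : ℂ)⁻¹ * creL α (A i) fun L => f (Function.update A i L)

theorem annFun_isAlt (i : Fin n) (α : κ) {f : Occ n κ → ℂ} (hf : IsAltOcc f) :
    IsAltOcc (annFun i α f) := by
  intro j A l₁ x y l₂
  simp only [annFun]
  by_cases h : j = i
  · subst h
    have := hf j A (α :: l₁) x y l₂
    simp only [List.cons_append] at this
    simp only [Function.update_self, Function.update_idem, this, List.length_append,
      List.length_cons]
    ring
  · have h' : i ≠ j := Ne.symm h
    simp only [Function.update_of_ne h', Function.update_comm h]
    rw [show f (Function.update (Function.update A i (α :: A i)) j (l₁ ++ x :: y :: l₂)) = _ from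
      hf j (Function.update A i (α :: A i)) l₁ x y l₂]
    ring

theorem creFun_isAlt (i : Fin n) (α : κ) {f : Occ n κ → ℂ} (hf : IsAltOcc f) :
    IsAltOcc (creFun i α f) := by
  intro j A l₁ x y l₂
  simp only [creFun]
  by_cases h : j = i
  · subst h
    have := creL_isAlt α (hf j A) l₁ x y l₂
    simp only [Function.update_self, Function.update_idem, List.length_append,
      List.length_cons]
    simp only at this
    rw [this]
    ring
  · have h' : i ≠ j := Ne.symm h
    simp only [Function.update_of_ne h', Function.update_comm h]
    have : (fun L => f (Function.update (Function.update A i L) j (l₁ ++ x :: y :: l₂))) =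
        fun L => (-1) * f (Function.update (Function.update A i L) j (l₁ ++ y :: x :: l₂)) := by
      funext L
      rw [show f (Function.update (Function.update A i L) j (l₁ ++ x :: y :: l₂)) = _ from
        hf j (Function.update A i L) l₁ x y l₂]
      ring
    rw [this, creL_smul]
    ring

theorem update_cons_injective (i : Fin n) (α : κ) :
    Function.Injective fun A : Occ n κ => Function.update A i (α :: A i) := by
  intro A B e
  funext j
  have := congrFun e j
  by_cases h : j = i
  · subst h
    simpa using this
  · simpa [h] using this

theorem annFun_finite (i : Fin n) (α : κ) {f : Occ n κ → ℂ} (hf : f.support.Finite) :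
    (annFun i α f).support.Finite := by
  refine (hf.preimage (update_cons_injective i α).injOn).subset fun A hA h => hA ?_
  have : f (Function.update A i (α :: A i)) = 0 := by simpa using h
  simp [annFun, this]

theorem creFun_finite (i : Fin n) (α : κ) {f : Occ n κ → ℂ} (hf : f.support.Finite) :
    (creFun i α f).support.Finite := by
  -- Every list in the new support arises by inserting `α` at some position of a list in the old
  -- one.
  have : (⋃ B ∈ f.support, (fun k : ℕ => Function.update B i
      ((B i).take k ++ α :: (B i).drop k)) '' Set.Iic (B i).length).Finite :=
    hf.biUnion fun B _ => (Set.finite_Iic _).image _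
  refine this.subset fun A hA => ?_
  have h1 : creL α (A i) (fun L => f (Function.update A i L)) ≠ 0 := fun h =>
    hA (by simp [creFun, h])
  obtain ⟨M₁, M₂, e, h2⟩ := exists_of_creL_ne_zero _ _ _ h1
  refine Set.mem_biUnion (x := Function.update A i (M₁ ++ M₂)) h2 ⟨M₁.length, by simp, ?_⟩
  simp only [Function.update_self, Function.update_idem, List.take_left, List.drop_left]
  rw [← e, Function.update_eq_self]

/-- Annihilation operators on the pre-Hilbert space of alternating functions. -/
def annOp (i : Fin n) (α : κ) : altSpace n κ →ₗ[ℂ] altSpace n κ where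
  toFun f := altMk (annFun i α (altFun f)) (annFun_finite i α (altFun_finite f))
    (annFun_isAlt i α (altFun_isAlt f))
  map_add' f g := altFun_ext fun A => by
    simp only [altFun_mk, altFun_add, annFun]; ring
  map_smul' c f := altFun_ext fun A => by
    simp only [altFun_mk, altFun_smul, annFun, RingHom.id_apply]; ring

/-- Creation operators on the pre-Hilbert space of alternating functions. -/
def creOp (i : Fin n) (α : κ) : altSpace n κ →ₗ[ℂ] altSpace n κ where
  toFun f := altMk (creFun i α (altFun f)) (creFun_finite i α (altFun_finite f))
    (creFun_isAlt i α (altFun_isAlt f))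
  map_add' f g := altFun_ext fun A => by
    simp only [altFun_mk, altFun_add, creFun, creL_add]; ring
  map_smul' c f := altFun_ext fun A => by
    simp only [altFun_mk, altFun_smul, creFun, creL_smul, RingHom.id_apply]; ring

theorem altFun_annOp (i : Fin n) (α : κ) (f : altSpace n κ) :
    altFun (annOp i α f) = annFun i α (altFun f) := rfl

theorem altFun_creOp (i : Fin n) (α : κ) (f : altSpace n κ) :
    altFun (creOp i α f) = creFun i α (altFun f) := rfl

theorem tsum_occ_eq (i : Fin n) {h : Occ n κ → ℂ} (hh : h.support.Finite) :
    ∑' A, h A = ∑' r : {j // j ≠ i} → List κ, ∑' L,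
      h (Function.update ((Equiv.funSplitAt i (List κ)).symm ([], r)) i L) := by
  have hs : Summable h := summable_of_hasFiniteSupport hh
  have hs' : Summable fun z => h ((Equiv.funSplitAt i (List κ)).symm z) :=
    (Equiv.summable_iff _).2 hs
  rw [← (Equiv.funSplitAt i (List κ)).symm.tsum_eq h, hs'.tsum_prod, ← Summable.tsum_comm]
  · refine tsum_congr fun r => tsum_congr fun L => ?_
    congr 1
    funext j
    by_cases hj : j = i
    · subst hj; simp [Equiv.funSplitAt, Equiv.piSplitAt]
    · simp [Equiv.funSplitAt, Equiv.piSplitAt, hj]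
  · exact hs'

/-- With the lists of the other species fixed, this is `tsum_mul_creL` for the weight `1 / √k`,
because `(k + 1) / √(k + 1) = √(k + 1)`. -/
theorem annOp_adjoint (i : Fin n) (α : κ) (f g : altSpace n κ) :
    inner ℂ (annOp i α f) g = inner ℂ f (creOp i α g) := by
  have hc : ∀ {f : Occ n κ → ℂ}, f.support.Finite → (fun A => conj (f A)).support.Finite :=
    fun hf => hf.subset fun A hA h => hA (by
      change conj _ = (0 : ℂ)
      rw [h, map_zero])
  rw [inner_altSpace, inner_altSpace, tsum_occ_eq i, tsum_occ_eq i]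
  · refine tsum_congr fun r => ?_
    simp only [altFun_annOp, altFun_creOp, annFun, creFun, Function.update_self,
      Function.update_idem, map_mul, Complex.conj_ofReal]
    set A₀ := (Equiv.funSplitAt i (List κ)).symm ([], r)
    have hinj : Function.Injective (fun L => Function.update A₀ i L) :=
      Function.update_injective A₀ i
    have hfin : (fun L => conj (altFun f (Function.update A₀ i L))).support.Finite :=
      (hc (altFun_finite f)).preimage (f := fun L => Function.update A₀ i L) hinj.injOn
    have halt : IsAlt fun L => conj (altFun f (Function.update A₀ i L)) := by
      intro l₁ x y l₂
      have := altFun_isAlt f i A₀ l₁ x y l₂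
      simp only at this ⊢
      rw [this, map_neg]
    have := tsum_mul_creL α hfin halt (fun L => altFun g (Function.update A₀ i L))
      (fun k => (Real.sqrt k : ℂ)⁻¹)
    rw [this]
    refine tsum_congr fun L => ?_
    have h1 : ((L.length + 1 : ℕ) : ℂ) =
        (Real.sqrt (L.length + 1 : ℕ) : ℂ) * (Real.sqrt (L.length + 1 : ℕ) : ℂ) := by
      rw [← Complex.ofReal_mul, Real.mul_self_sqrt (by positivity)]
      simp
    have h2 : (Real.sqrt (L.length + 1 : ℕ) : ℂ) ≠ 0 := by
      rw [Ne, Complex.ofReal_eq_zero, Real.sqrt_eq_zero (by positivity)]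
      positivity
    rw [h1, inv_mul_cancel_left₀ h2]
    push_cast
    ring
  · exact finite_support_mul_left (hc (altFun_finite f))
  · exact finite_support_mul_left (hc (altFun_finite _))

/-- Creating `c` and then removing the first entry `a` either deletes that very entry, which gives
the Kronecker delta, or acts on the tail with a minus sign and cancels against the opposite order.
The square roots of the lengths agree in both orders. -/
theorem isCAR_altSpace : IsCAR (annOp (n := n) (κ := κ)) creOp where
  adj := annOp_adjoint
  car i a c f := by
    refine altFun_ext fun A => ?_
    rw [altFun_add]
    simp only [altFun_annOp, altFun_creOp, annFun, creFun, Function.update_self,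
      Function.update_idem, List.length_cons, creL]
    have hl := creL_length_smul c (A i) (fun k => (Real.sqrt k : ℂ))
      (fun L => altFun f (Function.update A i (a :: L)))
    push_cast at hl
    rw [hl]
    have h2 : (Real.sqrt ((A i).length + 1 : ℝ) : ℂ) ≠ 0 := by
      rw [Ne, Complex.ofReal_eq_zero, Real.sqrt_eq_zero (by positivity)]
      positivity
    push_cast
    rw [mul_inv_cancel_left₀ h2, Function.update_eq_self]
    -- At the empty list the normalisation `(√0)⁻¹` is `0` by convention, but `creL` vanishes there
    -- as well.
    by_cases h0 : A i = []
    · rw [h0]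
      simp only [creL]
      split_ifs <;> simp [altFun_zero]
    · have h3 : (Real.sqrt ((A i).length : ℝ) : ℂ) ≠ 0 := by
        rw [Ne, Complex.ofReal_eq_zero, Real.sqrt_eq_zero (by positivity)]
        simpa using h0
      rw [inv_mul_cancel_left₀ h3]
      split_ifs
      · ring
      · simp [altFun_zero]
  comm i j hij a c f := by
    refine altFun_ext fun A => ?_
    simp only [altFun_annOp, annFun, Function.update_of_ne hij, Function.update_of_ne hij.symm,
      Function.update_comm hij]
    ring
  comm' i j hij a c f := by
    refine altFun_ext fun A => ?_
    simp only [altFun_annOp, altFun_creOp, annFun, creFun, Function.update_of_ne hij,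
      Function.update_of_ne hij.symm, creL_smul, Function.update_comm hij]
    ring

end AltSpace

/-! ### Unfolding the recursive estimate into sums over multi-indices -/

section Unfold

set_option linter.unusedSectionVars false

variable {n : ℕ} {κ : Type*} [DecidableEq κ]

/-- The multi-indices with entries in `J` for the species in `L`, frozen at `α` elsewhere. -/
def boxOn (J : Finset κ) (L : List (Fin n)) (α : Fin n → κ) : Finset (Fin n → κ) :=
  Fintype.piFinset fun i => if i ∈ L then J else {α i}

theorem boxOn_nil (J : Finset κ) (α : Fin n → κ) : boxOn J [] α = {α} := by
  ext β
  simp [boxOn, funext_iff]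

theorem mem_boxOn {J : Finset κ} {L : List (Fin n)} {α β : Fin n → κ} :
    β ∈ boxOn J L α ↔ ∀ i, (i ∈ L → β i ∈ J) ∧ (i ∉ L → β i = α i) := by
  simp only [boxOn, Fintype.mem_piFinset]
  refine forall_congr' fun i => ?_
  split_ifs with h <;> simp [h]

theorem sum_boxOn_cons {M : Type*} [AddCommMonoid M] (J : Finset κ) (L : List (Fin n)) (i : Fin n)
    (hi : i ∉ L) (α : Fin n → κ) (F : (Fin n → κ) → M) :
    ∑ β ∈ boxOn J (i :: L) α, F β =
      ∑ x ∈ J, ∑ β ∈ boxOn J L (Function.update α i x), F β := by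
  rw [← Finset.sum_fiberwise_of_maps_to (s := boxOn J (i :: L) α) (t := J) (g := fun β => β i)]
  · refine Finset.sum_congr rfl fun x hx => Finset.sum_congr ?_ fun _ _ => rfl
    ext β
    simp only [Finset.mem_filter, mem_boxOn, List.mem_cons]
    constructor
    · rintro ⟨h, rfl⟩ j
      refine ⟨fun hj => (h j).1 (Or.inr hj), fun hj => ?_⟩
      by_cases e : j = i
      · subst e; simp
      · rw [Function.update_of_ne e]
        exact (h j).2 (by simp [e, hj])
    · intro h
      have hβ : β i = x := by simpa using (h i).2 hi
      refine ⟨fun j => ⟨fun hj => ?_, fun hj => ?_⟩, hβ⟩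
      · rcases hj with rfl | hj
        · rw [hβ]; exact hx
        · exact (h j).1 hj
      · push Not at hj
        rw [(h j).2 hj.2, Function.update_of_ne hj.1]
  · intro β hβ
    exact ((mem_boxOn.1 hβ) i).1 (by simp)

theorem boxOn_apply_of_mem {J : Finset κ} {L : List (Fin n)} {α β : Fin n → κ} {i : Fin n} {x : κ}
    (hi : i ∉ L) (h : β ∈ boxOn J L (Function.update α i x)) : β i = x := by
  simpa using ((mem_boxOn.1 h) i).2 hi

/-- The annihilation operators `b_{i,βᵢ}`, `i ∈ L`, applied one after the other. -/
def annFold (L : List (Fin n)) (β : Fin n → κ) (f : altSpace n κ) : altSpace n κ :=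
  L.foldl (fun g i => annOp i (β i) g) f

/-- Prepend `β i` to the list of species `i`, for all `i ∈ L`. -/
def consOcc (L : List (Fin n)) (β : Fin n → κ) (A : Occ n κ) : Occ n κ :=
  fun i => if i ∈ L then β i :: A i else A i

theorem altFun_annFold (L : List (Fin n)) (hL : L.Nodup) (β : Fin n → κ) (f : altSpace n κ)
    (A : Occ n κ) :
    altFun (annFold L β f) A =
      ((∏ i ∈ L.toFinset, Real.sqrt ((A i).length + 1) : ℝ) : ℂ) * altFun f (consOcc L β A) := by
  induction L generalizing f with
  | nil =>
    have : consOcc [] β A = A := by funext i; simp [consOcc]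
    simp [annFold, this]
  | cons i L ih =>
    obtain ⟨hi, hL'⟩ := List.nodup_cons.1 hL
    have e1 : annFold (i :: L) β f = annFold L β (annOp i (β i) f) := rfl
    have e2 : consOcc L β A i = A i := by simp [consOcc, hi]
    have e3 : Function.update (consOcc L β A) i (β i :: A i) = consOcc (i :: L) β A := by
      funext j
      by_cases h : j = i
      · subst h; simp [consOcc]
      · simp [consOcc, h]
    rw [e1, ih hL', altFun_annOp, annFun, e2, e3, List.toFinset_cons,
      Finset.prod_insert (by simpa using hi)]
    push_cast
    ring

/-- Each creator is moved to the other side of the inner product, where it annihilates `ψ`; the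
annihilators stay on `φ`. -/
theorem inner_wickOp (S : Fin n → Prop) [DecidablePred S] (J : Finset κ) (i₀ : Fin n)
    (g : (Fin n → κ) → ℂ) (L : List (Fin n)) (hL : L.Nodup) (hi₀ : i₀ ∉ L) (α : Fin n → κ)
    (ψ φ : altSpace n κ) :
    inner ℂ ψ (wickOp annOp creOp S J i₀ g L α φ) =
      ∑ β ∈ boxOn J (L ++ [i₀]) α, g β *
        inner ℂ (annFold ((L ++ [i₀]).filter fun i => S i) β ψ)
          (annFold ((L ++ [i₀]).filter fun i => ¬ S i) β φ) := by
  induction L generalizing α ψ φ with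
  | nil =>
    rw [List.nil_append, sum_boxOn_cons J [] i₀ (by simp)]
    simp only [wickOp, inner_sum, boxOn_nil, Finset.sum_singleton, inner_smul_right]
    refine Finset.sum_congr rfl fun x _ => ?_
    by_cases hS : S i₀
    · simp [hS, annFold, isCAR_altSpace.adj]
    · simp [hS, annFold]
  | cons i L ih =>
    obtain ⟨hi, hL'⟩ := List.nodup_cons.1 hL
    have hi₀' : i₀ ∉ L := fun h => hi₀ (by simp [h])
    have hne : i ≠ i₀ := fun h => hi₀ (by simp [h])
    have hi' : i ∉ L ++ [i₀] := by simp [hi, hne]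
    rw [List.cons_append, sum_boxOn_cons J _ i hi']
    simp only [wickOp]
    by_cases hS : S i
    · rw [if_pos hS, inner_sum]
      refine Finset.sum_congr rfl fun x _ => ?_
      rw [← isCAR_altSpace.adj, ih hL' hi₀']
      refine Finset.sum_congr rfl fun β hβ => ?_
      have := boxOn_apply_of_mem hi' hβ
      simp [hS, annFold, this]
    · rw [if_neg hS, inner_sum]
      refine Finset.sum_congr rfl fun x _ => ?_
      rw [ih hL' hi₀']
      refine Finset.sum_congr rfl fun β hβ => ?_
      have := boxOn_apply_of_mem hi' hβ
      simp [hS, annFold, this]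

theorem wickWeight_eq (v : Fin n → κ → ℝ) (J : Finset κ) (i₀ : Fin n)
    (g : (Fin n → κ) → ℂ) (L : List (Fin n)) (hL : L.Nodup) (hi₀ : i₀ ∉ L) (α : Fin n → κ) :
    wickWeight v J i₀ g L α =
      ∑ β ∈ boxOn J (L ++ [i₀]) α, (∏ i ∈ L.toFinset, v i (β i)) * ‖g β‖ ^ 2 := by
  induction L generalizing α with
  | nil =>
    rw [List.nil_append, sum_boxOn_cons J [] i₀ (by simp)]
    simp [wickWeight, boxOn_nil]
  | cons i L ih =>
    obtain ⟨hi, hL'⟩ := List.nodup_cons.1 hL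
    have hi₀' : i₀ ∉ L := fun h => hi₀ (by simp [h])
    have hne : i ≠ i₀ := fun h => hi₀ (by simp [h])
    have hi' : i ∉ L ++ [i₀] := by simp [hi, hne]
    rw [List.cons_append, sum_boxOn_cons J _ i hi']
    simp only [wickWeight]
    refine Finset.sum_congr rfl fun x _ => ?_
    rw [ih hL' hi₀', Finset.mul_sum]
    refine Finset.sum_congr rfl fun β hβ => ?_
    rw [List.toFinset_cons, Finset.prod_insert (by simpa using hi), boxOn_apply_of_mem hi' hβ]
    ring

/-- `∑_β ∏_{i ∈ R} v_i(β_i)⁻¹ ‖∏_{i ∈ R} b_{i,β_i} φ‖²`. -/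
def wickTerm (v : Fin n → κ → ℝ) (J : Finset κ) (R : List (Fin n)) (α : Fin n → κ)
    (φ : altSpace n κ) : ℝ :=
  ∑ β ∈ boxOn J R α, (∏ i ∈ R.toFinset, (v i (β i))⁻¹) * ‖annFold R β φ‖ ^ 2

theorem wickTerm_cons (v : Fin n → κ → ℝ) (J : Finset κ) (R : List (Fin n)) (i : Fin n)
    (hi : i ∉ R) (α : Fin n → κ) (φ : altSpace n κ) :
    wickTerm v J (i :: R) α φ =
      ∑ y ∈ J, (v i y)⁻¹ * wickTerm v J R (Function.update α i y) (annOp i y φ) := by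
  rw [wickTerm, sum_boxOn_cons J _ i hi]
  refine Finset.sum_congr rfl fun y _ => ?_
  rw [wickTerm, Finset.mul_sum]
  refine Finset.sum_congr rfl fun β hβ => ?_
  rw [List.toFinset_cons, Finset.prod_insert (by simpa using hi), boxOn_apply_of_mem hi hβ]
  have : annFold (i :: R) β φ = annFold R β (annOp i y φ) := by
    simp [annFold, boxOn_apply_of_mem hi hβ]
  rw [this]
  ring

/-- The recursion is a product of factors `1 + ∑_y v_i(y)⁻¹ (…)`; multiplying out chooses for each
species whether it is annihilated, hence the sum over sublists. -/
theorem wickForm_eq (v : Fin n → κ → ℝ) (J : Finset κ) (L : List (Fin n)) (hL : L.Nodup)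
    (α : Fin n → κ) (φ : altSpace n κ) :
    wickForm annOp v J L φ = (L.sublists'.map fun R => wickTerm v J R α φ).sum := by
  induction L generalizing α φ with
  | nil => simp [wickForm, wickTerm, boxOn_nil, annFold]
  | cons i L ih =>
    obtain ⟨hi, hL'⟩ := List.nodup_cons.1 hL
    rw [List.sublists'_cons, List.map_append, List.sum_append, ← ih hL' α]
    simp only [wickForm]
    congr 1
    rw [List.map_map]
    have : ∀ M : List (List (Fin n)), (∀ R ∈ M, i ∉ R) →
        (M.map ((fun R => wickTerm v J R α φ) ∘ List.cons i)).sum = ∑ y ∈ J, (v i y)⁻¹ *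
          (M.map fun R => wickTerm v J R (Function.update α i y) (annOp i y φ)).sum := by
      intro M
      induction M with
      | nil => simp
      | cons R M ihM =>
        intro hM
        rw [List.map_cons, List.sum_cons, ihM fun R' h => hM R' (by simp [h])]
        simp only [Function.comp, List.map_cons, List.sum_cons, mul_add, Finset.sum_add_distrib]
        rw [wickTerm_cons v J R i (hM R (by simp))]
    rw [this]
    · exact Finset.sum_congr rfl fun y _ => by rw [ih hL' (Function.update α i y)]
    · intro R hR hiR
      exact hi ((List.mem_sublists'.1 hR).subset hiR)

/-- A list without repetitions has `2 ^ length` sublists, each contributing at most `K`. -/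
theorem wickForm_le (v : Fin n → κ → ℝ) (J : Finset κ) (L : List (Fin n)) (hL : L.Nodup)
    (α : Fin n → κ) (φ : altSpace n κ) (K : ℝ)
    (h : ∀ R : List (Fin n), R.Sublist L → wickTerm v J R α φ ≤ K) :
    wickForm annOp v J L φ ≤ 2 ^ L.length * K := by
  rw [wickForm_eq v J L hL α φ]
  have := List.sum_le_card_nsmul (L.sublists'.map fun R => wickTerm v J R α φ) K (by
    intro x hx
    obtain ⟨R, hR, rfl⟩ := List.mem_map.1 hx
    exact h R (List.mem_sublists'.1 hR))
  simpa using this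

/-- The basic bound for the form `∑ g(β) ⟨∏_S b ψ, ∏_{Sᶜ} b φ⟩`, in terms of the weighted norm of
`g` and of the annihilators of the species other than `i₀` acting on `φ`. -/
theorem norm_wick_sum_sq_le (S : Fin n → Prop) [DecidablePred S] (J : Finset κ) (i₀ : Fin n)
    (g : (Fin n → κ) → ℂ) {v : Fin n → κ → ℝ} (hv : ∀ i x, 1 ≤ v i x) (α : Fin n → κ)
    (ψ φ : altSpace n κ) (K : ℝ)
    (hK : ∀ R : List (Fin n), R.Nodup → i₀ ∉ R → wickTerm v J R α φ ≤ K) :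
    ‖∑ β ∈ Fintype.piFinset fun _ => J, g β *
        inner ℂ (annFold ((List.finRange n).filter fun i => S i) β ψ)
          (annFold ((List.finRange n).filter fun i => ¬ S i) β φ)‖ ^ 2 ≤
      ‖ψ‖ ^ 2 * ((∑ β ∈ Fintype.piFinset fun _ => J,
        (∏ i ∈ Finset.univ.erase i₀, v i (β i)) * ‖g β‖ ^ 2) * (2 ^ n * K)) := by
  -- The species `i₀` is moved to the last position, where `wickOp` uses the unweighted bound.
  set L := (List.finRange n).filter fun i => i ≠ i₀ with hLdef
  have hL : L.Nodup := (List.nodup_finRange n).filter _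
  have hi₀ : i₀ ∉ L := by simp [hLdef]
  have hmem : ∀ i, i ∈ L ++ [i₀] := by
    intro i
    by_cases h : i = i₀ <;> simp [hLdef, h]
  have hnd : (L ++ [i₀]).Nodup := by
    rw [List.nodup_append]
    refine ⟨hL, by simp, ?_⟩
    intro a ha b hb e
    simp at hb
    exact hi₀ (by rwa [← hb, ← e])
  have hbox : boxOn J (L ++ [i₀]) α = Fintype.piFinset fun _ => J := by
    simp [boxOn, hmem]
  -- By `altFun_annFold` the composite annihilator depends only on the set of species, so the
  -- reordering is harmless.
  have hfold : ∀ (T : Fin n → Prop) [DecidablePred T] (β : Fin n → κ) (f : altSpace n κ),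
      annFold ((L ++ [i₀]).filter fun i => T i) β f =
        annFold ((List.finRange n).filter fun i => T i) β f := by
    intro T _ β f
    refine altFun_ext fun A => ?_
    rw [altFun_annFold _ (hnd.filter _), altFun_annFold _ ((List.nodup_finRange n).filter _)]
    have e1 : ((L ++ [i₀]).filter fun i => T i).toFinset =
        ((List.finRange n).filter fun i => T i).toFinset := by
      ext i
      have := hmem i
      simp only [List.mem_toFinset, List.mem_filter, this, List.mem_finRange]
    have e2 : consOcc ((L ++ [i₀]).filter fun i => T i) β A =
        consOcc ((List.finRange n).filter fun i => T i) β A := by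
      funext i
      have := hmem i
      simp only [consOcc, List.mem_filter, this, List.mem_finRange]
    rw [e1, e2]
  have h1 := inner_wickOp S J i₀ g L hL hi₀ α ψ φ
  simp only [hfold, hbox] at h1
  rw [← h1]
  have h2 := (isCAR_altSpace (n := n) (κ := κ)).norm_wickOp_sq_le S J i₀ g hv L hi₀ hL α φ
  have hv0 : ∀ i x, 0 < v i x := fun i x => zero_lt_one.trans_le (hv i x)
  -- For the empty list `R` the term is `‖φ‖²`.
  have hK0 : 0 ≤ K := by
    refine le_trans ?_ (hK [] (by simp) (by simp))
    simp [wickTerm, boxOn_nil, annFold]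
  have h3 : wickForm annOp v J L φ ≤ 2 ^ n * K := by
    refine (wickForm_le v J L hL α φ K fun R hR => hK R (hR.nodup hL)
      fun h => hi₀ (hR.subset h)).trans ?_
    refine mul_le_mul_of_nonneg_right (pow_le_pow_right₀ (by norm_num) ?_) hK0
    calc L.length ≤ (List.finRange n).length := List.length_filter_le _ _
      _ = n := List.length_finRange
  have h4 : wickWeight v J i₀ g L α = ∑ β ∈ Fintype.piFinset fun _ => J,
        (∏ i ∈ Finset.univ.erase i₀, v i (β i)) * ‖g β‖ ^ 2 := by
    rw [wickWeight_eq v J i₀ g L hL hi₀ α, hbox]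
    have : L.toFinset = Finset.univ.erase i₀ := by
      ext i; simp [hLdef]
    rw [this]
  calc _ ≤ (‖ψ‖ * ‖wickOp annOp creOp S J i₀ g L α φ‖) ^ 2 :=
        pow_le_pow_left₀ (norm_nonneg _) (norm_inner_le_norm (𝕜 := ℂ) _ _) 2
    _ = ‖ψ‖ ^ 2 * ‖wickOp annOp creOp S J i₀ g L α φ‖ ^ 2 := by ring
    _ ≤ _ := by
        refine mul_le_mul_of_nonneg_left (h2.trans ?_) (sq_nonneg _)
        rw [h4]
        refine mul_le_mul_of_nonneg_left h3 ?_
        rw [← h4]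
        exact wickWeight_nonneg hv0 J i₀ g L α

end Unfold

/-! ### Square-integrable functions and product bases -/

section L2

variable {X Y : Type*} [MeasurableSpace X] [MeasurableSpace Y] {μ : Measure X} {ν : Measure Y}

theorem memLp_two_iff_lintegral {u : X → ℂ} :
    MemLp u 2 μ ↔ AEStronglyMeasurable u μ ∧ ∫⁻ x, ‖u x‖ₑ ^ 2 ∂μ < ∞ := by
  rw [MemLp, eLpNorm_lt_top_iff_lintegral_rpow_enorm_lt_top (by norm_num) (by norm_num)]
  simp

theorem lintegral_mul_sq_le {f g : X → ℝ≥0∞} (hf : AEMeasurable f μ) (hg : AEMeasurable g μ) :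
    (∫⁻ x, f x * g x ∂μ) ^ 2 ≤ (∫⁻ x, f x ^ 2 ∂μ) * ∫⁻ x, g x ^ 2 ∂μ := by
  have h := ENNReal.lintegral_mul_le_Lp_mul_Lq μ Real.HolderConjugate.two_two hf hg
  have h2 := pow_le_pow_left' h 2
  refine h2.trans (le_of_eq ?_)
  rw [mul_pow, ← ENNReal.rpow_natCast, ← ENNReal.rpow_natCast, ← ENNReal.rpow_mul,
    ← ENNReal.rpow_mul]
  norm_num

theorem enorm_integral_mul_sq_le {f g : X → ℂ} (hf : AEStronglyMeasurable f μ)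
    (hg : AEStronglyMeasurable g μ) :
    ‖∫ x, f x * g x ∂μ‖ₑ ^ 2 ≤ (∫⁻ x, ‖f x‖ₑ ^ 2 ∂μ) * ∫⁻ x, ‖g x‖ₑ ^ 2 ∂μ := by
  refine (pow_le_pow_left' (enorm_integral_le_lintegral_enorm _) 2).trans ?_
  simp only [enorm_mul]
  exact lintegral_mul_sq_le hf.enorm hg.enorm

theorem MemLp.integrable_mul_two {f g : X → ℂ} (hf : MemLp f 2 μ) (hg : MemLp g 2 μ) :
    Integrable (fun x => f x * g x) μ :=
  MemLp.integrable_mul (p := 2) (q := 2) hf hg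

theorem memLp_two_mul_prod [SFinite ν] {f : X → ℂ} {g : Y → ℂ}
    (hf : MemLp f 2 μ) (hg : MemLp g 2 ν) :
    MemLp (fun z : X × Y => f z.1 * g z.2) 2 (μ.prod ν) := by
  rw [memLp_two_iff_lintegral]
  refine ⟨hf.1.comp_fst.mul hg.1.comp_snd, ?_⟩
  simp only [enorm_mul, mul_pow]
  rw [lintegral_prod_mul (hf.1.enorm.pow_const 2) (hg.1.enorm.pow_const 2)]
  exact ENNReal.mul_lt_top (memLp_two_iff_lintegral.1 hf).2 (memLp_two_iff_lintegral.1 hg).2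

theorem MemLp.slice_two [SFinite ν] {u : X × Y → ℂ} (hu : MemLp u 2 (μ.prod ν)) :
    ∀ᵐ x ∂μ, MemLp (fun y => u (x, y)) 2 ν := by
  have h := memLp_two_iff_lintegral.1 hu
  have h1 : AEMeasurable (fun z => ‖u z‖ₑ ^ 2) (μ.prod ν) := h.1.enorm.pow_const 2
  have h2 := h.2
  rw [lintegral_prod _ h1] at h2
  filter_upwards [ae_lt_top' h1.lintegral_prod_right' h2.ne, h.1.prodMk_left] with x hx hx'
  exact memLp_two_iff_lintegral.2 ⟨hx', hx⟩

theorem memLp_two_partial [SFinite ν] {u : X × Y → ℂ} {f : Y → ℂ}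
    (hu : MemLp u 2 (μ.prod ν)) (hf : MemLp f 2 ν) :
    MemLp (fun x => ∫ y, f y * u (x, y) ∂ν) 2 μ := by
  have h := memLp_two_iff_lintegral.1 hu
  have hf' := memLp_two_iff_lintegral.1 hf
  rw [memLp_two_iff_lintegral]
  refine ⟨(hf.1.comp_snd.mul h.1).integral_prod_right', ?_⟩
  have hb : ∀ᵐ x ∂μ, ‖∫ y, f y * u (x, y) ∂ν‖ₑ ^ 2 ≤
      (∫⁻ y, ‖f y‖ₑ ^ 2 ∂ν) * ∫⁻ y, ‖u (x, y)‖ₑ ^ 2 ∂ν := by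
    filter_upwards [h.1.prodMk_left] with x hx
    exact enorm_integral_mul_sq_le hf.1 hx
  refine (lintegral_mono_ae hb).trans_lt ?_
  rw [lintegral_const_mul' _ _ hf'.2.ne, ← lintegral_prod _ (h.1.enorm.pow_const 2)]
  exact ENNReal.mul_lt_top hf'.2 h.2

end L2

/-- A complete orthonormal family of real functions in `L²(μ)`. -/
structure IsL2Basis {X κ : Type*} [MeasurableSpace X] (μ : Measure X) (E : κ → X → ℝ) : Prop where
  measurable : ∀ a, Measurable (E a)
  memLp : ∀ a, MemLp (fun x => (E a x : ℂ)) 2 μ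
  norm : ∀ a, ∫ x, (E a x : ℂ) * E a x ∂μ = 1
  orth : ∀ a b, a ≠ b → ∫ x, (E a x : ℂ) * E b x ∂μ = 0
  complete : ∀ u : X → ℂ, MemLp u 2 μ → (∀ a, ∫ x, (E a x : ℂ) * u x ∂μ = 0) → u =ᵐ[μ] 0

/-- The operator `∑ₐ B a |E a⟩⟨E a|` is bounded by the multiplication operator `W`. -/
def WeightedBessel {X κ : Type*} [MeasurableSpace X] (μ : Measure X) (E : κ → X → ℝ)
    (B : κ → ℝ≥0∞) (W : X → ℝ≥0∞) : Prop :=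
  ∀ u : X → ℂ, MemLp u 2 μ →
    ∑' a, B a * ‖∫ x, (E a x : ℂ) * u x ∂μ‖ₑ ^ 2 ≤ ∫⁻ x, W x * ‖u x‖ₑ ^ 2 ∂μ

section Prod

variable {X Y κ κ' : Type*} [MeasurableSpace X] [MeasurableSpace Y] {μ : Measure X}
  {ν : Measure Y} [SFinite μ] [SFinite ν] {E : κ → X → ℝ} {E' : κ' → Y → ℝ}

theorem integral_prod_basis (hE : ∀ a, MemLp (fun x => (E a x : ℂ)) 2 μ)
    (hE' : ∀ a, MemLp (fun x => (E' a x : ℂ)) 2 ν) {u : X × Y → ℂ} (hu : MemLp u 2 (μ.prod ν))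
    (a : κ) (b : κ') :
    ∫ z, ((E a z.1 * E' b z.2 : ℝ) : ℂ) * u z ∂(μ.prod ν) =
      ∫ x, (E a x : ℂ) * ∫ y, (E' b y : ℂ) * u (x, y) ∂ν ∂μ := by
  have hi : Integrable (fun z : X × Y => ((E a z.1 * E' b z.2 : ℝ) : ℂ) * u z) (μ.prod ν) := by
    have := MemLp.integrable_mul_two (memLp_two_mul_prod (hE a) (hE' b)) hu
    simpa using this
  rw [integral_prod _ hi]
  refine integral_congr_ae (Filter.Eventually.of_forall fun x => ?_)
  simp only [Complex.ofReal_mul, mul_assoc]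
  exact integral_const_mul _ _

/-- For completeness, the partial coefficients in `y` vanish for almost every `x` by completeness in
`x`; countability of `κ'` puts all of them on one set of full measure, where completeness in `y`
applies. -/
theorem IsL2Basis.prod [Countable κ'] (hE : IsL2Basis μ E) (hE' : IsL2Basis ν E') :
    IsL2Basis (μ.prod ν) fun (c : κ × κ') z => E c.1 z.1 * E' c.2 z.2 where
  measurable c := ((hE.measurable _).comp measurable_fst).mul
    ((hE'.measurable _).comp measurable_snd)
  memLp c := by
    have := memLp_two_mul_prod (hE.memLp c.1) (hE'.memLp c.2)
    simpa using this
  norm c := by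
    have := integral_prod_mul (μ := μ) (ν := ν) (fun x => (E c.1 x : ℂ) * E c.1 x)
      (fun y => (E' c.2 y : ℂ) * E' c.2 y)
    rw [hE.norm, hE'.norm, one_mul] at this
    rw [← this]
    refine integral_congr_ae (Filter.Eventually.of_forall fun z => ?_)
    push_cast; ring
  orth c d hcd := by
    have := integral_prod_mul (μ := μ) (ν := ν) (fun x => (E c.1 x : ℂ) * E d.1 x)
      (fun y => (E' c.2 y : ℂ) * E' d.2 y)
    have h0 : (∫ x, (E c.1 x : ℂ) * E d.1 x ∂μ) * ∫ y, (E' c.2 y : ℂ) * E' d.2 y ∂ν = 0 := by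
      by_cases h1 : c.1 = d.1
      · have h2 : c.2 ≠ d.2 := fun h => hcd (Prod.ext h1 h)
        rw [hE'.orth _ _ h2, mul_zero]
      · rw [hE.orth _ _ h1, zero_mul]
    rw [h0] at this
    rw [← this]
    refine integral_congr_ae (Filter.Eventually.of_forall fun z => ?_)
    push_cast; ring
  complete u hu h := by
    have h1 : ∀ b, (fun x => ∫ y, (E' b y : ℂ) * u (x, y) ∂ν) =ᵐ[μ] 0 := fun b =>
      hE.complete _ (memLp_two_partial hu (hE'.memLp b)) fun a => by
        rw [← integral_prod_basis hE.memLp hE'.memLp hu]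
        exact h (a, b)
    have h2 : ∀ᵐ x ∂μ, (fun y => u (x, y)) =ᵐ[ν] 0 := by
      filter_upwards [ae_all_iff.2 h1, MemLp.slice_two hu] with x hx hx'
      exact hE'.complete _ hx' hx
    have h3 : ∫⁻ z, ‖u z‖ₑ ∂(μ.prod ν) = 0 := by
      rw [lintegral_prod _ hu.1.enorm, lintegral_eq_zero_iff' hu.1.enorm.lintegral_prod_right']
      filter_upwards [h2] with x hx
      rw [Pi.zero_apply]
      refine lintegral_eq_zero_of_ae_eq_zero ?_
      filter_upwards [hx] with y hy
      rw [hy]; simp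
    rw [lintegral_eq_zero_iff' hu.1.enorm] at h3
    filter_upwards [h3] with z hz
    simpa using hz

/-- Operator inequalities in separate variables multiply: the first is applied in `x` to the partial
coefficients of `u`, the second in `y` to almost every slice. -/
theorem WeightedBessel.prod [Countable κ'] {B : κ → ℝ≥0∞} {B' : κ' → ℝ≥0∞} {W : X → ℝ≥0∞}
    {W' : Y → ℝ≥0∞} (hEm : ∀ a, MemLp (fun x => (E a x : ℂ)) 2 μ)
    (hEm' : ∀ a, MemLp (fun x => (E' a x : ℂ)) 2 ν) (hW : Measurable W) (hW' : Measurable W')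
    (hE : WeightedBessel μ E B W) (hE' : WeightedBessel ν E' B' W') :
    WeightedBessel (μ.prod ν) (fun (c : κ × κ') z => E c.1 z.1 * E' c.2 z.2)
      (fun c => B c.1 * B' c.2) fun z => W z.1 * W' z.2 := by
  intro u hu
  have hv : ∀ b, MemLp (fun x => ∫ y, (E' b y : ℂ) * u (x, y) ∂ν) 2 μ := fun b =>
    memLp_two_partial hu (hEm' b)
  rw [ENNReal.tsum_prod', ENNReal.tsum_comm]
  calc _ = ∑' b, B' b * ∑' a, B a *
        ‖∫ x, (E a x : ℂ) * ∫ y, (E' b y : ℂ) * u (x, y) ∂ν ∂μ‖ₑ ^ 2 := by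
        refine tsum_congr fun b => ?_
        rw [← ENNReal.tsum_mul_left]
        refine tsum_congr fun a => ?_
        rw [integral_prod_basis hEm hEm' hu]
        ring
    _ ≤ ∑' b, B' b * ∫⁻ x, W x * ‖∫ y, (E' b y : ℂ) * u (x, y) ∂ν‖ₑ ^ 2 ∂μ :=
        ENNReal.tsum_le_tsum fun b => mul_le_mul_right (hE _ (hv b)) _
    _ = ∫⁻ x, W x * ∑' b, B' b * ‖∫ y, (E' b y : ℂ) * u (x, y) ∂ν‖ₑ ^ 2 ∂μ := by
        have hm : ∀ b, AEMeasurable (fun x => W x * ‖∫ y, (E' b y : ℂ) * u (x, y) ∂ν‖ₑ ^ 2) μ :=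
          fun b => hW.aemeasurable.mul ((hv b).1.enorm.pow_const 2)
        simp only [← ENNReal.tsum_mul_left]
        have hm' : ∀ b, AEMeasurable (fun x => W x * (B' b *
            ‖∫ y, (E' b y : ℂ) * u (x, y) ∂ν‖ₑ ^ 2)) μ := fun b =>
          hW.aemeasurable.mul (((hv b).1.enorm.pow_const 2).const_mul (B' b))
        rw [lintegral_tsum hm']
        refine tsum_congr fun b => ?_
        rw [← lintegral_const_mul'' _ (hm b)]
        refine lintegral_congr fun x => ?_
        ring
    _ ≤ ∫⁻ x, W x * ∫⁻ y, W' y * ‖u (x, y)‖ₑ ^ 2 ∂ν ∂μ := by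
        refine lintegral_mono_ae ?_
        filter_upwards [MemLp.slice_two hu] with x hx
        exact mul_le_mul_right (hE' _ hx) _
    _ = _ := by
        have hm : AEMeasurable (fun z : X × Y => W z.1 * W' z.2 * ‖u z‖ₑ ^ 2) (μ.prod ν) :=
          ((hW.comp measurable_fst).mul (hW'.comp measurable_snd)).aemeasurable.mul
            (hu.1.enorm.pow_const 2)
        rw [lintegral_prod _ hm]
        refine lintegral_congr_ae ?_
        filter_upwards [hu.1.prodMk_left] with x hx
        simp only [mul_assoc]
        rw [lintegral_const_mul'']
        exact hW'.aemeasurable.mul (hx.enorm.pow_const 2)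

end Prod

section Transport

variable {X Y κ κ' : Type*} [MeasurableSpace X] [MeasurableSpace Y] {μ : Measure X}
  {ν : Measure Y} {E : κ' → Y → ℝ}

theorem IsL2Basis.comp (hE : IsL2Basis ν E) (e : X ≃ᵐ Y) (he : MeasurePreserving e μ ν)
    (f : κ ≃ κ') : IsL2Basis μ fun a x => E (f a) (e x) where
  measurable a := (hE.measurable _).comp e.measurable
  memLp a := (hE.memLp (f a)).comp_measurePreserving he
  norm a := by
    rw [← hE.norm (f a), ← he.integral_comp']
  orth a b hab := by
    rw [← hE.orth (f a) (f b) (f.injective.ne hab), ← he.integral_comp']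
  complete u hu h := by
    have h1 : (fun y => u (e.symm y)) =ᵐ[ν] 0 := by
      refine hE.complete _ (hu.comp_measurePreserving (he.symm e)) fun b => ?_
      rw [← he.integral_comp']
      have := h (f.symm b)
      simpa using this
    have h2 := he.quasiMeasurePreserving.ae h1
    filter_upwards [h2] with x hx
    simpa using hx

theorem WeightedBessel.comp {B : κ' → ℝ≥0∞} {W : Y → ℝ≥0∞} (hE : WeightedBessel ν E B W)
    (e : X ≃ᵐ Y) (he : MeasurePreserving e μ ν) (f : κ ≃ κ') :
    WeightedBessel μ (fun a x => E (f a) (e x)) (fun a => B (f a)) fun x => W (e x) := by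
  intro u hu
  have h := hE (fun y => u (e.symm y)) (hu.comp_measurePreserving (he.symm e))
  rw [← f.tsum_eq, ← he.lintegral_comp_emb e.measurableEmbedding] at h
  simp only [← he.integral_comp', MeasurableEquiv.symm_apply_apply] at h
  exact h

theorem IsL2Basis.congr {E' : κ' → Y → ℝ} (hE : IsL2Basis ν E) (h : ∀ a y, E' a y = E a y) :
    IsL2Basis ν E' := by
  have : E' = E := funext fun a => funext fun y => h a y
  rwa [this]

end Transport

section Pi

theorem IsL2Basis.pi {n : ℕ} {X κ : Fin n → Type} [∀ i, MeasurableSpace (X i)]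
    [∀ i, Countable (κ i)] {μ : ∀ i, Measure (X i)} [∀ i, SigmaFinite (μ i)]
    {E : ∀ i, κ i → X i → ℝ} (hE : ∀ i, IsL2Basis (μ i) (E i)) :
    IsL2Basis (Measure.pi μ) fun (a : ∀ i, κ i) x => ∏ i, E i (a i) (x i) := by
  induction n with
  | zero =>
    have hμ : Measure.pi μ = Measure.dirac isEmptyElim := Measure.pi_of_empty μ
    rw [hμ]
    refine ⟨fun _ => by simp, fun a => ?_, fun a => by simp, fun a b hab => ?_, fun u _ h => ?_⟩
    · have : (fun x : ∀ i, X i => ((∏ i, E i (a i) (x i) : ℝ) : ℂ)) = fun _ => 1 := by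
        funext x; simp
      rw [this]
      exact memLp_const 1
    · exact absurd (Subsingleton.elim a b) hab
    · have := h isEmptyElim
      simp only [Finset.univ_eq_empty, Finset.prod_empty, Complex.ofReal_one, one_mul] at this
      have e : ∀ x : ∀ i, X i, u x = 0 := by
        intro x
        rw [show u = fun _ => u x from funext fun y => congrArg u (Subsingleton.elim y x)] at this
        simpa using this
      exact Filter.Eventually.of_forall e
  | succ n ih =>
    have h1 := (hE 0).prod (ih fun i => hE (Fin.succAbove 0 i))
    have h2 := h1.comp (MeasurableEquiv.piFinSuccAbove X 0) (measurePreserving_piFinSuccAbove μ 0)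
      (Fin.insertNthEquiv κ 0).symm
    refine h2.congr fun a x => ?_
    rw [Fin.prod_univ_succAbove _ 0]
    rfl

theorem WeightedBessel.pi {n : ℕ} {X κ : Fin n → Type} [∀ i, MeasurableSpace (X i)]
    [∀ i, Countable (κ i)] {μ : ∀ i, Measure (X i)} [∀ i, SigmaFinite (μ i)]
    {E : ∀ i, κ i → X i → ℝ} {B : ∀ i, κ i → ℝ≥0∞} {W : ∀ i, X i → ℝ≥0∞}
    (hb : ∀ i, IsL2Basis (μ i) (E i)) (hW : ∀ i, Measurable (W i))
    (hE : ∀ i, WeightedBessel (μ i) (E i) (B i) (W i)) :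
    WeightedBessel (Measure.pi μ) (fun (a : ∀ i, κ i) x => ∏ i, E i (a i) (x i))
      (fun a => ∏ i, B i (a i)) fun x => ∏ i, W i (x i) := by
  induction n with
  | zero =>
    have hμ : Measure.pi μ = Measure.dirac isEmptyElim := Measure.pi_of_empty μ
    rw [hμ]
    intro u hu
    rw [tsum_eq_single isEmptyElim fun b hb => absurd (Subsingleton.elim _ _) hb]
    have : ∀ x : ∀ i, X i, u = fun _ => u x :=
      fun x => funext fun y => congrArg u (Subsingleton.elim y x)
    rw [this isEmptyElim]
    simp
  | succ n ih =>
    have h1 := WeightedBessel.prod (hb 0).memLp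
      (IsL2Basis.pi fun i : Fin n => hb (Fin.succAbove 0 i)).memLp (hW 0)
      (Finset.measurable_fun_prod _ fun i _ => (hW _).comp (measurable_pi_apply i)) (hE 0)
      (ih (fun i => hb (Fin.succAbove 0 i)) (fun i => hW (Fin.succAbove 0 i))
        fun i => hE (Fin.succAbove 0 i))
    have h2 := h1.comp (MeasurableEquiv.piFinSuccAbove X 0) (measurePreserving_piFinSuccAbove μ 0)
      (Fin.insertNthEquiv κ 0).symm
    intro u hu
    have h3 := h2 u hu
    simp only [Fin.prod_univ_succAbove _ (0 : Fin (n + 1))]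
    exact h3

end Pi

/-! ### Hermite functions -/

section Hermite

theorem abs_pow_mul_exp_le (j : ℕ) (x : ℝ) :
    |x| ^ j * Real.exp (-(x ^ 2 / 2)) ≤ j.factorial * Real.exp (1 / 2) := by
  have h1 : |x| ^ j ≤ j.factorial * Real.exp |x| := by
    have := Real.pow_div_factorial_le_exp |x| (abs_nonneg x) j
    rw [div_le_iff₀ (by positivity)] at this
    linarith
  calc _ ≤ j.factorial * Real.exp |x| * Real.exp (-(x ^ 2 / 2)) := by gcongr
    _ = j.factorial * Real.exp (|x| + -(x ^ 2 / 2)) := by rw [Real.exp_add]; ring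
    _ ≤ _ := by
      gcongr
      nlinarith [sq_nonneg (|x| - 1), sq_abs x]

theorem exists_abs_pow_mul_aeval_mul_exp_le (P : Polynomial ℤ) (k : ℕ) :
    ∃ C, ∀ x : ℝ, |x| ^ k * (|Polynomial.aeval x P| * Real.exp (-(x ^ 2 / 2))) ≤ C := by
  induction P using Polynomial.induction_on' with
  | add p q hp hq =>
    obtain ⟨C, hC⟩ := hp
    obtain ⟨D, hD⟩ := hq
    refine ⟨C + D, fun x => le_trans ?_ (add_le_add (hC x) (hD x))⟩
    rw [map_add, ← mul_add, ← add_mul]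
    gcongr
    exact abs_add_le _ _
  | monomial j a =>
    refine ⟨|(a : ℝ)| * ((k + j).factorial * Real.exp (1 / 2)), fun x => ?_⟩
    have := mul_le_mul_of_nonneg_left (abs_pow_mul_exp_le (k + j) x) (abs_nonneg (a : ℝ))
    refine le_trans (le_of_eq ?_) this
    rw [Polynomial.aeval_monomial, abs_mul, abs_pow, pow_add]
    simp only [eq_intCast]
    ring

/-- The Gaussian `exp (-x² / 2)`. -/
def gaussianS : 𝓢(ℝ, ℝ) where
  toFun x := Real.exp (-(x ^ 2 / 2))
  smooth' := by fun_prop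
  decay' k m := by
    obtain ⟨C, hC⟩ := exists_abs_pow_mul_aeval_mul_exp_le (Polynomial.hermite m) k
    refine ⟨C, fun x => le_trans (le_of_eq ?_) (hC x)⟩
    rw [norm_iteratedFDeriv_eq_norm_iteratedDeriv, iteratedDeriv_eq_iterate,
      Polynomial.deriv_gaussian_eq_hermite_mul_gaussian]
    simp [Real.abs_exp]

theorem gaussianS_apply (x : ℝ) : gaussianS x = Real.exp (-(x ^ 2 / 2)) := rfl

/-- Multiplication by the variable. -/
def mulX : 𝓢(ℝ, ℝ) →L[ℝ] 𝓢(ℝ, ℝ) := SchwartzMap.smulLeftCLM ℝ fun x : ℝ => x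

theorem mulX_apply (f : 𝓢(ℝ, ℝ)) (x : ℝ) : mulX f x = x * f x := by
  rw [mulX, SchwartzMap.smulLeftCLM_apply_apply (by fun_prop)]
  rfl

/-- Differentiation. -/
def derivS : 𝓢(ℝ, ℝ) →L[ℝ] 𝓢(ℝ, ℝ) := SchwartzMap.derivCLM ℝ ℝ

theorem derivS_apply (f : 𝓢(ℝ, ℝ)) (x : ℝ) : derivS f x = deriv f x := rfl

theorem derivS_mulX (f : 𝓢(ℝ, ℝ)) : derivS (mulX f) = f + mulX (derivS f) := by
  ext x
  rw [_root_.add_apply, derivS_apply, mulX_apply, derivS_apply]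
  have : (mulX f : ℝ → ℝ) = fun x => x * f x := funext (mulX_apply f)
  rw [this]
  have h := (hasDerivAt_id x).mul (f.hasDerivAt x)
  simp only [id, one_mul] at h
  exact h.deriv

theorem integrable_schwartz_mul (f g : 𝓢(ℝ, ℝ)) : Integrable fun x => f x * g x :=
  (SchwartzMap.pairing (ContinuousLinearMap.mul ℝ ℝ) f g).integrable

/-- The unnormalised Hermite functions `(x - d/dx)^n exp (-x² / 2)`. -/
def hermiteU : ℕ → 𝓢(ℝ, ℝ)
  | 0 => gaussianS
  | n + 1 => mulX (hermiteU n) - derivS (hermiteU n)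

/-- Induction by the commutator of `x + d/dx` with `x - d/dx`, which is `2`. At `n = 0` the
truncated index `n - 1` is harmless because its coefficient is `0`. -/
theorem lowering_hermiteU (n : ℕ) :
    mulX (hermiteU n) + derivS (hermiteU n) = (2 * n : ℝ) • hermiteU (n - 1) := by
  induction n with
  | zero =>
    ext x
    simp only [hermiteU, _root_.add_apply, mulX_apply, derivS_apply, Nat.cast_zero, mul_zero,
      zero_smul, _root_.zero_apply]
    have h : HasDerivAt (gaussianS : ℝ → ℝ) (Real.exp (-(x ^ 2 / 2)) * (-(2 * x / 2))) x := by
      change HasDerivAt (fun x => Real.exp (-(x ^ 2 / 2))) _ x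
      have := (((hasDerivAt_pow 2 x).div_const 2).neg).exp
      simpa using this
    rw [h.deriv, gaussianS_apply]
    ring
  | succ n ih =>
    have e : hermiteU (n + 1) = mulX (hermiteU n) - derivS (hermiteU n) := rfl
    have e2 : mulX (hermiteU n) = (2 * n : ℝ) • hermiteU (n - 1) - derivS (hermiteU n) :=
      eq_sub_of_add_eq ih
    -- Lowering after raising equals raising after lowering plus `2`.
    have key : mulX (hermiteU (n + 1)) + derivS (hermiteU (n + 1)) =
        mulX (mulX (hermiteU n) + derivS (hermiteU n)) -
          derivS (mulX (hermiteU n) + derivS (hermiteU n)) + (2 : ℝ) • hermiteU n := by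
      rw [e, map_sub, map_sub, map_add, map_add, derivS_mulX]
      module
    rw [key, ih, map_smul, map_smul, ← smul_sub]
    cases n with
    | zero => simp
    | succ m =>
      have : mulX (hermiteU m) - derivS (hermiteU m) = hermiteU (m + 1) := rfl
      simp only [Nat.add_sub_cancel, this]
      push_cast
      module

theorem integral_raise_mul (f g : 𝓢(ℝ, ℝ)) :
    ∫ x, (mulX f - derivS f) x * g x = ∫ x, f x * (mulX g + derivS g) x := by
  have h := SchwartzMap.integral_mul_deriv_eq_neg_deriv_mul f g
  have i1 : ∀ a b : 𝓢(ℝ, ℝ), Integrable fun x => a x * b x := integrable_schwartz_mul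
  have e1 : ∫ x, (mulX f - derivS f) x * g x =
      (∫ x, mulX f x * g x) - ∫ x, derivS f x * g x := by
    rw [← integral_sub (i1 _ _) (i1 _ _)]
    simp only [_root_.sub_apply, sub_mul]
  have e2 : ∫ x, f x * (mulX g + derivS g) x =
      (∫ x, f x * mulX g x) + ∫ x, f x * derivS g x := by
    rw [← integral_add (i1 _ _) (i1 _ _)]
    simp only [_root_.add_apply, mul_add]
  have e3 : ∫ x, mulX f x * g x = ∫ x, f x * mulX g x := by
    refine integral_congr_ae (Filter.Eventually.of_forall fun x => ?_)
    simp only [mulX_apply]; ring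
  have e4 : ∫ x, f x * derivS g x = -∫ x, derivS f x * g x := h
  rw [e1, e2, e3, e4]
  ring

theorem integral_hermiteU_succ_mul (n : ℕ) (g : 𝓢(ℝ, ℝ)) :
    ∫ x, hermiteU (n + 1) x * g x = ∫ x, hermiteU n x * (mulX g + derivS g) x :=
  integral_raise_mul _ _

theorem integral_hermiteU_succ_mul_hermiteU (n m : ℕ) :
    ∫ x, hermiteU (n + 1) x * hermiteU m x = 2 * m * ∫ x, hermiteU n x * hermiteU (m - 1) x := by
  rw [integral_hermiteU_succ_mul, lowering_hermiteU, ← integral_const_mul]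
  refine integral_congr_ae (Filter.Eventually.of_forall fun x => ?_)
  simp only [_root_.smul_apply, smul_eq_mul]; ring

/-- Moving a raising operator across lowers the other index, until the smaller index is `0` and
lowering gives zero. -/
theorem integral_hermiteU_mul_of_lt (n m : ℕ) (h : m < n) :
    ∫ x, hermiteU n x * hermiteU m x = 0 := by
  induction n generalizing m with
  | zero => omega
  | succ n ih =>
    rw [integral_hermiteU_succ_mul_hermiteU]
    rcases Nat.eq_zero_or_pos m with rfl | hm
    · simp
    · rw [ih (m - 1) (by omega), mul_zero]

theorem integral_hermiteU_sq_pos (n : ℕ) : 0 < ∫ x, hermiteU n x * hermiteU n x := by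
  induction n with
  | zero =>
    refine (integral_pos_iff_support_of_nonneg (fun x => mul_self_nonneg _)
      (integrable_schwartz_mul _ _)).2 ?_
    have : Function.support (fun x => hermiteU 0 x * hermiteU 0 x) = Set.univ := by
      ext x
      simp [hermiteU, gaussianS_apply, Real.exp_ne_zero]
    rw [this]
    simp
  | succ n ih =>
    rw [integral_hermiteU_succ_mul_hermiteU, Nat.add_sub_cancel]
    positivity

/-- The normalised Hermite functions. -/
def hermiteN (n : ℕ) : 𝓢(ℝ, ℝ) :=
  (Real.sqrt (∫ x, hermiteU n x * hermiteU n x))⁻¹ • hermiteU n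

theorem hermiteN_apply (n : ℕ) (x : ℝ) :
    hermiteN n x = (Real.sqrt (∫ x, hermiteU n x * hermiteU n x))⁻¹ * hermiteU n x := rfl

theorem integral_hermiteN_mul_self (n : ℕ) : ∫ x, hermiteN n x * hermiteN n x = 1 := by
  have hp := integral_hermiteU_sq_pos n
  have : ∀ x, hermiteN n x * hermiteN n x = (∫ x, hermiteU n x * hermiteU n x)⁻¹ *
      (hermiteU n x * hermiteU n x) := by
    intro x
    rw [hermiteN_apply, mul_mul_mul_comm, ← mul_inv, Real.mul_self_sqrt hp.le]
  simp only [this]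
  rw [integral_const_mul, inv_mul_cancel₀ hp.ne']

theorem integral_hermiteN_mul_of_ne (n m : ℕ) (h : n ≠ m) :
    ∫ x, hermiteN n x * hermiteN m x = 0 := by
  have key : ∀ a b : ℕ, b < a → ∫ x, hermiteN a x * hermiteN b x = 0 := by
    intro a b hab
    have h0 := integral_hermiteU_mul_of_lt a b hab
    have : ∀ x, hermiteN a x * hermiteN b x =
        ((Real.sqrt (∫ x, hermiteU a x * hermiteU a x))⁻¹ *
          (Real.sqrt (∫ x, hermiteU b x * hermiteU b x))⁻¹) * (hermiteU a x * hermiteU b x) := by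
      intro x
      rw [hermiteN_apply, hermiteN_apply]; ring
    simp only [this]
    rw [integral_const_mul, h0, mul_zero]
  rcases lt_or_gt_of_ne h with h | h
  · rw [← key m n h]
    exact integral_congr_ae (Filter.Eventually.of_forall fun x => mul_comm _ _)
  · exact key n m h

/-- The oscillator is `(x - d/dx)(x + d/dx) + 1`, and raising after lowering multiplies by `2n`. -/
theorem oscillator_hermiteU (n : ℕ) :
    mulX (mulX (hermiteU n)) - derivS (derivS (hermiteU n)) =
      (2 * n + 1 : ℝ) • hermiteU n := by
  have h := congrArg (fun f => mulX f - derivS f) (lowering_hermiteU n)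
  simp only [map_add, map_smul, derivS_mulX, ← smul_sub] at h
  have h2 : mulX (hermiteU (n - 1)) - derivS (hermiteU (n - 1)) = hermiteU (n - 1 + 1) := rfl
  rw [h2] at h
  -- At `n = 0` the index `n - 1 + 1` is `1`, not `n`, but the coefficient vanishes.
  have h3 : (2 * n : ℝ) • hermiteU (n - 1 + 1) = (2 * n : ℝ) • hermiteU n := by
    cases n with
    | zero => simp
    | succ m => rfl
  rw [h3] at h
  rw [add_smul, ← h]
  module

theorem oscillator_hermiteN (n : ℕ) :
    mulX (mulX (hermiteN n)) - derivS (derivS (hermiteN n)) =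
      (2 * n + 1 : ℝ) • hermiteN n := by
  simp only [hermiteN, map_smul, ← smul_sub, oscillator_hermiteU]
  rw [smul_comm]

/-- The Hermite functions as complex Schwartz functions. -/
def hermiteC (n : ℕ) : 𝓢(ℝ, ℂ) := (hermiteN n).postcompCLM Complex.ofRealCLM

theorem hermiteC_apply (n : ℕ) (x : ℝ) : hermiteC n x = (hermiteN n x : ℂ) := rfl

theorem harmonicOscillator_hermiteC (n : ℕ) (x : ℝ) :
    harmonicOscillator (hermiteC n) x = ((2 * n + 1 : ℝ) : ℂ) * hermiteC n x := by
  have hd : ∀ f : 𝓢(ℝ, ℝ), deriv (fun x => (f x : ℂ)) = fun x => ((derivS f x : ℝ) : ℂ) := by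
    intro f
    funext y
    exact (f.hasDerivAt y).ofReal_comp.deriv
  have e : (hermiteC n : ℝ → ℂ) = fun x => (hermiteN n x : ℂ) := rfl
  rw [harmonicOscillator, e, hd, hd]
  have := congrArg (fun f : 𝓢(ℝ, ℝ) => f x) (oscillator_hermiteN n)
  simp only [_root_.sub_apply, mulX_apply, _root_.smul_apply, smul_eq_mul] at this
  have h2 : ((x * (x * hermiteN n x) - derivS (derivS (hermiteN n)) x : ℝ) : ℂ) =
      (((2 * n + 1) * hermiteN n x : ℝ) : ℂ) := by rw [this]
  push_cast at h2 ⊢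
  rw [← h2]
  ring

end Hermite

/-! ### Completeness of the Hermite functions -/

section HermiteComplete

-- A smooth compactly supported test function is a Fourier transform `𝓕 ψ` with `ψ` Schwartz, and
-- moving `𝓕` onto `f` makes the pairing vanish.
open scoped FourierTransform in
theorem ae_eq_zero_of_fourier_eq_zero {f : ℝ → ℂ} (hf : Integrable f) (h : ∀ w, 𝓕 f w = 0) :
    f =ᵐ[volume] 0 := by
  refine ae_eq_zero_of_integral_contDiff_smul_eq_zero hf.locallyIntegrable fun g hg hgc => ?_
  have hc : HasCompactSupport fun x => (g x : ℂ) := hgc.comp_left (g := fun y : ℝ => (y : ℂ)) rfl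
  have hd : ContDiff ℝ (↑(⊤ : ℕ∞)) fun x => (g x : ℂ) := Complex.ofRealCLM.contDiff.comp hg
  set φ : 𝓢(ℝ, ℂ) := hc.toSchwartzMap hd
  have hφ : ∀ x, φ x = (g x : ℂ) := fun x => rfl
  set ψ : 𝓢(ℝ, ℂ) := 𝓕⁻ φ
  have hψ : 𝓕 ψ = φ := FourierTransform.fourier_fourierInv_eq φ
  have h1 : ∫ ξ, 𝓕 f ξ • ψ ξ = ∫ x, f x • 𝓕 (ψ : ℝ → ℂ) x := by
    have h0 := VectorFourier.integral_fourierIntegral_smul_eq_flip (L := innerₗ ℝ) (μ := volume)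
      (ν := volume) Real.continuous_fourierChar continuous_inner hf ψ.integrable
    rw [flip_innerₗ] at h0
    exact h0
  simp only [h, zero_smul, integral_zero] at h1
  rw [← SchwartzMap.fourier_coe, hψ] at h1
  rw [h1]
  refine integral_congr_ae (Filter.Eventually.of_forall fun x => ?_)
  simp only [hφ, Complex.real_smul, smul_eq_mul, mul_comm]

/-- Multiplication by `x` is half the sum of raising and lowering, so it preserves the span of the
Hermite functions. -/
theorem pow_mulX_gaussian_mem_span (k : ℕ) :
    (mulX^[k]) gaussianS ∈ Submodule.span ℝ (Set.range hermiteU) := by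
  have hX : ∀ f ∈ Submodule.span ℝ (Set.range hermiteU),
      mulX f ∈ Submodule.span ℝ (Set.range hermiteU) := by
    intro f hf
    induction hf using Submodule.span_induction with
    | mem f hf =>
      obtain ⟨n, rfl⟩ := hf
      have h1 := lowering_hermiteU n
      have h2 : mulX (hermiteU n) - derivS (hermiteU n) = hermiteU (n + 1) := rfl
      have : mulX (hermiteU n) = (1 / 2 : ℝ) • ((2 * n : ℝ) • hermiteU (n - 1)) +
          (1 / 2 : ℝ) • hermiteU (n + 1) := by
        rw [← h1, ← h2]
        module
      rw [this]
      exact add_mem (Submodule.smul_mem _ _ (Submodule.smul_mem _ _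
        (Submodule.subset_span ⟨_, rfl⟩))) (Submodule.smul_mem _ _ (Submodule.subset_span ⟨_, rfl⟩))
    | zero => rw [map_zero]; exact zero_mem _
    | add f g _ _ hf hg => rw [map_add]; exact add_mem hf hg
    | smul c f _ hf => rw [map_smul]; exact Submodule.smul_mem _ _ hf
  induction k with
  | zero => exact Submodule.subset_span ⟨0, rfl⟩
  | succ k ih =>
    rw [Function.iterate_succ_apply']
    exact hX _ ih

theorem iterate_mulX_gaussian_apply (k : ℕ) (x : ℝ) :
    (mulX^[k]) gaussianS x = x ^ k * Real.exp (-(x ^ 2 / 2)) := by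
  induction k with
  | zero => simp [gaussianS_apply]
  | succ k ih =>
    rw [Function.iterate_succ_apply', mulX_apply, ih]
    ring

theorem memLp_schwartz (f : 𝓢(ℝ, ℝ)) : MemLp (fun x => (f x : ℂ)) 2 :=
  (f.memLp 2).ofReal

theorem integral_schwartz_span_mul_eq_zero {u : ℝ → ℂ} (hu : MemLp u 2)
    (h : ∀ n, ∫ x, (hermiteN n x : ℂ) * u x = 0) (f : 𝓢(ℝ, ℝ))
    (hf : f ∈ Submodule.span ℝ (Set.range hermiteU)) : ∫ x, (f x : ℂ) * u x = 0 := by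
  have hi : ∀ f : 𝓢(ℝ, ℝ), Integrable fun x => (f x : ℂ) * u x := fun f =>
    MemLp.integrable_mul_two (memLp_schwartz f) hu
  induction hf using Submodule.span_induction with
  | mem f hf =>
    obtain ⟨n, rfl⟩ := hf
    have hp := Real.sqrt_pos.2 (integral_hermiteU_sq_pos n)
    have h1 := h n
    simp only [hermiteN_apply, Complex.ofReal_mul, mul_assoc] at h1
    rw [integral_const_mul] at h1
    exact (mul_eq_zero.1 h1).resolve_left (Complex.ofReal_ne_zero.2 (inv_pos.2 hp).ne')
  | zero => simp
  | add f g _ _ hf hg =>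
    simp only [_root_.add_apply, Complex.ofReal_add, add_mul]
    rw [integral_add (hi f) (hi g), hf, hg, add_zero]
  | smul c f _ hf =>
    simp only [_root_.smul_apply, smul_eq_mul, Complex.ofReal_mul, mul_assoc]
    rw [integral_const_mul, hf, mul_zero]

/-- Since `|t x| ≤ t² + x² / 4`, half of the Gaussian decay survives. This supplies the dominating
function for the exponential series below. -/
theorem memLp_exp_abs_gaussian (t : ℝ) :
    MemLp (fun x : ℝ => ((Real.exp (|t * x|) * Real.exp (-(x ^ 2 / 2)) : ℝ) : ℂ)) 2 := by
  have h1 : MemLp (fun x : ℝ => Real.exp (-(1 / 4) * x ^ 2)) 2 := by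
    rw [memLp_two_iff_integrable_sq (by fun_prop)]
    refine (integrable_exp_neg_mul_sq (b := 1 / 2) (by norm_num)).congr
      (Filter.Eventually.of_forall fun x => ?_)
    simp only
    rw [← Real.exp_nat_mul]
    congr 1
    push_cast
    ring
  refine (h1.const_mul (Real.exp (t ^ 2))).of_le (by fun_prop)
    (Filter.Eventually.of_forall fun x => ?_)
  rw [Complex.norm_real, Real.norm_of_nonneg (by positivity), Real.norm_of_nonneg (by positivity),
    ← Real.exp_add, ← Real.exp_add]
  refine Real.exp_le_exp.2 ?_
  rw [abs_mul]
  nlinarith [sq_nonneg (|t| - |x| / 2), sq_abs t, sq_abs x]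

-- All moments of `f = exp(-x²/2) u` vanish, and `f` has finite exponential moments. Hence its
-- Fourier transform is the sum of its moment series, which is zero.
open scoped FourierTransform in
theorem hermite_complete {u : ℝ → ℂ} (hu : MemLp u 2)
    (h : ∀ n, ∫ x, (hermiteN n x : ℂ) * u x = 0) : u =ᵐ[volume] 0 := by
  set f : ℝ → ℂ := fun x => ((Real.exp (-(x ^ 2 / 2)) : ℝ) : ℂ) * u x with hf
  have hmom : ∀ k : ℕ, ∫ x : ℝ, (x : ℂ) ^ k * f x = 0 := by
    intro k
    have := integral_schwartz_span_mul_eq_zero hu h _ (pow_mulX_gaussian_mem_span k)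
    rw [← this]
    refine integral_congr_ae (Filter.Eventually.of_forall fun x => ?_)
    simp only [hf, iterate_mulX_gaussian_apply]
    push_cast
    ring
  have hdom : ∀ t : ℝ, Integrable fun x : ℝ => Real.exp |t * x| * ‖f x‖ := by
    intro t
    refine (MemLp.integrable_mul_two (memLp_exp_abs_gaussian t) hu).norm.congr
      (Filter.Eventually.of_forall fun x => ?_)
    simp only [hf, norm_mul, Complex.norm_real, Real.norm_eq_abs, abs_mul, Real.abs_exp, mul_assoc]
  have hfi : Integrable f := by
    have := hdom 0
    simp only [zero_mul, abs_zero, Real.exp_zero, one_mul] at this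
    refine (integrable_norm_iff ?_).1 this
    exact (by fun_prop : AEStronglyMeasurable
      (fun x : ℝ => ((Real.exp (-(x ^ 2 / 2)) : ℝ) : ℂ)) volume).mul hu.1
  have hfour : ∀ w, 𝓕 f w = 0 := by
    intro w
    rw [Real.fourier_real_eq_integral_exp_smul]
    set t : ℝ := -2 * Real.pi * w with ht
    -- The exponential series is integrated termwise, dominated by `exp |t x| ‖f x‖`; each term is a
    -- multiple of a moment.
    have hs := hasSum_integral_of_dominated_convergence (μ := volume)
      (F := fun (k : ℕ) (x : ℝ) => ((t * x : ℝ) * Complex.I) ^ k / (k.factorial : ℂ) * f x)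
      (f := fun x => Complex.exp ((t * x : ℝ) * Complex.I) * f x)
      (fun k x => |t * x| ^ k / (k.factorial : ℝ) * ‖f x‖)
      (fun k => by
        refine AEStronglyMeasurable.mul ?_ hfi.1
        fun_prop)
      (fun k => Filter.Eventually.of_forall fun x => by
        simp [norm_pow])
      (Filter.Eventually.of_forall fun x => (Real.summable_pow_div_factorial _).mul_right _)
      (by
        refine (hdom t).congr (Filter.Eventually.of_forall fun x => ?_)
        simp only
        rw [tsum_mul_right, Real.exp_eq_exp_ℝ, NormedSpace.exp_eq_tsum_div])
      (Filter.Eventually.of_forall fun x => by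
        refine HasSum.mul_right _ ?_
        rw [Complex.exp_eq_exp_ℂ]
        exact NormedSpace.expSeries_div_hasSum_exp _)
    have hz : ∀ k : ℕ, ∫ x : ℝ, ((t * x : ℝ) * Complex.I) ^ k / (k.factorial : ℂ) * f x = 0 := by
      intro k
      have : ∀ x : ℝ, ((t * x : ℝ) * Complex.I) ^ k / (k.factorial : ℂ) * f x =
          ((t : ℂ) * Complex.I) ^ k / (k.factorial : ℂ) * ((x : ℂ) ^ k * f x) := by
        intro x
        push_cast
        ring
      simp only [this]
      rw [integral_const_mul, hmom, mul_zero]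
    simp only [hz] at hs
    have h0 := hs.unique hasSum_zero
    rw [← h0]
    refine integral_congr_ae (Filter.Eventually.of_forall fun x => ?_)
    simp only [smul_eq_mul, ht]
    congr 4
    ring
  filter_upwards [ae_eq_zero_of_fourier_eq_zero hfi hfour] with x hx
  simp only [hf, Pi.zero_apply] at hx
  exact (mul_eq_zero.1 hx).resolve_left (Complex.ofReal_ne_zero.2 (Real.exp_ne_zero _))

theorem isL2Basis_hermite : IsL2Basis (volume : Measure ℝ) fun n x => hermiteN n x where
  measurable n := (hermiteN n).continuous.measurable
  memLp n := memLp_schwartz _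
  norm n := by
    have := integral_hermiteN_mul_self n
    rw [← Complex.ofReal_inj, ← integral_complex_ofReal] at this
    push_cast at this
    exact this
  orth n m h := by
    have := integral_hermiteN_mul_of_ne n m h
    rw [← Complex.ofReal_inj, ← integral_complex_ofReal] at this
    push_cast at this
    exact this
  complete u hu h := hermite_complete hu h

end HermiteComplete

/-! ### Hilbert bases and Parseval's identity -/

section Parseval

variable {X κ : Type*} [MeasurableSpace X] {μ : Measure X} {E : κ → X → ℝ}

/-- A member of the family as a vector of `L²(μ)`. -/
def IsL2Basis.vec (h : IsL2Basis μ E) (a : κ) : Lp ℂ 2 μ := (h.memLp a).toLp _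

theorem IsL2Basis.inner_vec (h : IsL2Basis μ E) (a : κ) (f : Lp ℂ 2 μ) :
    inner ℂ (h.vec a) f = ∫ x, (E a x : ℂ) * f x ∂μ := by
  rw [L2.inner_def]
  refine integral_congr_ae ?_
  filter_upwards [(h.memLp a).coeFn_toLp] with x hx
  rw [IsL2Basis.vec, hx, RCLike.inner_apply, mul_comm]
  simp

theorem IsL2Basis.orthonormal (h : IsL2Basis μ E) : Orthonormal ℂ h.vec := by
  classical
  rw [orthonormal_iff_ite]
  intro a b
  have e : inner ℂ (h.vec a) (h.vec b) = ∫ x, (E a x : ℂ) * E b x ∂μ := by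
    rw [h.inner_vec]
    refine integral_congr_ae ?_
    filter_upwards [(h.memLp b).coeFn_toLp] with x hx
    rw [IsL2Basis.vec, hx]
  rw [e]
  split_ifs with hab
  · rw [hab, h.norm]
  · exact h.orth a b hab

theorem IsL2Basis.orthogonal_eq_bot (h : IsL2Basis μ E) :
    (Submodule.span ℂ (Set.range h.vec))ᗮ = ⊥ := by
  rw [Submodule.eq_bot_iff]
  intro f hf
  rw [Submodule.mem_orthogonal] at hf
  have : f =ᵐ[μ] 0 := h.complete f (Lp.memLp f) fun a => by
    rw [← h.inner_vec]
    exact hf _ (Submodule.subset_span ⟨a, rfl⟩)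
  exact Lp.ext (this.trans (Lp.coeFn_zero ℂ 2 μ).symm)

/-- The associated Hilbert basis of `L²(μ)`. -/
def IsL2Basis.hilbertBasis (h : IsL2Basis μ E) : HilbertBasis κ ℂ (Lp ℂ 2 μ) :=
  HilbertBasis.mkOfOrthogonalEqBot h.orthonormal h.orthogonal_eq_bot

theorem IsL2Basis.hilbertBasis_apply (h : IsL2Basis μ E) (a : κ) : h.hilbertBasis a = h.vec a := by
  rw [IsL2Basis.hilbertBasis, HilbertBasis.coe_mkOfOrthogonalEqBot]

theorem IsL2Basis.hasSum_coef (h : IsL2Basis μ E) {f g : X → ℂ} (hf : MemLp f 2 μ)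
    (hg : MemLp g 2 μ) :
    HasSum (fun a => conj (∫ x, (E a x : ℂ) * f x ∂μ) * ∫ x, (E a x : ℂ) * g x ∂μ)
      (∫ x, conj (f x) * g x ∂μ) := by
  have h1 := h.hilbertBasis.hasSum_inner_mul_inner (hf.toLp f) (hg.toLp g)
  have e : ∀ {f : X → ℂ} (hf : MemLp f 2 μ) (a : κ),
      inner ℂ (h.hilbertBasis a) (hf.toLp f) = ∫ x, (E a x : ℂ) * f x ∂μ := by
    intro f hf a
    rw [h.hilbertBasis_apply, h.inner_vec]
    refine integral_congr_ae ?_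
    filter_upwards [hf.coeFn_toLp] with x hx
    rw [hx]
  have e2 : inner ℂ (hf.toLp f) (hg.toLp g) = ∫ x, conj (f x) * g x ∂μ := by
    rw [L2.inner_def]
    refine integral_congr_ae ?_
    filter_upwards [hf.coeFn_toLp, hg.coeFn_toLp] with x hx hx'
    rw [hx, hx', RCLike.inner_apply, mul_comm]
  rw [e2] at h1
  refine h1.congr_fun fun a => ?_
  rw [← inner_conj_symm (hf.toLp f), e, e]

theorem IsL2Basis.hasSum_norm_sq (h : IsL2Basis μ E) {f : X → ℂ} (hf : MemLp f 2 μ) :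
    HasSum (fun a => ‖∫ x, (E a x : ℂ) * f x ∂μ‖ ^ 2) (∫ x, ‖f x‖ ^ 2 ∂μ) := by
  have h1 := h.hasSum_coef hf hf
  simp only [Complex.conj_mul'] at h1
  have e : ∫ x, (‖f x‖ : ℂ) ^ 2 ∂μ = ((∫ x, ‖f x‖ ^ 2 ∂μ : ℝ) : ℂ) := by
    rw [← integral_complex_ofReal]
    push_cast
    rfl
  rw [e] at h1
  exact_mod_cast h1

theorem ofReal_integral_norm_sq {f : X → ℂ} (hf : MemLp f 2 μ) :
    ENNReal.ofReal (∫ x, ‖f x‖ ^ 2 ∂μ) = ∫⁻ x, ‖f x‖ₑ ^ 2 ∂μ := by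
  rw [ofReal_integral_eq_lintegral_ofReal ((memLp_two_iff_integrable_sq_norm hf.1).1 hf)
    (Filter.Eventually.of_forall fun x => sq_nonneg _)]
  refine lintegral_congr fun x => ?_
  rw [ENNReal.ofReal_pow (norm_nonneg _), ofReal_norm]

theorem IsL2Basis.tsum_enorm_sq (h : IsL2Basis μ E) {f : X → ℂ} (hf : MemLp f 2 μ) :
    ∑' a, ‖∫ x, (E a x : ℂ) * f x ∂μ‖ₑ ^ 2 = ∫⁻ x, ‖f x‖ₑ ^ 2 ∂μ := by
  have h1 := h.hasSum_norm_sq hf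
  rw [← ofReal_integral_norm_sq hf, ← h1.tsum_eq,
    ENNReal.ofReal_tsum_of_nonneg (fun a => sq_nonneg _) h1.summable]
  refine tsum_congr fun a => ?_
  rw [ENNReal.ofReal_pow (norm_nonneg _), ofReal_norm]

theorem IsL2Basis.weightedBessel_one (h : IsL2Basis μ E) :
    WeightedBessel μ E (fun _ => 1) fun _ => 1 := by
  intro u hu
  simp only [one_mul]
  exact (h.tsum_enorm_sq hu).le

end Parseval

/-! ### The Hardy-type inequality `∑ₙ μₙ^{-1/6} |eₙ⟩⟨eₙ| ≤ C |x|^{1/3}` -/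

section Hardy

/-- `v(x)²` is the integral of `2 v v'` over `(-∞, x]`, and `2 v v' ≤ c v² + c⁻¹ v'²`. -/
theorem schwartz_sq_le (v : 𝓢(ℝ, ℝ)) (c : ℝ) (hc : 0 < c) (x : ℝ) :
    v x ^ 2 ≤ c * (∫ y, v y * v y) + c⁻¹ * ∫ y, derivS v y * derivS v y := by
  have hi := integrable_schwartz_mul
  have hd : ∀ y ∈ Set.Iic x, HasDerivAt (fun y => v y * v y)
      (derivS v y * v y + v y * derivS v y) y := fun y _ => (v.hasDerivAt y).mul (v.hasDerivAt y)
  have hInt : Integrable fun y => derivS v y * v y + v y * derivS v y := (hi _ _).add (hi _ _)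
  have hlim : Filter.Tendsto (fun y => v y * v y) Filter.atBot (nhds 0) := by
    have h0 : Filter.Tendsto v Filter.atBot (nhds 0) :=
      v.tendsto_cocompact.mono_left atBot_le_cocompact
    simpa using h0.mul h0
  have h1 := integral_Iic_of_hasDerivAt_of_tendsto' hd hInt.integrableOn hlim
  rw [sub_zero] at h1
  rw [sq, ← h1, ← integral_const_mul, ← integral_const_mul,
    ← integral_add ((hi _ _).const_mul _) ((hi _ _).const_mul _)]
  have hb : ∀ y, derivS v y * v y + v y * derivS v y ≤
      c * (v y * v y) + c⁻¹ * (derivS v y * derivS v y) := by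
    intro y
    have : 0 ≤ c⁻¹ * (c * v y - derivS v y) ^ 2 := by positivity
    have e : c⁻¹ * (c * v y - derivS v y) ^ 2 = c * (v y * v y) +
        c⁻¹ * (derivS v y * derivS v y) - (derivS v y * v y + v y * derivS v y) := by
      field_simp
      ring
    linarith
  have hI2 : Integrable fun y => c * (v y * v y) + c⁻¹ * (derivS v y * derivS v y) :=
    ((hi _ _).const_mul _).add ((hi _ _).const_mul _)
  calc _ ≤ ∫ y in Set.Iic x, (c * (v y * v y) + c⁻¹ * (derivS v y * derivS v y)) :=
        integral_mono hInt.integrableOn hI2.integrableOn hb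
    _ ≤ _ := setIntegral_le_integral hI2 (Filter.Eventually.of_forall fun y => by
        have := mul_self_nonneg (v y)
        have := mul_self_nonneg (derivS v y)
        have := inv_pos.2 hc
        simp only [Pi.zero_apply]
        positivity)

/-- After integration by parts the right side is `∫ v'² + ∫ y² v²`. -/
theorem integral_derivS_sq_le (v : 𝓢(ℝ, ℝ)) :
    ∫ y, derivS v y * derivS v y ≤ ∫ y, v y * (mulX (mulX v) - derivS (derivS v)) y := by
  have hi := integrable_schwartz_mul
  have h1 : ∫ y, v y * derivS (derivS v) y = -∫ y, derivS v y * derivS v y :=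
    SchwartzMap.integral_mul_deriv_eq_neg_deriv_mul v (derivS v)
  have h2 : ∫ y, v y * (mulX (mulX v) - derivS (derivS v)) y =
      (∫ y, v y * mulX (mulX v) y) - ∫ y, v y * derivS (derivS v) y := by
    rw [← integral_sub (hi _ _) (hi _ _)]
    simp only [_root_.sub_apply, mul_sub]
  have h3 : 0 ≤ ∫ y, v y * mulX (mulX v) y := integral_nonneg fun y => by
    simp only [mulX_apply, Pi.zero_apply]
    nlinarith [sq_nonneg (y * v y)]
  rw [h2, h1]
  linarith

theorem integral_sum_hermiteN_mul (s : Finset ℕ) (a b : ℕ → ℝ) :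
    ∫ y, (∑ n ∈ s, a n • hermiteN n) y * (∑ n ∈ s, b n • hermiteN n) y = ∑ n ∈ s, a n * b n := by
  have hi := integrable_schwartz_mul
  have e : ∀ c : ℕ → ℝ, ∀ y, (∑ n ∈ s, c n • hermiteN n) y = ∑ n ∈ s, c n * hermiteN n y := by
    intro c y
    rw [_root_.sum_apply]
    rfl
  simp only [e, Finset.sum_mul_sum]
  have hnm : ∀ n m, Integrable fun y => a n * hermiteN n y * (b m * hermiteN m y) := fun n m =>
    ((hi (hermiteN n) (hermiteN m)).const_mul (a n * b m)).congr
      (Filter.Eventually.of_forall fun y => by ring)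
  rw [integral_finsetSum _ fun n _ => integrable_finsetSum _ fun m _ => hnm n m]
  · refine Finset.sum_congr rfl fun n hn => ?_
    rw [integral_finsetSum _ fun m _ => hnm n m]
    · have : ∀ m, ∫ y, a n * hermiteN n y * (b m * hermiteN m y) =
          a n * b m * ∫ y, hermiteN n y * hermiteN m y := by
        intro m
        rw [← integral_const_mul]
        exact integral_congr_ae (Filter.Eventually.of_forall fun y => by ring)
      simp only [this]
      rw [Finset.sum_eq_single_of_mem n hn]
      · rw [integral_hermiteN_mul_self, mul_one]
      · intro m _ hm
        rw [integral_hermiteN_mul_of_ne n m hm.symm, mul_zero]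

/-- For the reproducing combination `v = ∑ e_n(x) e_n` with `x` fixed, both `v(x)` and `∫ v²` equal
the sum `S` to be bounded, while `⟨v, h v⟩ ≤ r⁻² S`. The pointwise bound then reads `S² ≤ 2 r⁻¹ S`.
-/
theorem sum_hermiteN_sq_le (s : Finset ℕ) (r : ℝ) (hr : 0 < r)
    (hs : ∀ n ∈ s, (2 * n + 1 : ℝ) * r ^ 2 ≤ 1) (x : ℝ) :
    ∑ n ∈ s, hermiteN n x ^ 2 ≤ 2 * r⁻¹ := by
  set a : ℕ → ℝ := fun n => hermiteN n x
  set v : 𝓢(ℝ, ℝ) := ∑ n ∈ s, a n • hermiteN n with hv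
  have hvx : v x = ∑ n ∈ s, hermiteN n x ^ 2 := by
    rw [hv, _root_.sum_apply]
    exact Finset.sum_congr rfl fun n _ => (sq _).symm
  set S := ∑ n ∈ s, hermiteN n x ^ 2 with hS
  have h1 : ∫ y, v y * v y = S := by
    rw [hv, integral_sum_hermiteN_mul]
    exact Finset.sum_congr rfl fun n _ => (sq _).symm
  have hH : mulX (mulX v) - derivS (derivS v) = ∑ n ∈ s, (a n * (2 * n + 1)) • hermiteN n := by
    rw [hv]
    simp only [map_sum, map_smul, ← Finset.sum_sub_distrib, ← smul_sub, oscillator_hermiteN,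
      smul_smul]
  have h2 : ∫ y, derivS v y * derivS v y ≤ (r ^ 2)⁻¹ * S := by
    refine (integral_derivS_sq_le v).trans ?_
    rw [hH, hv, integral_sum_hermiteN_mul, hS, Finset.mul_sum]
    refine Finset.sum_le_sum fun n hn => ?_
    have h3 : (2 * n + 1 : ℝ) ≤ (r ^ 2)⁻¹ := by
      rw [← one_div, le_div_iff₀ (by positivity)]
      exact hs n hn
    calc _ = (2 * n + 1 : ℝ) * hermiteN n x ^ 2 := by ring
      _ ≤ _ := mul_le_mul_of_nonneg_right h3 (sq_nonneg _)
  -- The choice `c = r⁻¹` balances the two terms, each becoming at most `r⁻¹ S`.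
  have h4 := schwartz_sq_le v r⁻¹ (inv_pos.2 hr) x
  rw [hvx, h1, inv_inv] at h4
  have h5 : r * ∫ y, derivS v y * derivS v y ≤ r⁻¹ * S := by
    refine (mul_le_mul_of_nonneg_left h2 hr.le).trans (le_of_eq ?_)
    field_simp
  have hS0 : 0 ≤ S := Finset.sum_nonneg fun n _ => sq_nonneg _
  have h6 : S ^ 2 ≤ 2 * r⁻¹ * S := by linarith
  rcases hS0.eq_or_lt with h | h
  · rw [← h]; positivity
  · nlinarith

/-- Duality: the sum `T` of squared coefficients is the pairing of `u` with `∑ conj(c_n) e_n`, whose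
supremum is at most `√T √(2 / r)` by Cauchy–Schwarz and `sum_hermiteN_sq_le`. This is the `L¹` to
`L²` bound for the low-energy spectral projection. -/
theorem sum_norm_hermite_coef_le (s : Finset ℕ) (r : ℝ) (hr : 0 < r)
    (hs : ∀ n ∈ s, (2 * n + 1 : ℝ) * r ^ 2 ≤ 1) {u : ℝ → ℂ} (hu : MemLp u 2)
    (hui : Integrable u) :
    ∑ n ∈ s, ‖∫ x, (hermiteN n x : ℂ) * u x‖ ^ 2 ≤ 2 * r⁻¹ * (∫ x, ‖u x‖) ^ 2 := by
  set c : ℕ → ℂ := fun n => ∫ x, (hermiteN n x : ℂ) * u x with hc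
  set T := ∑ n ∈ s, ‖c n‖ ^ 2 with hT
  have hT0 : 0 ≤ T := Finset.sum_nonneg fun n _ => sq_nonneg _
  have hi : ∀ n, Integrable fun x => (hermiteN n x : ℂ) * u x := fun n =>
    MemLp.integrable_mul_two (memLp_schwartz _) hu
  have e1 : (T : ℂ) = ∫ x, (∑ n ∈ s, conj (c n) * hermiteN n x) * u x := by
    simp only [Finset.sum_mul, mul_assoc]
    rw [integral_finsetSum _ fun n _ => (hi n).const_mul _, hT]
    push_cast
    refine Finset.sum_congr rfl fun n _ => ?_
    rw [integral_const_mul, ← Complex.conj_mul']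
  have hb : ∀ x, ‖∑ n ∈ s, conj (c n) * (hermiteN n x : ℂ)‖ ≤
      Real.sqrt T * Real.sqrt (2 * r⁻¹) := by
    intro x
    have h1 : ‖∑ n ∈ s, conj (c n) * (hermiteN n x : ℂ)‖ ≤ ∑ n ∈ s, ‖c n‖ * |hermiteN n x| := by
      refine (norm_sum_le _ _).trans (le_of_eq (Finset.sum_congr rfl fun n _ => ?_))
      simp
    refine h1.trans ((Real.sum_mul_le_sqrt_mul_sqrt s _ _).trans ?_)
    refine mul_le_mul_of_nonneg_left (Real.sqrt_le_sqrt ?_) (Real.sqrt_nonneg _)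
    simp only [sq_abs]
    exact sum_hermiteN_sq_le s r hr hs x
  have h2 : T ≤ Real.sqrt T * (Real.sqrt (2 * r⁻¹) * ∫ x, ‖u x‖) := by
    calc T = ‖(T : ℂ)‖ := by rw [Complex.norm_real, Real.norm_of_nonneg hT0]
      _ = ‖∫ x, (∑ n ∈ s, conj (c n) * hermiteN n x) * u x‖ := by rw [e1]
      _ ≤ ∫ x, Real.sqrt T * Real.sqrt (2 * r⁻¹) * ‖u x‖ := by
        refine norm_integral_le_of_norm_le (hui.norm.const_mul _)
          (Filter.Eventually.of_forall fun x => ?_)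
        rw [norm_mul]
        exact mul_le_mul_of_nonneg_right (hb x) (norm_nonneg _)
      _ = _ := by rw [integral_const_mul]; ring
  have h3 : Real.sqrt T ≤ Real.sqrt (2 * r⁻¹) * ∫ x, ‖u x‖ := by
    rcases hT0.eq_or_lt with h | h
    · rw [← h, Real.sqrt_zero]
      exact mul_nonneg (Real.sqrt_nonneg _) (integral_nonneg fun x => norm_nonneg _)
    · have hp := Real.sqrt_pos.2 h
      have h4 : Real.sqrt T * Real.sqrt T ≤ Real.sqrt T * (Real.sqrt (2 * r⁻¹) * ∫ x, ‖u x‖) := by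
        rwa [Real.mul_self_sqrt hT0]
      exact le_of_mul_le_mul_left h4 hp
  calc T = Real.sqrt T ^ 2 := (Real.sq_sqrt hT0).symm
    _ ≤ (Real.sqrt (2 * r⁻¹) * ∫ x, ‖u x‖) ^ 2 := pow_le_pow_left₀ (Real.sqrt_nonneg _) h3 2
    _ = _ := by rw [mul_pow, Real.sq_sqrt (by positivity)]

end Hardy

section Hardy

theorem lintegral_Ioc_rpow {q : ℝ} (hq : -1 < q) {a : ℝ} (ha : 0 ≤ a) :
    ∫⁻ r in Set.Ioc 0 a, ENNReal.ofReal (r ^ q) = ENNReal.ofReal (a ^ (q + 1) / (q + 1)) := by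
  have hi : IntegrableOn (fun r : ℝ => r ^ q) (Set.Ioc 0 a) :=
    (intervalIntegrable_iff_integrableOn_Ioc_of_le ha).1
      (intervalIntegral.intervalIntegrable_rpow' hq)
  rw [← ofReal_integral_eq_lintegral_ofReal hi, ← intervalIntegral.integral_of_le ha,
    integral_rpow (Or.inl hq), Real.zero_rpow (by linarith), sub_zero]
  filter_upwards [ae_restrict_mem measurableSet_Ioc] with r hr
  exact Real.rpow_nonneg hr.1.le _

theorem lintegral_Ioi_rpow {q : ℝ} (hq : q < -1) {a : ℝ} (ha : 0 < a) :
    ∫⁻ r in Set.Ioi a, ENNReal.ofReal (r ^ q) = ENNReal.ofReal (-a ^ (q + 1) / (q + 1)) := by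
  rw [← ofReal_integral_eq_lintegral_ofReal (integrableOn_Ioi_rpow_of_lt hq ha),
    integral_Ioi_rpow_of_lt hq ha]
  filter_upwards [ae_restrict_mem measurableSet_Ioi] with r hr
  exact Real.rpow_nonneg (ha.trans hr).le _

theorem enorm_add_sq_le (a b : ℂ) : ‖a + b‖ₑ ^ 2 ≤ 2 * ‖a‖ₑ ^ 2 + 2 * ‖b‖ₑ ^ 2 := by
  have h : ‖a + b‖ ^ 2 ≤ 2 * ‖a‖ ^ 2 + 2 * ‖b‖ ^ 2 := by
    have := norm_add_le a b
    nlinarith [norm_nonneg (a + b), norm_nonneg a, norm_nonneg b, sq_nonneg (‖a‖ - ‖b‖)]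
  have h2 := ENNReal.ofReal_le_ofReal h
  rw [ENNReal.ofReal_add (by positivity) (by positivity), ENNReal.ofReal_mul (by norm_num),
    ENNReal.ofReal_mul (by norm_num), ENNReal.ofReal_pow (norm_nonneg _),
    ENNReal.ofReal_pow (norm_nonneg _), ENNReal.ofReal_pow (norm_nonneg _)] at h2
  simpa using h2

theorem lintegral_abs_rpow_le {r : ℝ} (hr : 0 < r) :
    ∫⁻ x in Set.Ioo (-r) r, ENNReal.ofReal (|x| ^ (-(1 / 2) : ℝ)) ≤
      ENNReal.ofReal (4 * r ^ (1 / 2 : ℝ)) := by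
  have h1 : ∫⁻ x in Set.Ioc 0 r, ENNReal.ofReal (|x| ^ (-(1 / 2) : ℝ)) =
      ENNReal.ofReal (2 * r ^ (1 / 2 : ℝ)) := by
    have := lintegral_Ioc_rpow (q := -(1 / 2)) (by norm_num) hr.le
    rw [show (-(1 / 2) + 1 : ℝ) = 1 / 2 by norm_num] at this
    rw [show 2 * r ^ (1 / 2 : ℝ) = r ^ (1 / 2 : ℝ) / (1 / 2) by ring, ← this]
    refine setLIntegral_congr_fun measurableSet_Ioc fun x hx => ?_
    simp only [abs_of_pos hx.1]
  have h2 : ∫⁻ x in Set.Ico (-r) 0, ENNReal.ofReal (|x| ^ (-(1 / 2) : ℝ)) =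
      ENNReal.ofReal (2 * r ^ (1 / 2 : ℝ)) := by
    rw [← h1]
    have := (Measure.measurePreserving_neg (volume : Measure ℝ)).setLIntegral_comp_preimage_emb
      (MeasurableEquiv.neg ℝ).measurableEmbedding
      (fun x => ENNReal.ofReal (|x| ^ (-(1 / 2) : ℝ))) (Set.Ioc 0 r)
    simp only [abs_neg] at this
    rw [← this]
    congr 2
    ext x
    simp only [Set.mem_Ico, Set.mem_preimage, Set.mem_Ioc]
    constructor <;> rintro ⟨a, b⟩ <;> constructor <;> linarith
  have h3 : Set.Ioo (-r) r ⊆ Set.Ico (-r) 0 ∪ {0} ∪ Set.Ioc 0 r := by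
    intro x hx
    rcases lt_trichotomy x 0 with h | h | h
    · exact Or.inl (Or.inl ⟨hx.1.le, h⟩)
    · exact Or.inl (Or.inr h)
    · exact Or.inr ⟨h, hx.2.le⟩
  refine (lintegral_mono_set h3).trans ((lintegral_union_le _ _ _).trans ?_)
  refine (add_le_add_left (lintegral_union_le _ _ _) _).trans ?_
  rw [h1, h2]
  simp only [Measure.restrict_singleton, measure_singleton, zero_smul, lintegral_zero_measure,
    add_zero]
  rw [← ENNReal.ofReal_add (by positivity) (by positivity)]
  exact ENNReal.ofReal_le_ofReal (by linarith)

/-- The bound for the spectral projection of the oscillator on `[0, r⁻²]`. -/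
def hardyKernel (r x : ℝ) : ℝ≥0∞ :=
  if |x| < r then 16 * ENNReal.ofReal (r ^ (-(1 / 2) : ℝ)) * ENNReal.ofReal (|x| ^ (1 / 2 : ℝ))
  else 2

/-- The function is cut at `|x| = r`. Inside, the low-energy projection is controlled by the `L¹`
norm; outside, by Parseval. The cut costs a factor `2`, whence the constants `16` and `2` of
`hardyKernel`. -/
theorem sum_enorm_hermite_coef_le (s : Finset ℕ) (r : ℝ) (hr : 0 < r)
    (hs : ∀ n ∈ s, (2 * n + 1 : ℝ) * r ^ 2 ≤ 1) {u : ℝ → ℂ} (hu : MemLp u 2) :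
    ∑ n ∈ s, ‖∫ x, (hermiteN n x : ℂ) * u x‖ₑ ^ 2 ≤
      ∫⁻ x, hardyKernel r x * ‖u x‖ₑ ^ 2 := by
  set I := Set.Ioo (-r) r with hI
  have hIm : MeasurableSet I := measurableSet_Ioo
  have habs : ∀ x, x ∈ I ↔ |x| < r := fun x => by rw [abs_lt]; rfl
  set u₀ := I.indicator u
  set u₁ := Iᶜ.indicator u
  have hu₀ : MemLp u₀ 2 := hu.indicator hIm
  have hu₁ : MemLp u₁ 2 := hu.indicator hIm.compl
  have hsum : ∀ x, u x = u₁ x + u₀ x := fun x => by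
    have := congrFun (Set.indicator_compl_add_self I u) x
    exact this.symm
  have hui : Integrable u₀ := by
    have : IsFiniteMeasure ((volume : Measure ℝ).restrict I) := ⟨by simp [hI]⟩
    have h1 : MemLp u 2 (volume.restrict I) := hu.restrict I
    have h2 : Integrable u (volume.restrict I) := h1.integrable (by norm_num)
    exact (integrable_indicator_iff hIm).2 h2
  have hi : ∀ {w : ℝ → ℂ}, MemLp w 2 → ∀ n, Integrable fun x => (hermiteN n x : ℂ) * w x :=
    fun hw n => MemLp.integrable_mul_two (memLp_schwartz _) hw
  have hcoef : ∀ n, ∫ x, (hermiteN n x : ℂ) * u x =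
      (∫ x, (hermiteN n x : ℂ) * u₁ x) + ∫ x, (hermiteN n x : ℂ) * u₀ x := by
    intro n
    rw [← integral_add (hi hu₁ n) (hi hu₀ n)]
    refine integral_congr_ae (Filter.Eventually.of_forall fun x => ?_)
    simp only [hsum x]; ring
  -- Cauchy–Schwarz with the weights `|x|^(∓1/4)` on `(-r, r)` gives a factor `4 r^(1/2)`; with the
  -- `2 / r` of the `L¹` bound this makes `8 r^(-1/2)`.
  have hlow : ∑ n ∈ s, ‖∫ x, (hermiteN n x : ℂ) * u₀ x‖ₑ ^ 2 ≤
      8 * ENNReal.ofReal (r ^ (-(1 / 2) : ℝ)) *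
        ∫⁻ x in I, ENNReal.ofReal (|x| ^ (1 / 2 : ℝ)) * ‖u x‖ₑ ^ 2 := by
    have h1 := ENNReal.ofReal_le_ofReal (sum_norm_hermite_coef_le s r hr hs hu₀ hui)
    rw [ENNReal.ofReal_sum_of_nonneg fun n _ => sq_nonneg _] at h1
    simp only [ENNReal.ofReal_pow (norm_nonneg _), ofReal_norm] at h1
    refine h1.trans ?_
    rw [ENNReal.ofReal_mul (by positivity),
      ENNReal.ofReal_pow (integral_nonneg fun x => norm_nonneg _),
      ofReal_integral_norm_eq_lintegral_enorm hui]
    have h2 : ∫⁻ x, ‖u₀ x‖ₑ = ∫⁻ x in I, ENNReal.ofReal (|x| ^ (-(1 / 4) : ℝ)) *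
        (ENNReal.ofReal (|x| ^ (1 / 4 : ℝ)) * ‖u x‖ₑ) := by
      have e : ∀ x, ‖u₀ x‖ₑ = I.indicator (fun x => ‖u x‖ₑ) x := fun x =>
        enorm_indicator_eq_indicator_enorm _ _
      simp only [e]
      rw [lintegral_indicator hIm]
      refine lintegral_congr_ae (ae_restrict_of_ae ?_)
      have h0 : ∀ᵐ x : ℝ, x ≠ 0 := by
        rw [ae_iff]
        simp
      filter_upwards [h0] with x hx
      have hx' := abs_pos.2 hx
      rw [← mul_assoc, ← ENNReal.ofReal_mul (by positivity), ← Real.rpow_add hx']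
      norm_num
    have hmu : AEMeasurable (fun x => ‖u x‖ₑ) (volume.restrict I) := hu.1.enorm.restrict
    have h3 := lintegral_mul_sq_le (μ := volume.restrict I)
      (f := fun x => ENNReal.ofReal (|x| ^ (-(1 / 4) : ℝ)))
      (g := fun x => ENNReal.ofReal (|x| ^ (1 / 4 : ℝ)) * ‖u x‖ₑ)
      (by fun_prop) (AEMeasurable.mul (by fun_prop) hmu)
    rw [← h2] at h3
    have e1 : ∀ x : ℝ, ENNReal.ofReal (|x| ^ (-(1 / 4) : ℝ)) ^ 2 =
        ENNReal.ofReal (|x| ^ (-(1 / 2) : ℝ)) := by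
      intro x
      rw [← ENNReal.ofReal_pow (by positivity), ← Real.rpow_natCast,
        ← Real.rpow_mul (abs_nonneg x)]
      norm_num
    have e2 : ∀ x : ℝ, (ENNReal.ofReal (|x| ^ (1 / 4 : ℝ)) * ‖u x‖ₑ) ^ 2 =
        ENNReal.ofReal (|x| ^ (1 / 2 : ℝ)) * ‖u x‖ₑ ^ 2 := by
      intro x
      rw [mul_pow, ← ENNReal.ofReal_pow (by positivity), ← Real.rpow_natCast,
        ← Real.rpow_mul (abs_nonneg x)]
      norm_num
    simp only [e1, e2] at h3
    have h4 := h3.trans (mul_le_mul_left (lintegral_abs_rpow_le hr) _)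
    refine (mul_le_mul_right h4 _).trans (le_of_eq ?_)
    rw [← mul_assoc]
    congr 1
    rw [← ENNReal.ofReal_mul (by positivity),
      show (8 : ℝ≥0∞) = ENNReal.ofReal 8 by norm_num, ← ENNReal.ofReal_mul (by norm_num)]
    congr 1
    have h5 : r⁻¹ * r ^ (1 / 2 : ℝ) = r ^ (-(1 / 2) : ℝ) := by
      rw [← Real.rpow_neg_one, ← Real.rpow_add hr]
      norm_num
    rw [← h5]; ring
  have hhigh : ∑ n ∈ s, ‖∫ x, (hermiteN n x : ℂ) * u₁ x‖ₑ ^ 2 ≤ ∫⁻ x in Iᶜ, ‖u x‖ₑ ^ 2 := by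
    refine (ENNReal.sum_le_tsum s).trans ?_
    rw [isL2Basis_hermite.tsum_enorm_sq hu₁, ← lintegral_indicator hIm.compl]
    refine lintegral_mono fun x => ?_
    by_cases hx : x ∈ Iᶜ
    · simp [u₁, Set.indicator_of_mem hx]
    · simp [u₁, Set.indicator_of_notMem hx]
  calc _ ≤ ∑ n ∈ s, (2 * ‖∫ x, (hermiteN n x : ℂ) * u₁ x‖ₑ ^ 2 +
        2 * ‖∫ x, (hermiteN n x : ℂ) * u₀ x‖ₑ ^ 2) := by
        refine Finset.sum_le_sum fun n _ => ?_
        rw [hcoef n]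
        exact enorm_add_sq_le _ _
    _ ≤ 2 * (∫⁻ x in Iᶜ, ‖u x‖ₑ ^ 2) + 2 * (8 * ENNReal.ofReal (r ^ (-(1 / 2) : ℝ)) *
        ∫⁻ x in I, ENNReal.ofReal (|x| ^ (1 / 2 : ℝ)) * ‖u x‖ₑ ^ 2) := by
        rw [Finset.sum_add_distrib, ← Finset.mul_sum, ← Finset.mul_sum]
        gcongr
    _ = _ := by
        rw [add_comm, ← lintegral_add_compl (fun x => hardyKernel r x * ‖u x‖ₑ ^ 2) hIm]
        congr 1
        · rw [← mul_assoc, ← mul_assoc, ← lintegral_const_mul'']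
          · refine setLIntegral_congr_fun hIm fun x hx => ?_
            simp only [hardyKernel, if_pos ((habs x).1 hx)]
            rw [← mul_assoc]
            norm_num
          · exact AEMeasurable.mul (by fun_prop) (hu.1.enorm.restrict.pow_const 2)
        · rw [← lintegral_const_mul'' _ (hu.1.enorm.restrict.pow_const 2)]
          refine setLIntegral_congr_fun hIm.compl fun x hx => ?_
          have : ¬ |x| < r := fun h => hx ((habs x).2 h)
          simp only [hardyKernel, if_neg this]

/-- The range `r ≤ |x|` contributes `2 · 3 |x|^(1/3)`, and the range `r > |x|` contributes `16
|x|^(1/2) · 6 |x|^(-1/6)`; in total `6 + 96 = 102`. -/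
theorem lintegral_hardyKernel (x : ℝ) (hx : x ≠ 0) :
    ∫⁻ r in Set.Ioi 0, ENNReal.ofReal (r ^ (-(2 / 3) : ℝ)) * hardyKernel r x =
      102 * ENNReal.ofReal (|x| ^ (1 / 3 : ℝ)) := by
  have ha := abs_pos.2 hx
  set a := |x| with hadef
  rw [← Set.Ioc_union_Ioi_eq_Ioi ha.le,
    lintegral_union measurableSet_Ioi (by
      rw [Set.disjoint_left]; rintro r ⟨_, h⟩ h'; exact absurd h' (not_lt.2 h))]
  have h1 : ∫⁻ r in Set.Ioc 0 a, ENNReal.ofReal (r ^ (-(2 / 3) : ℝ)) * hardyKernel r x =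
      6 * ENNReal.ofReal (a ^ (1 / 3 : ℝ)) := by
    have : ∫⁻ r in Set.Ioc 0 a, ENNReal.ofReal (r ^ (-(2 / 3) : ℝ)) * hardyKernel r x =
        ∫⁻ r in Set.Ioc 0 a, 2 * ENNReal.ofReal (r ^ (-(2 / 3) : ℝ)) := by
      refine setLIntegral_congr_fun measurableSet_Ioc fun r hr => ?_
      simp only [hardyKernel, if_neg (show ¬ |x| < r from not_lt.2 hr.2)]
      rw [mul_comm]
    rw [this, lintegral_const_mul _ (by fun_prop), lintegral_Ioc_rpow (by norm_num) ha.le,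
      show (-(2 / 3) + 1 : ℝ) = 1 / 3 by norm_num,
      show a ^ (1 / 3 : ℝ) / (1 / 3) = 3 * a ^ (1 / 3 : ℝ) by ring,
      ENNReal.ofReal_mul (by norm_num), show ENNReal.ofReal (3 : ℝ) = 3 by norm_num]
    ring
  have h2 : ∫⁻ r in Set.Ioi a, ENNReal.ofReal (r ^ (-(2 / 3) : ℝ)) * hardyKernel r x =
      96 * ENNReal.ofReal (a ^ (1 / 3 : ℝ)) := by
    have : ∫⁻ r in Set.Ioi a, ENNReal.ofReal (r ^ (-(2 / 3) : ℝ)) * hardyKernel r x =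
        ∫⁻ r in Set.Ioi a, 16 * ENNReal.ofReal (a ^ (1 / 2 : ℝ)) *
          ENNReal.ofReal (r ^ (-(7 / 6) : ℝ)) := by
      refine setLIntegral_congr_fun measurableSet_Ioi fun r hr => ?_
      have hr0 : 0 < r := ha.trans hr
      simp only [hardyKernel]
      rw [if_pos (show |x| < r from hr)]
      have : ENNReal.ofReal (r ^ (-(7 / 6) : ℝ)) = ENNReal.ofReal (r ^ (-(2 / 3) : ℝ)) *
          ENNReal.ofReal (r ^ (-(1 / 2) : ℝ)) := by
        rw [← ENNReal.ofReal_mul (by positivity), ← Real.rpow_add hr0]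
        norm_num
      rw [this]
      ring
    rw [this, lintegral_const_mul _ (by fun_prop), lintegral_Ioi_rpow (by norm_num) ha,
      show (-(7 / 6) + 1 : ℝ) = -(1 / 6) by norm_num,
      show -a ^ (-(1 / 6) : ℝ) / (-(1 / 6)) = a ^ (-(1 / 6) : ℝ) * 6 by ring,
      ENNReal.ofReal_mul (by positivity)]
    have : ENNReal.ofReal (a ^ (1 / 3 : ℝ)) = ENNReal.ofReal (a ^ (1 / 2 : ℝ)) *
        ENNReal.ofReal (a ^ (-(1 / 6) : ℝ)) := by
      rw [← ENNReal.ofReal_mul (by positivity), ← Real.rpow_add ha]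
      norm_num
    rw [this, show ENNReal.ofReal (6 : ℝ) = 6 by norm_num]
    ring
  rw [h1, h2, ← add_mul]
  norm_num

theorem measurable_hardyKernel : Measurable fun z : ℝ × ℝ => hardyKernel z.1 z.2 := by
  unfold hardyKernel
  refine Measurable.ite (measurableSet_lt (by fun_prop) (by fun_prop)) ?_ measurable_const
  fun_prop

/-- A negative power of the oscillator is a superposition of spectral projections: for an eigenvalue
`μ`, `3 μ^(-1/6)` is the integral of `r^(-2/3)` over the `r > 0` with `μ r² ≤ 1`. The bound of
`sum_enorm_hermite_coef_le` is integrated against `r^(-2/3) dr`, and `102 / 3 = 34`. -/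
theorem weightedBessel_hermite :
    WeightedBessel (volume : Measure ℝ) (fun n x => hermiteN n x)
      (fun n => ENNReal.ofReal ((2 * n + 1 : ℝ) ^ (-(1 / 6) : ℝ)))
      fun x => 34 * ENNReal.ofReal (|x| ^ (1 / 3 : ℝ)) := by
  intro u hu
  set c : ℕ → ℝ≥0∞ := fun n => ‖∫ x, (hermiteN n x : ℂ) * u x‖ₑ ^ 2 with hc
  have hB : ∀ n : ℕ, 3 * ENNReal.ofReal ((2 * n + 1 : ℝ) ^ (-(1 / 6) : ℝ)) =
      ∫⁻ r in Set.Ioi (0 : ℝ), ENNReal.ofReal (r ^ (-(2 / 3) : ℝ)) *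
        (if (2 * n + 1 : ℝ) * r ^ 2 ≤ 1 then 1 else 0) := by
    intro n
    have hμ : (0 : ℝ) < 2 * n + 1 := by positivity
    set b : ℝ := (2 * n + 1 : ℝ) ^ (-(1 / 2) : ℝ) with hb
    have hb0 : 0 < b := Real.rpow_pos_of_pos hμ _
    have hb2 : (2 * n + 1 : ℝ) * b ^ 2 = 1 := by
      rw [hb, ← Real.rpow_natCast, ← Real.rpow_mul hμ.le]
      nth_rewrite 1 [← Real.rpow_one (2 * n + 1 : ℝ)]
      rw [← Real.rpow_add hμ]
      norm_num
    have hiff : ∀ r : ℝ, 0 < r → ((2 * n + 1 : ℝ) * r ^ 2 ≤ 1 ↔ r ≤ b) := by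
      intro r hr
      rw [← pow_le_pow_iff_left₀ hr.le hb0.le two_ne_zero,
        ← mul_le_mul_iff_right₀ hμ (b := r ^ 2), hb2]
    rw [← Set.Ioc_union_Ioi_eq_Ioi hb0.le,
      lintegral_union measurableSet_Ioi (by
        rw [Set.disjoint_left]; rintro r ⟨_, h⟩ h'; exact absurd h' (not_lt.2 h))]
    have e1 : ∫⁻ r in Set.Ioc 0 b, ENNReal.ofReal (r ^ (-(2 / 3) : ℝ)) *
        (if (2 * n + 1 : ℝ) * r ^ 2 ≤ 1 then 1 else 0) =
        ∫⁻ r in Set.Ioc 0 b, ENNReal.ofReal (r ^ (-(2 / 3) : ℝ)) := by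
      refine setLIntegral_congr_fun measurableSet_Ioc fun r hr => ?_
      simp only [if_pos ((hiff r hr.1).2 hr.2), mul_one]
    have e2 : ∫⁻ r in Set.Ioi b, ENNReal.ofReal (r ^ (-(2 / 3) : ℝ)) *
        (if (2 * n + 1 : ℝ) * r ^ 2 ≤ 1 then 1 else 0) = 0 := by
      refine (setLIntegral_congr_fun (g := fun _ => 0) measurableSet_Ioi fun r hr => ?_).trans
        lintegral_zero
      have hr' : b < r := hr
      have hn : ¬ (2 * n + 1 : ℝ) * r ^ 2 ≤ 1 := fun h =>
        absurd ((hiff r (hb0.trans hr')).1 h) (not_le.2 hr')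
      simp only [if_neg hn, mul_zero]
    rw [e1, e2, add_zero, lintegral_Ioc_rpow (by norm_num) hb0.le,
      show (-(2 / 3) + 1 : ℝ) = 1 / 3 by norm_num, hb, ← Real.rpow_mul hμ.le,
      show (-(1 / 2) * (1 / 3) : ℝ) = -(1 / 6) by norm_num,
      show (2 * n + 1 : ℝ) ^ (-(1 / 6) : ℝ) / (1 / 3) = 3 * (2 * n + 1 : ℝ) ^ (-(1 / 6) : ℝ) by ring,
      ENNReal.ofReal_mul (by norm_num), show ENNReal.ofReal (3 : ℝ) = 3 by norm_num]
  have hmk : AEMeasurable (Function.uncurry fun (r x : ℝ) => ENNReal.ofReal (r ^ (-(2 / 3) : ℝ)) *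
      (hardyKernel r x * ‖u x‖ₑ ^ 2)) ((volume.restrict (Set.Ioi 0)).prod volume) := by
    refine AEMeasurable.mul (by fun_prop) (measurable_hardyKernel.aemeasurable.mul ?_)
    exact hu.1.comp_snd.enorm.pow_const 2
  have key : 3 * ∑' n : ℕ, ENNReal.ofReal ((2 * n + 1 : ℝ) ^ (-(1 / 6) : ℝ)) * c n ≤
      102 * ∫⁻ x, ENNReal.ofReal (|x| ^ (1 / 3 : ℝ)) * ‖u x‖ₑ ^ 2 := by
    calc _ = ∑' n : ℕ, ∫⁻ r in Set.Ioi (0 : ℝ), ENNReal.ofReal (r ^ (-(2 / 3) : ℝ)) *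
          (if (2 * n + 1 : ℝ) * r ^ 2 ≤ 1 then 1 else 0) * c n := by
          rw [← ENNReal.tsum_mul_left]
          refine tsum_congr fun n => ?_
          rw [← mul_assoc, hB n, lintegral_mul_const]
          refine Measurable.mul (by fun_prop) (Measurable.ite ?_ measurable_const measurable_const)
          exact measurableSet_le (by fun_prop) (by fun_prop)
      _ = ∫⁻ r in Set.Ioi (0 : ℝ), ∑' n : ℕ, ENNReal.ofReal (r ^ (-(2 / 3) : ℝ)) *
          (if (2 * n + 1 : ℝ) * r ^ 2 ≤ 1 then 1 else 0) * c n := by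
          rw [lintegral_tsum]
          intro n
          refine (Measurable.mul_const (Measurable.mul (by fun_prop)
            (Measurable.ite ?_ measurable_const measurable_const)) _).aemeasurable
          exact measurableSet_le (by fun_prop) (by fun_prop)
      _ ≤ ∫⁻ r in Set.Ioi (0 : ℝ), ∫⁻ x, ENNReal.ofReal (r ^ (-(2 / 3) : ℝ)) *
          (hardyKernel r x * ‖u x‖ₑ ^ 2) := by
          refine setLIntegral_mono' measurableSet_Ioi fun r hr => ?_
          have hk : AEMeasurable (fun x => hardyKernel r x * ‖u x‖ₑ ^ 2) :=
            (measurable_hardyKernel.comp (measurable_const.prodMk measurable_id)).aemeasurable.mul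
              (hu.1.enorm.pow_const 2)
          rw [lintegral_const_mul'' _ hk]
          simp only [mul_assoc]
          rw [ENNReal.tsum_mul_left]
          refine mul_le_mul_right ?_ _
          rw [ENNReal.tsum_eq_iSup_sum]
          refine iSup_le fun s => ?_
          simp only [ite_mul, one_mul, zero_mul]
          rw [← Finset.sum_filter]
          exact sum_enorm_hermite_coef_le _ r hr (fun n hn => (Finset.mem_filter.1 hn).2) hu
      _ = ∫⁻ x, ∫⁻ r in Set.Ioi (0 : ℝ), ENNReal.ofReal (r ^ (-(2 / 3) : ℝ)) *
          (hardyKernel r x * ‖u x‖ₑ ^ 2) := lintegral_lintegral_swap hmk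
      _ = ∫⁻ x, 102 * (ENNReal.ofReal (|x| ^ (1 / 3 : ℝ)) * ‖u x‖ₑ ^ 2) := by
          have h0 : ∀ᵐ x : ℝ, x ≠ 0 := by
            rw [ae_iff]
            simp
          refine lintegral_congr_ae ?_
          filter_upwards [h0] with x hx
          simp only [← mul_assoc]
          rw [lintegral_mul_const, lintegral_hardyKernel x hx]
          exact Measurable.mul (by fun_prop)
            (measurable_hardyKernel.comp (measurable_id.prodMk measurable_const))
      _ = _ := by
          rw [lintegral_const_mul'']
          exact AEMeasurable.mul (by fun_prop) (hu.1.enorm.pow_const 2)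
  have e3 : (102 : ℝ≥0∞) = 3 * 34 := by norm_num
  rw [e3, mul_assoc] at key
  have := (ENNReal.mul_le_mul_iff_right (by norm_num : (3 : ℝ≥0∞) ≠ 0) (by norm_num)).1 key
  refine this.trans (le_of_eq ?_)
  simp only [mul_assoc]
  rw [lintegral_const_mul'']
  exact AEMeasurable.mul (by fun_prop) (hu.1.enorm.pow_const 2)

end Hardy

/-! ### One-particle basis and comparison with the dispersion relation -/

section XiBasis

/-- Labels of the one-particle basis: three oscillator quantum numbers and a spin. -/
abbrev Mode : Type := (Fin 3 → ℕ) × Bool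

/-- Products of Hermite functions of the three momentum coordinates, with fixed spin. -/
def xiBasis (a : Mode) (ξ : Xi) : ℝ :=
  (∏ j, hermiteN (a.1 j) (ξ.1 j)) * (if ξ.2 = a.2 then 1 else 0)

theorem isL2Basis_bool :
    IsL2Basis (Measure.count : Measure Bool) fun b x => if x = b then (1 : ℝ) else 0 where
  measurable b := measurable_of_finite _
  memLp b := MemLp.of_bound (measurable_of_finite _).aestronglyMeasurable 1
    (Filter.Eventually.of_forall fun x => by split_ifs <;> simp)
  norm b := by
    rw [integral_count]
    cases b <;> simp
  orth a b h := by
    rw [integral_count]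
    cases a <;> cases b <;> simp at h ⊢
  complete u hu h := by
    refine Filter.Eventually.of_forall fun x => ?_
    have := h x
    rw [integral_count] at this
    cases x <;> simpa using this

theorem isL2Basis_xi : IsL2Basis xiMeasure xiBasis := by
  have h := (IsL2Basis.pi (n := 3) fun _ => isL2Basis_hermite).prod isL2Basis_bool
  rw [← volume_pi] at h
  exact h

theorem WeightedBessel.mono {X κ : Type*} [MeasurableSpace X] {μ : Measure X} {E : κ → X → ℝ}
    {B : κ → ℝ≥0∞} {W W' : X → ℝ≥0∞} (h : WeightedBessel μ E B W) (hW : ∀ x, W x ≤ W' x) :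
    WeightedBessel μ E B W' := fun u hu =>
  (h u hu).trans (lintegral_mono fun x => mul_le_mul_left (hW x) _)

/-- The weight `∏_j μ_{a_j}^{-1/6}` for massless and `1` for massive particles. -/
def modeEnergyWeight (m : ℝ) (a : Mode) : ℝ :=
  if m = 0 then ∏ j, (2 * a.1 j + 1 : ℝ) ^ (-(1 / 6) : ℝ) else 1

/-- The constant in the bound of `modeEnergyWeight` by the dispersion relation. -/
def dispersionConst (m : ℝ) : ℝ := if m = 0 then 34 ^ 3 else m⁻¹

theorem dispersion_nonneg (m : ℝ) (k : Fin 3 → ℝ) : 0 ≤ dispersion m k := Real.sqrt_nonneg _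

theorem measurable_dispersion (m : ℝ) : Measurable (dispersion m) := by
  unfold dispersion
  fun_prop

theorem abs_le_dispersion (m : ℝ) (k : Fin 3 → ℝ) (j : Fin 3) : |k j| ≤ dispersion m k := by
  rw [dispersion]
  refine Real.abs_le_sqrt ?_
  have := Finset.single_le_sum (f := fun j => k j ^ 2) (fun _ _ => sq_nonneg _) (Finset.mem_univ j)
  nlinarith [sq_nonneg m]

theorem le_dispersion {m : ℝ} (k : Fin 3 → ℝ) : m ≤ dispersion m k := by
  rw [dispersion]
  refine Real.le_sqrt_of_sq_le ?_
  have : 0 ≤ ∑ j, k j ^ 2 := Finset.sum_nonneg fun _ _ => sq_nonneg _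
  linarith

/-- Each factor is at most `ω^(1/3)`, and there are three. This is why the one-dimensional
inequality is needed exactly with the power `|x|^(1/3)`, that is, with the oscillator power `-1/6`.
-/
theorem prod_abs_rpow_le (k : Fin 3 → ℝ) :
    ∏ j, |k j| ^ (1 / 3 : ℝ) ≤ dispersion 0 k := by
  calc ∏ j, |k j| ^ (1 / 3 : ℝ) ≤ ∏ _j : Fin 3, dispersion 0 k ^ (1 / 3 : ℝ) :=
        Finset.prod_le_prod (fun _ _ => by positivity) fun j _ =>
          Real.rpow_le_rpow (abs_nonneg _) (abs_le_dispersion 0 k j) (by norm_num)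
    _ = dispersion 0 k := by
        rw [Finset.prod_const, Finset.card_univ, Fintype.card_fin, ← Real.rpow_natCast,
          ← Real.rpow_mul (dispersion_nonneg _ _)]
        norm_num

/-- A massless particle uses the Hardy-type inequality in each of the three coordinates and plain
Parseval in the spin. A massive one needs only Parseval and `m ≤ ω`. -/
theorem weightedBessel_xi {m : ℝ} (hm : 0 ≤ m) :
    WeightedBessel xiMeasure xiBasis (fun a => ENNReal.ofReal (modeEnergyWeight m a))
      fun ξ => ENNReal.ofReal (dispersionConst m * dispersion m ξ.1) := by
  by_cases h0 : m = 0
  · have h := WeightedBessel.pi (n := 3) (fun _ => isL2Basis_hermite)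
      (fun _ => (by fun_prop : Measurable fun x : ℝ => 34 * ENNReal.ofReal (|x| ^ (1 / 3 : ℝ))))
      fun _ => weightedBessel_hermite
    have h' := WeightedBessel.prod (fun a => (IsL2Basis.pi (n := 3)
      fun _ => isL2Basis_hermite).memLp a) isL2Basis_bool.memLp (by fun_prop) measurable_const h
      isL2Basis_bool.weightedBessel_one
    rw [← volume_pi] at h'
    have h'' : WeightedBessel xiMeasure xiBasis
      (fun a => (∏ j, ENNReal.ofReal ((2 * a.1 j + 1 : ℝ) ^ (-(1 / 6) : ℝ))) * 1)
      (fun ξ => (∏ j, 34 * ENNReal.ofReal (|ξ.1 j| ^ (1 / 3 : ℝ))) * 1) := h'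
    have e : (fun a : Mode => ENNReal.ofReal (modeEnergyWeight m a)) = fun a : Mode =>
        (∏ j, ENNReal.ofReal ((2 * a.1 j + 1 : ℝ) ^ (-(1 / 6) : ℝ))) * 1 := by
      funext a
      rw [modeEnergyWeight, if_pos h0, mul_one, ENNReal.ofReal_prod_of_nonneg]
      intro j _
      positivity
    rw [e]
    refine h''.mono fun ξ => ?_
    rw [mul_one, Finset.prod_mul_distrib, Finset.prod_const, Finset.card_univ, Fintype.card_fin,
      ← ENNReal.ofReal_prod_of_nonneg fun _ _ => by positivity, dispersionConst, if_pos h0, h0,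
      ENNReal.ofReal_mul (by positivity), ENNReal.ofReal_pow (by norm_num)]
    refine mul_le_mul' (le_of_eq (by norm_num)) (ENNReal.ofReal_le_ofReal (prod_abs_rpow_le _))
  · have hm' : 0 < m := lt_of_le_of_ne hm (Ne.symm h0)
    have e : (fun a : Mode => ENNReal.ofReal (modeEnergyWeight m a)) = fun _ => 1 := by
      funext a
      rw [modeEnergyWeight, if_neg h0, ENNReal.ofReal_one]
    rw [e]
    refine isL2Basis_xi.weightedBessel_one.mono fun ξ => ?_
    rw [dispersionConst, if_neg h0, ← ENNReal.ofReal_one]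
    refine ENNReal.ofReal_le_ofReal ?_
    rw [inv_mul_eq_div, le_div_iff₀ hm', one_mul]
    exact le_dispersion _

end XiBasis

/-! ### Cutting and rearranging the variables of configurations and kernels -/

section Geometry

variable {n : ℕ}

/-- The positions of all particles, listed over a single index set. -/
def flatConf (l : Fin n → ℕ) : Conf l ≃ᵐ ((Σ i, Fin (l i)) → Xi) :=
  (MeasurableEquiv.piCurry fun (i : Fin n) (_ : Fin (l i)) => Xi).symm

theorem flatConf_apply (l : Fin n → ℕ) (X : Conf l) (x : Σ i, Fin (l i)) :
    flatConf l X x = X x.1 x.2 := rfl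

theorem measurePreserving_flatConf (l : Fin n → ℕ) :
    MeasurePreserving (flatConf l) (confMeasure l) (Measure.pi fun _ => xiMeasure) := by
  refine ⟨(flatConf l).measurable, (Measure.pi_eq fun s hs => ?_).symm⟩
  rw [MeasurableEquiv.map_apply]
  have : flatConf l ⁻¹' Set.univ.pi s =
      Set.univ.pi fun i => Set.univ.pi fun k => s ⟨i, k⟩ := by
    ext X
    simp only [Set.mem_preimage, Set.mem_univ_pi, flatConf_apply]
    exact ⟨fun h i k => h ⟨i, k⟩, fun h x => h x.1 x.2⟩
  rw [this, confMeasure, Measure.pi_pi]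
  simp only [Measure.pi_pi]
  rw [Fintype.prod_sigma]

theorem measurePreserving_reindex {ι ι' Y : Type*} [Fintype ι] [Fintype ι'] [MeasurableSpace Y]
    (μ : Measure Y) [SigmaFinite μ] (e : ι ≃ ι') :
    MeasurePreserving (MeasurableEquiv.piCongrLeft (fun _ => Y) e.symm)
      (Measure.pi fun _ : ι' => μ) (Measure.pi fun _ : ι => μ) :=
  measurePreserving_piCongrLeft (fun _ => μ) e.symm

theorem piCongrLeft_symm_apply {ι ι' Y : Type*} [MeasurableSpace Y] (e : ι ≃ ι') (f : ι' → Y)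
    (i : ι) : MeasurableEquiv.piCongrLeft (fun _ => Y) e.symm f i = f (e i) := by
  have := MeasurableEquiv.piCongrLeft_apply_apply (β := fun _ : ι => Y) e.symm f (e i)
  rwa [Equiv.symm_apply_apply] at this

/-- Families over an index set that is in bijection with the disjoint union of the particles of
two configurations. -/
def splitConf {ι : Type*} (a b : Fin n → ℕ) (e : (Σ i, Fin (a i)) ⊕ (Σ i, Fin (b i)) ≃ ι) :
    (ι → Xi) ≃ᵐ Conf a × Conf b :=
  ((MeasurableEquiv.piCongrLeft (fun _ => Xi) e.symm).trans
    (MeasurableEquiv.sumPiEquivProdPi fun _ => Xi)).trans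
    ((flatConf a).symm.prodCongr (flatConf b).symm)

theorem splitConf_fst {ι : Type*} (a b : Fin n → ℕ)
    (e : (Σ i, Fin (a i)) ⊕ (Σ i, Fin (b i)) ≃ ι) (f : ι → Xi) (i : Fin n) (k : Fin (a i)) :
    (splitConf a b e f).1 i k = f (e (Sum.inl ⟨i, k⟩)) :=
  piCongrLeft_symm_apply e f (Sum.inl ⟨i, k⟩)

theorem splitConf_snd {ι : Type*} (a b : Fin n → ℕ)
    (e : (Σ i, Fin (a i)) ⊕ (Σ i, Fin (b i)) ≃ ι) (f : ι → Xi) (i : Fin n) (k : Fin (b i)) :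
    (splitConf a b e f).2 i k = f (e (Sum.inr ⟨i, k⟩)) :=
  piCongrLeft_symm_apply e f (Sum.inr ⟨i, k⟩)

theorem measurePreserving_splitConf {ι : Type*} [Fintype ι] (a b : Fin n → ℕ)
    (e : (Σ i, Fin (a i)) ⊕ (Σ i, Fin (b i)) ≃ ι) :
    MeasurePreserving (splitConf a b e) (Measure.pi fun _ => xiMeasure)
      ((confMeasure a).prod (confMeasure b)) :=
  ((((measurePreserving_flatConf a).symm _).prod ((measurePreserving_flatConf b).symm _)).comp
    (measurePreserving_sumPiEquivProdPi fun _ => xiMeasure)).comp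
    (measurePreserving_reindex xiMeasure e)

/-- Particles of a sum of occupation numbers. -/
def appendIndex (a b : Fin n → ℕ) :
    (Σ i, Fin (a i)) ⊕ (Σ i, Fin (b i)) ≃ Σ i, Fin (a i + b i) :=
  (Equiv.sigmaSumDistrib _ _).symm.trans (Equiv.sigmaCongrRight fun _ => finSumFinEquiv)

/-- Juxtaposition of configurations, species by species. -/
def appendConf {κ : Type*} {a b : Fin n → ℕ} (Y : ∀ i, Fin (a i) → κ) (X : ∀ i, Fin (b i) → κ) :
    ∀ i, Fin (a i + b i) → κ := fun i => Fin.append (Y i) (X i)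

/-- Cut a configuration into two. -/
def cutConf (a b : Fin n → ℕ) : Conf (fun i => a i + b i) ≃ᵐ Conf a × Conf b :=
  (flatConf _).trans (splitConf a b (appendIndex a b))

theorem measurePreserving_cutConf (a b : Fin n → ℕ) :
    MeasurePreserving (cutConf a b) (confMeasure fun i => a i + b i)
      ((confMeasure a).prod (confMeasure b)) :=
  (measurePreserving_splitConf a b _).comp (measurePreserving_flatConf _)

theorem cutConf_appendConf {a b : Fin n → ℕ} (Y : Conf a) (X : Conf b) :
    cutConf a b (appendConf Y X) = (Y, X) := by
  have h1 : (cutConf a b (appendConf Y X)).1 = Y := by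
    funext i k
    refine (splitConf_fst a b (appendIndex a b) _ i k).trans ?_
    exact Fin.append_left _ _ _
  have h2 : (cutConf a b (appendConf Y X)).2 = X := by
    funext i k
    refine (splitConf_snd a b (appendIndex a b) _ i k).trans ?_
    exact Fin.append_right _ _ _
  exact Prod.ext h1 h2

theorem cutConf_symm_apply {a b : Fin n → ℕ} (z : Conf a × Conf b) :
    (cutConf a b).symm z = appendConf z.1 z.2 := by
  rw [MeasurableEquiv.symm_apply_eq, cutConf_appendConf]

/-- One particle of each species in `S`. -/
def indOcc (S : Fin n → Prop) [DecidablePred S] (i : Fin n) : ℕ := if S i then 1 else 0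

/-- The particles at `ξ i`, `i ∈ S`, as a configuration. -/
def constConf {κ : Type*} (S : Fin n → Prop) [DecidablePred S] (ξ : Fin n → κ) :
    ∀ i, Fin (indOcc S i) → κ := fun i _ => ξ i

theorem indOcc_mem {S : Fin n → Prop} [DecidablePred S] {i : Fin n} (k : Fin (indOcc S i)) :
    S i := by
  by_contra h
  have := k.2
  simp [indOcc, h] at this

theorem subsingleton_indOcc {S : Fin n → Prop} [DecidablePred S] {i : Fin n}
    (k k' : Fin (indOcc S i)) : k = k' := by
  have h1 := k.2
  have h2 := k'.2
  have h3 : indOcc S i = 1 := by simp [indOcc, indOcc_mem k]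
  exact Fin.ext (by omega)

theorem bijective_splitIndex (S : Fin n → Prop) [DecidablePred S] :
    Function.Bijective (Sum.elim Sigma.fst Sigma.fst :
      (Σ i, Fin (indOcc S i)) ⊕ (Σ i, Fin (indOcc (fun i => ¬ S i) i)) → Fin n) := by
  constructor
  · rintro (⟨i, k⟩ | ⟨i, k⟩) (⟨j, k'⟩ | ⟨j, k'⟩) (h : i = j) <;> subst h
    · rw [subsingleton_indOcc k k']
    · exact absurd (indOcc_mem k) (indOcc_mem k')
    · exact absurd (indOcc_mem k') (indOcc_mem k)
    · rw [subsingleton_indOcc k k']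
  · intro i
    by_cases h : S i
    · exact ⟨Sum.inl ⟨i, ⟨0, by simp [indOcc, h]⟩⟩, rfl⟩
    · exact ⟨Sum.inr ⟨i, ⟨0, by simp [indOcc, h]⟩⟩, rfl⟩

/-- Separate the variables of a kernel. -/
def splitKernel (S : Fin n → Prop) [DecidablePred S] :
    (Fin n → Xi) ≃ᵐ Conf (indOcc S) × Conf (indOcc fun i => ¬ S i) :=
  splitConf _ _ (Equiv.ofBijective _ (bijective_splitIndex S))

theorem splitKernel_apply (S : Fin n → Prop) [DecidablePred S] (ξ : Fin n → Xi) :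
    splitKernel S ξ = (constConf S ξ, constConf (fun i => ¬ S i) ξ) :=
  Prod.ext (funext fun i => funext fun k => splitConf_fst _ _ _ ξ i k)
    (funext fun i => funext fun k => splitConf_snd _ _ _ ξ i k)

theorem measurePreserving_splitKernel (S : Fin n → Prop) [DecidablePred S] :
    MeasurePreserving (splitKernel S) (kernelMeasure n)
      ((confMeasure (indOcc S)).prod (confMeasure (indOcc fun i => ¬ S i))) :=
  measurePreserving_splitConf _ _ _

end Geometry

/-! ### Product bases for configurations and kernels -/

section ConfBasis

variable {n : ℕ}

/-- Assignments of one-particle states to particles. -/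
abbrev ConfMode (l : Fin n → ℕ) : Type := (i : Fin n) → Fin (l i) → Mode

/-- The product basis of the space of `l i` distinguishable particles of each species. -/
def confBasis {l : Fin n → ℕ} (a : ConfMode l) (X : Conf l) : ℝ :=
  ∏ i, ∏ k, xiBasis (a i k) (X i k)

theorem isL2Basis_conf (l : Fin n → ℕ) : IsL2Basis (confMeasure l) (confBasis (l := l)) :=
  IsL2Basis.pi fun _ => IsL2Basis.pi fun _ => isL2Basis_xi

/-- The product basis for kernels. -/
def kernelBasis (β : Fin n → Mode) (ξ : Fin n → Xi) : ℝ := ∏ i, xiBasis (β i) (ξ i)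

theorem isL2Basis_kernel : IsL2Basis (kernelMeasure n) (kernelBasis (n := n)) :=
  IsL2Basis.pi fun _ => isL2Basis_xi

theorem confBasis_append {a b : Fin n → ℕ} (α : ConfMode a) (β : ConfMode b) (Y : Conf a)
    (X : Conf b) :
    confBasis (appendConf α β) (appendConf Y X) = confBasis α Y * confBasis β X := by
  simp only [confBasis, ← Finset.prod_mul_distrib]
  refine Finset.prod_congr rfl fun i _ => ?_
  rw [Fin.prod_univ_add]
  simp [appendConf]

theorem kernelBasis_eq (S : Fin n → Prop) [DecidablePred S] (β : Fin n → Mode) (ξ : Fin n → Xi) :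
    kernelBasis β ξ = confBasis (constConf S β) (constConf S ξ) *
      confBasis (constConf (fun i => ¬ S i) β) (constConf (fun i => ¬ S i) ξ) := by
  simp only [confBasis, kernelBasis, ← Finset.prod_mul_distrib]
  refine Finset.prod_congr rfl fun i _ => ?_
  simp only [constConf, Finset.prod_const, Finset.card_univ, Fintype.card_fin]
  by_cases h : S i <;> simp [indOcc, h]

/-- Coefficients with respect to the product basis. -/
def coef {l : Fin n → ℕ} (f : Conf l → ℂ) (a : ConfMode l) : ℂ :=
  ∫ X, (confBasis a X : ℂ) * f X ∂confMeasure l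

theorem coef_append {a b : Fin n → ℕ} (f : Conf (fun i => a i + b i) → ℂ) (α : ConfMode a)
    (β : ConfMode b) :
    coef f (appendConf α β) = ∫ z, ((confBasis α z.1 * confBasis β z.2 : ℝ) : ℂ) *
      f (appendConf z.1 z.2) ∂((confMeasure a).prod (confMeasure b)) := by
  rw [coef, ← (measurePreserving_cutConf a b).symm.integral_comp']
  simp only [cutConf_symm_apply, confBasis_append]

end ConfBasis

/-! ### Trilinear forms and their expansion in product bases -/

section Trilinear

variable {Y₁ Y₂ X : Type*} [MeasurableSpace Y₁] [MeasurableSpace Y₂]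
  [MeasurableSpace X] {ν₁ : Measure Y₁} {ν₂ : Measure Y₂} {τ : Measure X}
  [SigmaFinite ν₁] [SigmaFinite ν₂] [SigmaFinite τ]

set_option linter.unusedSectionVars false

theorem aestronglyMeasurable_comp_right {f : Y₂ × X → ℂ}
    (hf : AEStronglyMeasurable f (ν₂.prod τ)) :
    AEStronglyMeasurable (fun z : (Y₁ × Y₂) × X => f (z.1.2, z.2)) ((ν₁.prod ν₂).prod τ) :=
  hf.comp_quasiMeasurePreserving (Measure.quasiMeasurePreserving_snd.comp
    (measurePreserving_prodAssoc ν₁ ν₂ τ).quasiMeasurePreserving)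

theorem aestronglyMeasurable_comp_left {f : Y₁ × X → ℂ}
    (hf : AEStronglyMeasurable f (ν₁.prod τ)) :
    AEStronglyMeasurable (fun z : (Y₁ × Y₂) × X => f (z.1.1, z.2)) ((ν₁.prod ν₂).prod τ) :=
  (aestronglyMeasurable_comp_right (ν₁ := ν₂) hf).comp_quasiMeasurePreserving
    (Measure.measurePreserving_swap.prod (MeasurePreserving.id τ)).quasiMeasurePreserving

/-- Cauchy–Schwarz in the shared variable `x`, for almost every `y`; the resulting product
separates. -/
theorem lintegral_contract_sq_le {f : Y₁ × X → ℂ} {g : Y₂ × X → ℂ}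
    (hf : AEStronglyMeasurable f (ν₁.prod τ)) (hg : AEStronglyMeasurable g (ν₂.prod τ)) :
    ∫⁻ y : Y₁ × Y₂, (∫⁻ x, ‖f (y.1, x)‖ₑ * ‖g (y.2, x)‖ₑ ∂τ) ^ 2 ∂(ν₁.prod ν₂) ≤
      (∫⁻ z, ‖f z‖ₑ ^ 2 ∂(ν₁.prod τ)) * ∫⁻ z, ‖g z‖ₑ ^ 2 ∂(ν₂.prod τ) := by
  have hf2 : AEMeasurable (fun z => ‖f z‖ₑ ^ 2) (ν₁.prod τ) := hf.enorm.pow_const 2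
  have hg2 : AEMeasurable (fun z => ‖g z‖ₑ ^ 2) (ν₂.prod τ) := hg.enorm.pow_const 2
  rw [lintegral_prod _ hf2, lintegral_prod _ hg2,
    ← lintegral_prod_mul hf2.lintegral_prod_right' hg2.lintegral_prod_right']
  refine lintegral_mono_ae ?_
  filter_upwards [Measure.quasiMeasurePreserving_fst.ae hf.prodMk_left,
    Measure.quasiMeasurePreserving_snd.ae hg.prodMk_left] with y h1 h2
  exact lintegral_mul_sq_le h1.enorm h2.enorm

/-- Contracting `|f|` with `|g|` over `x` gives a square-integrable function of `y`, which is then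
paired with `|G|`. -/
theorem integrable_tri {G : Y₁ × Y₂ → ℂ} {f : Y₁ × X → ℂ} {g : Y₂ × X → ℂ}
    (hG : MemLp G 2 (ν₁.prod ν₂)) (hf : MemLp f 2 (ν₁.prod τ)) (hg : MemLp g 2 (ν₂.prod τ)) :
    Integrable (fun z : (Y₁ × Y₂) × X => G z.1 * (conj (f (z.1.1, z.2)) * g (z.1.2, z.2)))
      ((ν₁.prod ν₂).prod τ) := by
  have hfm := aestronglyMeasurable_comp_left (ν₂ := ν₂) hf.1
  have hgm := aestronglyMeasurable_comp_right (ν₁ := ν₁) hg.1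
  have hm : AEStronglyMeasurable (fun z : (Y₁ × Y₂) × X =>
      G z.1 * (conj (f (z.1.1, z.2)) * g (z.1.2, z.2))) ((ν₁.prod ν₂).prod τ) :=
    hG.1.comp_fst.mul ((Complex.continuous_conj.comp_aestronglyMeasurable hfm).mul hgm)
  refine ⟨hm, ?_⟩
  rw [HasFiniteIntegral, lintegral_prod _ hm.enorm]
  have hk : AEMeasurable (fun z : (Y₁ × Y₂) × X => ‖f (z.1.1, z.2)‖ₑ * ‖g (z.1.2, z.2)‖ₑ)
      ((ν₁.prod ν₂).prod τ) := hfm.enorm.mul hgm.enorm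
  have h1 : ∫⁻ y, ∫⁻ x, ‖G y * (conj (f (y.1, x)) * g (y.2, x))‖ₑ ∂τ ∂(ν₁.prod ν₂) =
      ∫⁻ y, ‖G y‖ₑ * ∫⁻ x, ‖f (y.1, x)‖ₑ * ‖g (y.2, x)‖ₑ ∂τ ∂(ν₁.prod ν₂) := by
    refine lintegral_congr fun y => ?_
    rw [← lintegral_const_mul' _ _ enorm_ne_top]
    simp only [enorm_mul, RCLike.enorm_conj]
  rw [h1]
  have h2 := lintegral_mul_sq_le hG.1.enorm hk.lintegral_prod_right'
  have h3 : (∫⁻ y, ‖G y‖ₑ * ∫⁻ x, ‖f (y.1, x)‖ₑ * ‖g (y.2, x)‖ₑ ∂τ ∂(ν₁.prod ν₂)) ^ 2 < ∞ := by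
    refine h2.trans_lt (ENNReal.mul_lt_top (memLp_two_iff_lintegral.1 hG).2 ?_)
    refine (lintegral_contract_sq_le hf.1 hg.1).trans_lt (ENNReal.mul_lt_top ?_ ?_)
    · exact (memLp_two_iff_lintegral.1 hf).2
    · exact (memLp_two_iff_lintegral.1 hg).2
  exact (ENNReal.pow_lt_top_iff.1 h3).resolve_right two_ne_zero

theorem memLp_contract {f : Y₁ × X → ℂ} {g : Y₂ × X → ℂ}
    (hf : MemLp f 2 (ν₁.prod τ)) (hg : MemLp g 2 (ν₂.prod τ)) :
    MemLp (fun y : Y₁ × Y₂ => ∫ x, conj (f (y.1, x)) * g (y.2, x) ∂τ) 2 (ν₁.prod ν₂) := by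
  rw [memLp_two_iff_lintegral]
  have hm : AEStronglyMeasurable (fun z : (Y₁ × Y₂) × X => conj (f (z.1.1, z.2)) * g (z.1.2, z.2))
      ((ν₁.prod ν₂).prod τ) :=
    (Complex.continuous_conj.comp_aestronglyMeasurable (aestronglyMeasurable_comp_left hf.1)).mul
      (aestronglyMeasurable_comp_right hg.1)
  refine ⟨hm.integral_prod_right', ?_⟩
  refine lt_of_le_of_lt ?_ (ENNReal.mul_lt_top (memLp_two_iff_lintegral.1 hf).2
    (memLp_two_iff_lintegral.1 hg).2)
  refine le_trans (lintegral_mono fun y => ?_) (lintegral_contract_sq_le hf.1 hg.1)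
  refine pow_le_pow_left' ((enorm_integral_le_lintegral_enorm _).trans (le_of_eq ?_)) 2
  simp only [enorm_mul, RCLike.enorm_conj]

variable {κ₁ κ₂ κ : Type*} {E₁ : κ₁ → Y₁ → ℝ} {E₂ : κ₂ → Y₂ → ℝ} {E : κ → X → ℝ}

theorem integral_prod_basis_swap (h₁ : IsL2Basis ν₁ E₁) (h : IsL2Basis τ E) {f : Y₁ × X → ℂ}
    (hf : MemLp f 2 (ν₁.prod τ)) (a : κ₁) (b : κ) :
    ∫ z, ((E₁ a z.1 * E b z.2 : ℝ) : ℂ) * f z ∂(ν₁.prod τ) =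
      ∫ x, (E b x : ℂ) * ∫ y, (E₁ a y : ℂ) * f (y, x) ∂ν₁ ∂τ := by
  have hs := integral_prod_basis h.memLp h₁.memLp
    (u := fun z => f z.swap) (hf.comp_measurePreserving Measure.measurePreserving_swap) b a
  rw [← Measure.measurePreserving_swap.integral_comp MeasurableEquiv.prodComm.measurableEmbedding]
  simpa [mul_comm] using hs

theorem memLp_partial_left {f : Y₁ × X → ℂ} {e : Y₁ → ℂ} (hf : MemLp f 2 (ν₁.prod τ))
    (he : MemLp e 2 ν₁) : MemLp (fun x => ∫ y, e y * f (y, x) ∂ν₁) 2 τ :=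
  memLp_two_partial (hf.comp_measurePreserving Measure.measurePreserving_swap) he

/-- Parseval's identity in the common variable. -/
theorem hasSum_contract (h₁ : IsL2Basis ν₁ E₁) (h₂ : IsL2Basis ν₂ E₂) (h : IsL2Basis τ E)
    {f : Y₁ × X → ℂ} {g : Y₂ × X → ℂ} (hf : MemLp f 2 (ν₁.prod τ)) (hg : MemLp g 2 (ν₂.prod τ))
    (a : κ₁) (b : κ₂) :
    HasSum (fun c => conj (∫ z, ((E₁ a z.1 * E c z.2 : ℝ) : ℂ) * f z ∂(ν₁.prod τ)) *
        ∫ z, ((E₂ b z.1 * E c z.2 : ℝ) : ℂ) * g z ∂(ν₂.prod τ))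
      (∫ y : Y₁ × Y₂, ((E₁ a y.1 * E₂ b y.2 : ℝ) : ℂ) *
        ∫ x, conj (f (y.1, x)) * g (y.2, x) ∂τ ∂(ν₁.prod ν₂)) := by
  simp only [integral_prod_basis_swap h₁ h hf, integral_prod_basis_swap h₂ h hg]
  have hp := h.hasSum_coef (memLp_partial_left hf (h₁.memLp a))
    (memLp_partial_left hg (h₂.memLp b))
  convert hp using 1
  have hT := integrable_tri (memLp_two_mul_prod (h₁.memLp a) (h₂.memLp b)) hf hg
  have e1 : ∫ y : Y₁ × Y₂, ((E₁ a y.1 * E₂ b y.2 : ℝ) : ℂ) *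
        ∫ x, conj (f (y.1, x)) * g (y.2, x) ∂τ ∂(ν₁.prod ν₂) =
      ∫ y : Y₁ × Y₂, ∫ x, ((E₁ a y.1 : ℂ) * E₂ b y.2) * (conj (f (y.1, x)) * g (y.2, x)) ∂τ
        ∂(ν₁.prod ν₂) := by
    refine integral_congr_ae (Filter.Eventually.of_forall fun y => ?_)
    simp only [Complex.ofReal_mul, integral_const_mul]
  rw [e1, integral_integral_swap hT]
  refine integral_congr_ae (Filter.Eventually.of_forall fun x => ?_)
  simp only
  rw [← integral_conj, ← integral_prod_mul]
  refine integral_congr_ae (Filter.Eventually.of_forall fun y => ?_)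
  simp only [map_mul, Complex.conj_ofReal]
  ring

/-- Expansion of a trilinear form in product bases. -/
theorem hasSum_tri [Countable κ₂] (h₁ : IsL2Basis ν₁ E₁) (h₂ : IsL2Basis ν₂ E₂)
    {G : Y₁ × Y₂ → ℂ} {f : Y₁ × X → ℂ} {g : Y₂ × X → ℂ} (hG : MemLp G 2 (ν₁.prod ν₂))
    (hf : MemLp f 2 (ν₁.prod τ)) (hg : MemLp g 2 (ν₂.prod τ)) :
    HasSum (fun c : κ₁ × κ₂ => (∫ y, ((E₁ c.1 y.1 * E₂ c.2 y.2 : ℝ) : ℂ) * G y ∂(ν₁.prod ν₂)) *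
        ∫ y : Y₁ × Y₂, ((E₁ c.1 y.1 * E₂ c.2 y.2 : ℝ) : ℂ) *
          ∫ x, conj (f (y.1, x)) * g (y.2, x) ∂τ ∂(ν₁.prod ν₂))
      (∫ z : (Y₁ × Y₂) × X, G z.1 * (conj (f (z.1.1, z.2)) * g (z.1.2, z.2))
        ∂((ν₁.prod ν₂).prod τ)) := by
  have hH := memLp_contract hf hg
  -- The first slot of `hasSum_coef` is antilinear, so the contraction enters conjugated.
  have hHc : MemLp (fun y : Y₁ × Y₂ => conj (∫ x, conj (f (y.1, x)) * g (y.2, x) ∂τ)) 2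
      (ν₁.prod ν₂) := hH.star
  have hs := (h₁.prod h₂).hasSum_coef hHc hG
  rw [integral_prod _ (integrable_tri hG hf hg)]
  simp only [integral_const_mul]
  convert hs using 1
  · funext c
    rw [← integral_conj, mul_comm]
    simp only [map_mul, Complex.conj_ofReal, Complex.conj_conj]
  · refine integral_congr_ae (Filter.Eventually.of_forall fun y => ?_)
    simp only [Complex.conj_conj]
    ring

end Trilinear

/-! ### Annihilation operators as prepending entries to lists -/

section Annihilate

variable {n : ℕ}

/-- The list of entries of each species. -/
def listConf {κ : Type*} {l : Fin n → ℕ} (X : ∀ i, Fin (l i) → κ) : Occ n κ :=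
  fun i => List.ofFn (X i)

theorem listConf_injective {κ : Type*} {l : Fin n → ℕ} :
    Function.Injective (listConf (κ := κ) (l := l)) := fun _ _ h =>
  funext fun i => List.ofFn_injective (congrFun h i)

theorem length_listConf {κ : Type*} {l : Fin n → ℕ} (X : ∀ i, Fin (l i) → κ) (i : Fin n) :
    (listConf X i).length = l i := List.length_ofFn

theorem exists_listConf {κ : Type*} {l : Fin n → ℕ} (A : Occ n κ)
    (h : ∀ i, (A i).length = l i) : ∃ X : ∀ i, Fin (l i) → κ, listConf X = A := by
  obtain rfl : (fun i => (A i).length) = l := funext h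
  exact ⟨fun i => (A i).get, funext fun i => List.ofFn_get (A i)⟩

/-- Configurations whose types differ by arithmetic on occupation numbers are compared through their
lists; equal lists force equal occupation numbers, and no casts are needed. -/
theorem family_congr {κ γ : Type*} (f : (l : Fin n → ℕ) → (∀ i, Fin (l i) → κ) → γ)
    {l l' : Fin n → ℕ} {X : ∀ i, Fin (l i) → κ} {Y : ∀ i, Fin (l' i) → κ}
    (h : listConf X = listConf Y) : f l X = f l' Y := by
  obtain rfl : l = l' := funext fun i => by
    rw [← length_listConf X i, h, length_listConf]
  rw [listConf_injective h]

theorem ofFn_cast {κ : Type*} {a b : ℕ} (h : a = b) (g : Fin b → κ) :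
    List.ofFn (fun k => g (Fin.cast h k)) = List.ofFn g := by
  subst h
  rfl

theorem listConf_insertConf {l : Fin n → ℕ} (i : Fin n) (ξ : Xi) (X : Conf l) :
    listConf (insertConf i ξ X) = Function.update (listConf X) i (ξ :: listConf X i) := by
  funext j
  by_cases h : j = i
  · subst h
    rw [Function.update_self]
    have e : insertConf j ξ X j = fun k => (Fin.cons ξ (X j) : Fin (l j + 1) → Xi)
        (Fin.cast (by simp) k) := funext fun k => dif_pos rfl
    rw [listConf, e, ofFn_cast (by simp) (Fin.cons ξ (X j) : Fin (l j + 1) → Xi), List.ofFn_succ]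
    simp [listConf]
  · rw [Function.update_of_ne h]
    have e : insertConf i ξ X j = fun k => X j (Fin.cast (by simp [h]) k) :=
      funext fun k => dif_neg h
    rw [listConf, e, ofFn_cast (by simp [h]) (X j), listConf]

theorem listConf_append {κ : Type*} {a b : Fin n → ℕ} (Y : ∀ i, Fin (a i) → κ)
    (X : ∀ i, Fin (b i) → κ) (i : Fin n) :
    listConf (appendConf Y X) i = listConf Y i ++ listConf X i := List.ofFn_fin_append _ _

theorem listConf_constConf {κ : Type*} (S : Fin n → Prop) [DecidablePred S] (ξ : Fin n → κ)
    (i : Fin n) : listConf (constConf S ξ) i = if S i then [ξ i] else [] := by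
  have h : ∀ m (x : κ), List.ofFn (fun _ : Fin m => x) = List.replicate m x := fun m x =>
    List.ofFn_const m x
  rw [listConf]
  refine (h _ _).trans ?_
  by_cases hS : S i <;> simp [indOcc, hS]

theorem listConf_append_constConf {κ : Type*} (S : Fin n → Prop) [DecidablePred S]
    {l : Fin n → ℕ} (ξ : Fin n → κ) (X : ∀ i, Fin (l i) → κ) (L : List (Fin n))
    (hL : ∀ i, i ∈ L ↔ S i) :
    listConf (appendConf (constConf S ξ) X) = consOcc L ξ (listConf X) := by
  funext i
  rw [listConf_append, listConf_constConf, consOcc]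
  by_cases hS : S i <;> simp [hS, hL]

/-- Annihilators of distinct species evaluate the wave function with one particle prepended in each
of them. The signs between species depend only on the occupation numbers, so on a sector they form
one unimodular factor. -/
theorem exists_annihilateList_eq (L : List (Fin n)) (hL : L.Nodup) :
    ∃ ε : (Fin n → ℕ) → ℂ, (∀ l, ‖ε l‖ = 1) ∧
      ∀ (ξ : Fin n → Xi) (f : (l : Fin n → ℕ) → Conf l → ℂ) (l : Fin n → ℕ) (X : Conf l)
        (l' : Fin n → ℕ) (Y : Conf l'), listConf Y = consOcc L ξ (listConf X) →
        annihilateList L ξ f l X =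
          ε l * ((∏ i ∈ L.toFinset, Real.sqrt (l i + 1) : ℝ) : ℂ) * f l' Y := by
  induction L with
  | nil =>
    refine ⟨fun _ => 1, fun _ => norm_one, fun ξ f l X l' Y h => ?_⟩
    have : consOcc [] ξ (listConf X) = listConf X := by funext i; simp [consOcc]
    rw [this] at h
    rw [family_congr f h]
    simp [annihilateList]
  | cons i L ih =>
    obtain ⟨hi, hL'⟩ := List.nodup_cons.1 hL
    obtain ⟨ε, hε, h⟩ := ih hL'
    -- The outer annihilator evaluates the inner ones in the sector with one more particle of
    -- species `i`, so the earlier phase is taken there; the earlier square roots do not change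
    -- because `i ∉ L`.
    refine ⟨fun l => (-1) ^ (∑ j ∈ Finset.univ.filter (· < i), l j) *
      ε (Function.update l i (l i + 1)), fun l => by simp [hε], fun ξ f l X l' Y hY => ?_⟩
    have e : annihilateList (i :: L) ξ f l X = annihilate i (ξ i) (annihilateList L ξ f) l X := rfl
    rw [e, annihilate, h ξ f _ (insertConf i (ξ i) X) l' Y]
    · rw [List.toFinset_cons, Finset.prod_insert (by simpa using hi)]
      have e2 : ∏ j ∈ L.toFinset, Real.sqrt ((Function.update l i (l i + 1) j : ℕ) + 1) =
          ∏ j ∈ L.toFinset, Real.sqrt (l j + 1) := by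
        refine Finset.prod_congr rfl fun j hj => ?_
        rw [Function.update_of_ne]
        rintro rfl
        exact hi (List.mem_toFinset.1 hj)
      rw [e2]
      push_cast
      ring
    · rw [hY, listConf_insertConf]
      funext j
      by_cases hj : j = i
      · subst hj
        simp [consOcc, hi]
      · simp [consOcc, hj]

/-- The variables of `ψ` and `φ` in the form are separated, up to a phase. -/
theorem exists_formIntegrand_eq (p : ℕ) (l : Fin n → ℕ) :
    ∃ c : ℂ, ‖c‖ = 1 ∧ ∀ (G : Kernel n) (ψ φ : Fock n) (z : (Fin n → Xi) × Conf l),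
      formIntegrand p G ψ φ l z = c * ((∏ i, Real.sqrt (l i + 1) : ℝ) : ℂ) *
        (G z.1 *
          (conj (wave ψ _ (appendConf (constConf (fun i : Fin n => i.val < p) z.1) z.2)) *
            wave φ _ (appendConf (constConf (fun i : Fin n => ¬ i.val < p) z.1) z.2))) := by
  set L₁ := ((List.finRange n).filter (fun i => i.val < p)).reverse with hL₁
  set L₂ := (List.finRange n).filter (fun i => p ≤ i.val) with hL₂
  have hn₁ : L₁.Nodup := List.nodup_reverse.2 ((List.nodup_finRange n).filter _)
  have hn₂ : L₂.Nodup := (List.nodup_finRange n).filter _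
  obtain ⟨ε₁, hε₁, h₁⟩ := exists_annihilateList_eq L₁ hn₁
  obtain ⟨ε₂, hε₂, h₂⟩ := exists_annihilateList_eq L₂ hn₂
  refine ⟨conj (ε₁ l) * ε₂ l, by simp [hε₁, hε₂], fun G ψ φ z => ?_⟩
  rw [formIntegrand,
    h₁ z.1 (wave ψ) l z.2 _ _ (listConf_append_constConf (fun i : Fin n => i.val < p) z.1 z.2 L₁
      (by simp [hL₁])),
    h₂ z.1 (wave φ) l z.2 _ _ (listConf_append_constConf (fun i : Fin n => ¬ i.val < p) z.1 z.2 L₂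
      (by simp [hL₂]))]
  have e : ∏ i, Real.sqrt (l i + 1) = (∏ i ∈ L₁.toFinset, Real.sqrt (l i + 1)) *
      ∏ i ∈ L₂.toFinset, Real.sqrt (l i + 1) := by
    rw [← Finset.prod_union]
    · congr 1
      ext i
      simp [hL₁, hL₂, lt_or_ge]
    · rw [Finset.disjoint_left]
      intro i h h'
      simp [hL₁, hL₂] at h h'
      omega
  rw [e]
  simp only [map_mul, Complex.conj_ofReal, Complex.ofReal_mul]
  ring

end Annihilate

/-! ### The form of the interaction in terms of coefficients -/

section Form

variable {n : ℕ}

/-- Coefficients of a kernel. -/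
def kernelCoef (G : (Fin n → Xi) → ℂ) (β : Fin n → Mode) : ℂ :=
  ∫ ξ, (kernelBasis β ξ : ℂ) * G ξ ∂kernelMeasure n

theorem bijective_constConf {κ : Type*} (S : Fin n → Prop) [DecidablePred S] :
    Function.Bijective fun β : Fin n → κ => (constConf S β, constConf (fun i => ¬ S i) β) := by
  constructor
  · intro β β' h
    funext i
    by_cases hS : S i
    · exact congrFun (congrFun (congrArg Prod.fst h) i) ⟨0, by simp [indOcc, hS]⟩
    · exact congrFun (congrFun (congrArg Prod.snd h) i) ⟨0, by simp [indOcc, hS]⟩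
  · rintro ⟨a, b⟩
    refine ⟨fun i => if h : S i then a i ⟨0, by simp [indOcc, h]⟩
      else b i ⟨0, by simp [indOcc, h]⟩, Prod.ext ?_ ?_⟩
    · funext i k
      simp only [constConf]
      rw [dif_pos (indOcc_mem k)]
      exact congrArg _ (subsingleton_indOcc _ _)
    · funext i k
      simp only [constConf]
      rw [dif_neg (indOcc_mem k)]
      exact congrArg _ (subsingleton_indOcc _ _)

theorem memLp_append {a b : Fin n → ℕ} {f : Conf (fun i => a i + b i) → ℂ}
    (hf : MemLp f 2 (confMeasure _)) :
    MemLp (fun z : Conf a × Conf b => f (appendConf z.1 z.2)) 2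
      ((confMeasure a).prod (confMeasure b)) := by
  have h := hf.comp_measurePreserving ((measurePreserving_cutConf a b).symm _)
  have e : f ∘ (cutConf a b).symm = fun z : Conf a × Conf b => f (appendConf z.1 z.2) :=
    funext fun z => congrArg f (cutConf_symm_apply z)
  rwa [e] at h

/-- The kernel variables are separated into those fed to `f` (the species in `S`) and those fed to
`g`, while the configuration in the sector `l` is shared. The form is then trilinear of the type of
`hasSum_tri`, and Parseval in the shared variable identifies `M`. -/
theorem form_expansion (S : Fin n → Prop) [DecidablePred S] (l : Fin n → ℕ)
    {G : (Fin n → Xi) → ℂ} {f : Conf (fun i => indOcc S i + l i) → ℂ}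
    {g : Conf (fun i => indOcc (fun i => ¬ S i) i + l i) → ℂ} (hG : MemLp G 2 (kernelMeasure n))
    (hf : MemLp f 2 (confMeasure _)) (hg : MemLp g 2 (confMeasure _)) :
    Integrable (fun z : (Fin n → Xi) × Conf l => G z.1 * (conj (f (appendConf (constConf S z.1) z.2)) *
        g (appendConf (constConf (fun i => ¬ S i) z.1) z.2)))
      ((kernelMeasure n).prod (confMeasure l)) ∧
    ∃ M : (Fin n → Mode) → ℂ,
      (∀ β, HasSum (fun A : ConfMode l => conj (coef f (appendConf (constConf S β) A)) *
        coef g (appendConf (constConf (fun i => ¬ S i) β) A)) (M β)) ∧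
      HasSum (fun β => kernelCoef G β * M β)
        (∫ z : (Fin n → Xi) × Conf l, G z.1 * (conj (f (appendConf (constConf S z.1) z.2)) *
          g (appendConf (constConf (fun i => ¬ S i) z.1) z.2))
          ∂((kernelMeasure n).prod (confMeasure l))) := by
  set q := splitKernel S
  have hq := measurePreserving_splitKernel S
  have hqi : MeasurePreserving (q.prodCongr (MeasurableEquiv.refl (Conf l)))
      ((kernelMeasure n).prod (confMeasure l))
      (((confMeasure (indOcc S)).prod (confMeasure (indOcc fun i => ¬ S i))).prod
        (confMeasure l)) := hq.prod (MeasurePreserving.id _)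
  have hG' : MemLp (fun y => G (q.symm y)) 2
    ((confMeasure (indOcc S)).prod (confMeasure (indOcc fun i => ¬ S i))) :=
    hG.comp_measurePreserving (hq.symm _)
  have hf' := memLp_append hf
  have hg' := memLp_append hg
  have hT := integrable_tri hG' hf' hg'
  have hcomp : ∀ z : (Fin n → Xi) × Conf l, G z.1 * (conj (f (appendConf (constConf S z.1) z.2)) *
        g (appendConf (constConf (fun i => ¬ S i) z.1) z.2)) =
      (fun z : (Conf (indOcc S) × Conf (indOcc fun i => ¬ S i)) × Conf l => G (q.symm z.1) *
        (conj (f (appendConf z.1.1 z.2)) * g (appendConf z.1.2 z.2)))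
        (q.prodCongr (MeasurableEquiv.refl (Conf l)) z) := by
    intro z
    have e : q.prodCongr (MeasurableEquiv.refl (Conf l)) z = (q z.1, z.2) := rfl
    simp only [e, MeasurableEquiv.symm_apply_apply]
    simp only [q, splitKernel_apply]
  refine ⟨?_, ?_⟩
  · simp only [hcomp]
    exact hqi.integrable_comp_of_integrable hT
  · have hs := hasSum_tri (isL2Basis_conf _) (isL2Basis_conf _) hG' hf' hg'
    set M' : ConfMode (indOcc S) × ConfMode (indOcc fun i => ¬ S i) → ℂ := fun c =>
      ∫ y : Conf (indOcc S) × Conf (indOcc fun i => ¬ S i),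
        ((confBasis c.1 y.1 * confBasis c.2 y.2 : ℝ) : ℂ) *
          ∫ x, conj (f (appendConf y.1 x)) * g (appendConf y.2 x) ∂(confMeasure l)
          ∂((confMeasure (indOcc S)).prod (confMeasure (indOcc fun i => ¬ S i))) with hM'
    refine ⟨fun β => M' (constConf S β, constConf (fun i => ¬ S i) β), fun β => ?_, ?_⟩
    · simp only [coef_append]
      exact hasSum_contract (isL2Basis_conf _) (isL2Basis_conf _) (isL2Basis_conf _) hf' hg' _ _
    · have e3 := hqi.integral_comp' (fun z : (Conf (indOcc S) × Conf (indOcc fun i => ¬ S i)) ×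
        Conf l => G (q.symm z.1) * (conj (f (appendConf z.1.1 z.2)) * g (appendConf z.1.2 z.2)))
      rw [integral_congr_ae (Filter.Eventually.of_forall hcomp)]
      refine (congrArg (HasSum _) e3).mpr ?_
      rw [← (Equiv.ofBijective _ (bijective_constConf (κ := Mode) S)).hasSum_iff] at hs
      convert hs using 1
      funext β
      simp only [Function.comp, Equiv.ofBijective_apply]
      congr 1
      rw [kernelCoef, ← hq.integral_comp' (g := fun y => ((confBasis (constConf S β) y.1 *
        confBasis (constConf (fun i => ¬ S i) β) y.2 : ℝ) : ℂ) * G (q.symm y))]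
      refine integral_congr_ae (Filter.Eventually.of_forall fun ξ => ?_)
      have e4 : q.symm (splitKernel S ξ) = ξ := q.symm_apply_apply ξ
      simp only [e4, kernelBasis_eq S]
      rw [splitKernel_apply]

end Form

/-! ### Antisymmetric coefficients and their finite truncations -/

section Antisymmetry

variable {n : ℕ}

/-- Permutation of the particles, as a measurable equivalence. -/
def permEquiv {l : Fin n → ℕ} (σ : (i : Fin n) → Equiv.Perm (Fin (l i))) : Conf l ≃ᵐ Conf l where
  toFun := permConf σ
  invFun := permConf fun i => (σ i)⁻¹
  left_inv X := by funext i k; simp [permConf]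
  right_inv X := by funext i k; simp [permConf]
  measurable_toFun := (measurePreserving_permConf σ).measurable
  measurable_invFun := (measurePreserving_permConf _).measurable

/-- Antisymmetric wave functions. -/
def IsAntisymm {l : Fin n → ℕ} (f : Conf l → ℂ) : Prop :=
  ∀ σ : (i : Fin n) → Equiv.Perm (Fin (l i)),
    ∀ᵐ X ∂confMeasure l, f (permConf σ X) = permSign σ * f X

/-- Antisymmetric families of coefficients. -/
def IsAntisymmCoef {l : Fin n → ℕ} (c : ConfMode l → ℂ) : Prop :=
  ∀ (σ : (i : Fin n) → Equiv.Perm (Fin (l i))) (a : ConfMode l),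
    c (fun i => a i ∘ σ i) = permSign σ * c a

/-- Permuting the labels and the particles together leaves the product basis unchanged, so a change
of variables transfers the sign from the function to its coefficients. -/
theorem IsAntisymm.coef {l : Fin n → ℕ} {f : Conf l → ℂ} (hf : IsAntisymm f) :
    IsAntisymmCoef (coef f) := by
  intro σ a
  have h := (measurePreserving_permConf σ).integral_comp' (f := permEquiv σ)
    (fun X => (confBasis (fun i => a i ∘ σ i) X : ℂ) * f X)
  rw [FermionFields.coef, ← h, FermionFields.coef, ← integral_const_mul]
  refine integral_congr_ae ?_
  filter_upwards [hf σ] with X hX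
  have e : confBasis (fun i => a i ∘ σ i) (permConf σ X) = confBasis a X := by
    unfold confBasis
    refine Finset.prod_congr rfl fun i _ => ?_
    exact Equiv.prod_comp (σ i) fun k => xiBasis (a i k) (X i k)
  have e2 : permEquiv σ X = permConf σ X := rfl
  rw [e2, e, hX]
  ring

theorem getElem?_append_swap {κ : Type*} (l₁ l₂ : List κ) (x y : κ) (k : ℕ) :
    (l₁ ++ y :: x :: l₂)[k]? = (l₁ ++ x :: y :: l₂)[if k = l₁.length then l₁.length + 1 else
      if k = l₁.length + 1 then l₁.length else k]? := by
  rcases lt_or_ge k l₁.length with h | h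
  · rw [if_neg (by omega), if_neg (by omega), List.getElem?_append_left h,
      List.getElem?_append_left h]
  · obtain ⟨j, rfl⟩ := Nat.exists_eq_add_of_le h
    rcases j with _ | _ | j
    · simp
    · simp
    · rw [if_neg (by omega), if_neg (by omega), List.getElem?_append_right (by omega),
        List.getElem?_append_right (by omega)]
      simp

theorem ofFn_comp_swap {κ : Type*} {m : ℕ} (g : Fin m → κ) (l₁ l₂ : List κ) (x y : κ)
    (hg : List.ofFn g = l₁ ++ x :: y :: l₂) (h : l₁.length + 1 < m) :
    List.ofFn (g ∘ Equiv.swap ⟨l₁.length, by omega⟩ ⟨l₁.length + 1, h⟩) =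
      l₁ ++ y :: x :: l₂ := by
  have hm : m = (l₁ ++ x :: y :: l₂).length := by rw [← hg, List.length_ofFn]
  refine List.ext_getElem? fun k => ?_
  rw [getElem?_append_swap, ← hg]
  simp only [List.getElem?_ofFn]
  by_cases hk : k < m
  · rw [dif_pos hk]
    simp only [Function.comp]
    by_cases h1 : k = l₁.length
    · subst h1
      rw [if_pos rfl, dif_pos h, Equiv.swap_apply_left]
    · rw [if_neg h1]
      by_cases h2 : k = l₁.length + 1
      · subst h2
        rw [if_pos rfl, dif_pos (by omega), Equiv.swap_apply_right]
      · rw [if_neg h2, dif_pos hk, Equiv.swap_apply_of_ne_of_ne]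
        · simpa [Fin.ext_iff] using h1
        · simpa [Fin.ext_iff] using h2
  · rw [dif_neg hk, if_neg (by omega), if_neg (by omega), dif_neg hk]

/-- Configurations with entries in a finite set. -/
def boxConf (J : Finset Mode) (l : Fin n → ℕ) : Finset (ConfMode l) :=
  Fintype.piFinset fun _ => Fintype.piFinset fun _ => J

theorem mem_boxConf {J : Finset Mode} {l : Fin n → ℕ} {a : ConfMode l} :
    a ∈ boxConf J l ↔ ∀ i k, a i k ∈ J := by
  simp [boxConf]

open Classical in
/-- A family of coefficients, cut off to a finite set of modes, as a function of lists. -/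
def truncFun {l : Fin n → ℕ} (c : ConfMode l → ℂ) (J : Finset Mode) (A : Occ n Mode) : ℂ :=
  if h : ∃ a, listConf a = A ∧ a ∈ boxConf J l then c h.choose else 0

theorem truncFun_listConf {l : Fin n → ℕ} (c : ConfMode l → ℂ) (J : Finset Mode)
    (a : ConfMode l) : truncFun c J (listConf a) = if a ∈ boxConf J l then c a else 0 := by
  unfold truncFun
  by_cases ha : a ∈ boxConf J l
  · have h : ∃ b, listConf b = listConf a ∧ b ∈ boxConf J l := ⟨a, rfl, ha⟩
    rw [dif_pos h, if_pos ha]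
    exact congrArg c (listConf_injective h.choose_spec.1)
  · rw [dif_neg, if_neg ha]
    rintro ⟨b, hb, hb'⟩
    exact ha (listConf_injective hb ▸ hb')

theorem exists_of_truncFun_ne_zero {l : Fin n → ℕ} {c : ConfMode l → ℂ} {J : Finset Mode}
    {A : Occ n Mode} (h : truncFun c J A ≠ 0) : ∃ a ∈ boxConf J l, listConf a = A := by
  unfold truncFun at h
  split_ifs at h with h'
  · exact ⟨_, h'.choose_spec.2, h'.choose_spec.1⟩
  · exact absurd rfl h

theorem truncFun_finite {l : Fin n → ℕ} (c : ConfMode l → ℂ) (J : Finset Mode) :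
    (truncFun c J).support.Finite :=
  ((boxConf J l).finite_toSet.image listConf).subset fun _ hA =>
    let ⟨a, ha, e⟩ := exists_of_truncFun_ne_zero hA
    ⟨a, ha, e⟩

/-- Exchanging adjacent entries of one list is a transposition in that species and the identity in
the others, of total sign `-1`; the cut-off box is invariant under permutations. -/
theorem truncFun_swap {l : Fin n → ℕ} {c : ConfMode l → ℂ} (hc : IsAntisymmCoef c)
    (J : Finset Mode) (i : Fin n) (A : Occ n Mode) (l₁ : List Mode) (x y : Mode)
    (l₂ : List Mode) (a : ConfMode l)
    (ha : listConf a = Function.update A i (l₁ ++ x :: y :: l₂)) :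
    truncFun c J (Function.update A i (l₁ ++ y :: x :: l₂)) =
      -truncFun c J (Function.update A i (l₁ ++ x :: y :: l₂)) := by
  have hi : List.ofFn (a i) = l₁ ++ x :: y :: l₂ := by
    have := congrFun ha i
    rwa [Function.update_self] at this
  have hl : l₁.length + 1 < l i := by
    have := congrArg List.length hi
    simp at this
    omega
  set τ : Equiv.Perm (Fin (l i)) := Equiv.swap ⟨l₁.length, by omega⟩ ⟨l₁.length + 1, hl⟩ with hτ
  set σ : (j : Fin n) → Equiv.Perm (Fin (l j)) := Function.update (fun j => 1) i τ with hσ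
  have hb : listConf (fun j => a j ∘ σ j) = Function.update A i (l₁ ++ y :: x :: l₂) := by
    funext j
    by_cases hj : j = i
    · subst hj
      rw [Function.update_self]
      simp only [listConf, hσ, Function.update_self]
      exact ofFn_comp_swap _ _ _ _ _ hi hl
    · rw [Function.update_of_ne hj]
      have := congrFun ha j
      rw [Function.update_of_ne hj] at this
      rw [← this]
      simp only [listConf, hσ, Function.update_of_ne hj]
      rfl
  have hsign : permSign σ = -1 := by
    rw [permSign, Finset.prod_eq_single i]
    · simp only [hσ, Function.update_self, hτ]
      rw [Equiv.Perm.sign_swap (by simp [Fin.ext_iff])]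
      simp
    · intro j _ hj
      simp [hσ, Function.update_of_ne hj]
    · simp
  rw [← hb, ← ha, truncFun_listConf, truncFun_listConf, hc σ a, hsign]
  have hiff : (fun j => a j ∘ σ j) ∈ boxConf J l ↔ a ∈ boxConf J l := by
    simp only [mem_boxConf, Function.comp]
    exact forall_congr' fun j => (σ j).forall_congr_left.trans (by simp)
  by_cases h : a ∈ boxConf J l
  · rw [if_pos h, if_pos (hiff.2 h)]; ring
  · rw [if_neg h, if_neg (fun h' => h (hiff.1 h'))]; simp

theorem truncFun_isAlt {l : Fin n → ℕ} {c : ConfMode l → ℂ} (hc : IsAntisymmCoef c)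
    (J : Finset Mode) : IsAltOcc (truncFun c J) := by
  intro i A l₁ x y l₂
  simp only
  by_cases h : truncFun c J (Function.update A i (l₁ ++ x :: y :: l₂)) = 0
  · by_cases h' : truncFun c J (Function.update A i (l₁ ++ y :: x :: l₂)) = 0
    · rw [h, h', neg_zero]
    · obtain ⟨a, -, ha⟩ := exists_of_truncFun_ne_zero h'
      exact truncFun_swap hc J i A l₁ y x l₂ a ha
  · obtain ⟨a, -, ha⟩ := exists_of_truncFun_ne_zero h
    rw [truncFun_swap hc J i A l₁ x y l₂ a ha, neg_neg]

/-- The truncated coefficients as a vector. -/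
def truncVec {l : Fin n → ℕ} {c : ConfMode l → ℂ} (hc : IsAntisymmCoef c) (J : Finset Mode) :
    altSpace n Mode := altMk (truncFun c J) (truncFun_finite c J) (truncFun_isAlt hc J)

theorem altFun_truncVec {l : Fin n → ℕ} {c : ConfMode l → ℂ} (hc : IsAntisymmCoef c)
    (J : Finset Mode) : altFun (truncVec hc J) = truncFun c J := rfl

theorem ofReal_norm_altSpace_sq (f : altSpace n Mode) :
    ENNReal.ofReal (‖f‖ ^ 2) = ∑' A, ‖altFun f A‖ₑ ^ 2 := by
  rw [norm_altSpace_sq, ENNReal.ofReal_tsum_of_nonneg fun _ => sq_nonneg _]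
  · refine tsum_congr fun A => ?_
    rw [ENNReal.ofReal_pow (norm_nonneg _), ofReal_norm]
  · refine summable_of_hasFiniteSupport ((altFun_finite f).subset fun A hA h => hA ?_)
    simp [h]

theorem tsum_listConf {M : Type*} [AddCommMonoid M] [TopologicalSpace M] [T2Space M]
    {l : Fin n → ℕ} {h : Occ n Mode → M} (hh : ∀ A, h A ≠ 0 → ∃ a : ConfMode l, listConf a = A) :
    ∑' A, h A = ∑' a : ConfMode l, h (listConf a) :=
  (listConf_injective.tsum_eq fun A hA => hh A hA).symm

theorem norm_truncVec_sq {l : Fin n → ℕ} {c : ConfMode l → ℂ} (hc : IsAntisymmCoef c)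
    (J : Finset Mode) :
    ENNReal.ofReal (‖truncVec hc J‖ ^ 2) = ∑ a ∈ boxConf J l, ‖c a‖ₑ ^ 2 := by
  rw [ofReal_norm_altSpace_sq, altFun_truncVec, tsum_listConf (l := l)]
  · rw [tsum_eq_sum (s := boxConf J l)]
    · refine Finset.sum_congr rfl fun a ha => ?_
      rw [truncFun_listConf, if_pos ha]
    · intro a ha
      rw [truncFun_listConf, if_neg ha]
      simp
  · intro A hA
    obtain ⟨a, -, ha⟩ := exists_of_truncFun_ne_zero (c := c) (J := J) (A := A) (by
      rintro h; simp [h] at hA)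
    exact ⟨a, ha⟩

end Antisymmetry

/-! ### Sector bounds from finite truncations -/

section Truncation

variable {n : ℕ}

/-- Number of particles times the weight of the first one. -/
def listWeight {κ : Type*} (u : κ → ℝ) : List κ → ℝ
  | [] => 0
  | x :: L => (L.length + 1) * u x

theorem listWeight_nonneg {κ : Type*} {u : κ → ℝ} (hu : ∀ x, 0 ≤ u x) (L : List κ) :
    0 ≤ listWeight u L := by
  cases L with
  | nil => exact le_rfl
  | cons x L => exact mul_nonneg (by positivity) (hu x)

theorem consOcc_injOn {κ : Type*} [DecidableEq κ] (J : Finset κ) (R : List (Fin n))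
    (α : Fin n → κ) : Function.Injective fun z : (boxOn J R α) × Occ n κ =>
      consOcc R z.1.1 z.2 := by
  rintro ⟨⟨β, hβ⟩, A⟩ ⟨⟨β', hβ'⟩, A'⟩ h
  have h' : ∀ i, consOcc R β A i = consOcc R β' A' i := fun i => congrFun h i
  have h1 : β = β' := funext fun i => by
    by_cases hi : i ∈ R
    · have := h' i
      simp only [consOcc, hi, if_true, List.cons.injEq] at this
      exact this.1
    · rw [(mem_boxOn.1 hβ i).2 hi, (mem_boxOn.1 hβ' i).2 hi]
  have h2 : A = A' := funext fun i => by
    have := h' i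
    by_cases hi : i ∈ R
    · simp only [consOcc, hi, if_true, List.cons.injEq] at this
      exact this.2
    · simpa [consOcc, hi] using this
  subst h1 h2
  rfl

/-- A choice of `β` and of remaining lists is the same as lists that are non-empty for every species
in `R`, with `β` as heads. The squared factor `√(length + 1)` is then the length of the full list,
which produces `listWeight`. -/
theorem ofReal_wickTerm_truncVec {l : Fin n → ℕ} {c : ConfMode l → ℂ} (hc : IsAntisymmCoef c)
    {v : Fin n → Mode → ℝ} (hv : ∀ i x, 0 < v i x) (J : Finset Mode) (R : List (Fin n))
    (hR : R.Nodup) (α : Fin n → Mode) :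
    ENNReal.ofReal (wickTerm v J R α (truncVec hc J)) =
      ∑ a ∈ boxConf J l, ENNReal.ofReal (∏ i ∈ R.toFinset,
        listWeight (fun x => (v i x)⁻¹) (listConf a i)) * ‖c a‖ₑ ^ 2 := by
  have hv' : ∀ i x, 0 ≤ (v i x)⁻¹ := fun i x => (inv_pos.2 (hv i x)).le
  set h : Occ n Mode → ℝ≥0∞ := fun A => ENNReal.ofReal (∏ i ∈ R.toFinset,
        listWeight (fun x => (v i x)⁻¹) (A i)) * ‖truncFun c J A‖ₑ ^ 2 with hh
  have hsupp : ∀ A, h A ≠ 0 → ∃ a ∈ boxConf J l, listConf a = A := fun A hA =>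
    exists_of_truncFun_ne_zero (c := c) fun h0 => hA (by simp [hh, h0])
  have e1 : ENNReal.ofReal (wickTerm v J R α (truncVec hc J)) =
      ∑ β ∈ boxOn J R α, ∑' A, h (consOcc R β A) := by
    rw [wickTerm, ENNReal.ofReal_sum_of_nonneg fun β _ =>
      mul_nonneg (Finset.prod_nonneg fun i _ => hv' _ _) (sq_nonneg _)]
    refine Finset.sum_congr rfl fun β _ => ?_
    rw [ENNReal.ofReal_mul (Finset.prod_nonneg fun i _ => hv' _ _), ofReal_norm_altSpace_sq,
      ← ENNReal.tsum_mul_left]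
    refine tsum_congr fun A => ?_
    rw [altFun_annFold R hR, enorm_mul, mul_pow, ← mul_assoc, altFun_truncVec]
    simp only [hh]
    congr 1
    have e : ‖((∏ i ∈ R.toFinset, Real.sqrt ((A i).length + 1) : ℝ) : ℂ)‖ₑ ^ 2 =
        ENNReal.ofReal (∏ i ∈ R.toFinset, ((A i).length + 1 : ℝ)) := by
      rw [← ofReal_norm, ← ENNReal.ofReal_pow (norm_nonneg _), Complex.norm_real,
        Real.norm_eq_abs, sq_abs, ← Finset.prod_pow]
      congr 1
      exact Finset.prod_congr rfl fun i _ => Real.sq_sqrt (by positivity)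
    rw [e, ← ENNReal.ofReal_mul (Finset.prod_nonneg fun i _ => hv' _ _),
      ← Finset.prod_mul_distrib]
    congr 1
    refine Finset.prod_congr rfl fun i hi => ?_
    rw [consOcc, if_pos (List.mem_toFinset.1 hi), listWeight, mul_comm]
  have e2 : ∑ β ∈ boxOn J R α, ∑' A, h (consOcc R β A) = ∑' A, h A := by
    rw [← Finset.sum_coe_sort, ← tsum_fintype (L := SummationFilter.unconditional _), ← ENNReal.tsum_prod]
    refine (consOcc_injOn J R α).tsum_eq fun A hA => ?_
    obtain ⟨a, ha, rfl⟩ := hsupp A hA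
    -- An empty list in a species of `R` has weight `0`, so on the support the head and the tail
    -- exist.
    have hne : ∀ i ∈ R, listConf a i ≠ [] := by
      intro i hi h0
      refine hA ?_
      simp only [hh]
      rw [Finset.prod_eq_zero (List.mem_toFinset.2 hi) (by rw [h0, listWeight])]
      simp
    have hmem : ∀ i x, x ∈ listConf a i → x ∈ J := by
      intro i x hx
      obtain ⟨k, rfl⟩ := List.mem_ofFn.1 hx
      exact mem_boxConf.1 ha i k
    have hβ : (fun i => if hi : i ∈ R then (listConf a i).head (hne i hi) else α i) ∈
        boxOn J R α := by
      rw [mem_boxOn]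
      intro i
      refine ⟨fun hi => ?_, fun hi => dif_neg hi⟩
      rw [dif_pos hi]
      exact hmem i _ (List.head_mem _)
    refine ⟨⟨⟨_, hβ⟩, fun i => if i ∈ R then (listConf a i).tail else listConf a i⟩, ?_⟩
    funext i
    by_cases hi : i ∈ R
    · simp [consOcc, hi, List.cons_head_tail]
    · simp [consOcc, hi]
  rw [e1, e2, tsum_listConf (l := l) fun A hA => (hsupp A hA).imp fun a h => h.2,
    tsum_eq_sum (s := boxConf J l)]
  · refine Finset.sum_congr rfl fun a ha => ?_
    simp only [hh]
    rw [truncFun_listConf, if_pos ha]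
  · intro a ha
    simp only [hh]
    rw [truncFun_listConf, if_neg ha]
    simp

/-- The exclusion principle: bound of the annihilators with summable weights. -/
theorem wickTerm_le_of_sum_le {κ : Type*} [DecidableEq κ] {v : Fin n → κ → ℝ}
    (hv : ∀ i x, 0 < v i x) (J : Finset κ) {C : ℝ} (hC : ∀ i, ∑ x ∈ J, (v i x)⁻¹ ≤ C)
    (R : List (Fin n)) (hR : R.Nodup) (α : Fin n → κ) (φ : altSpace n κ) :
    wickTerm v J R α φ ≤ C ^ R.length * ‖φ‖ ^ 2 := by
  induction R generalizing α φ with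
  | nil => simp [wickTerm, boxOn_nil, annFold]
  | cons i R ih =>
    obtain ⟨hi, hR'⟩ := List.nodup_cons.1 hR
    have hC0 : 0 ≤ C := (Finset.sum_nonneg fun x _ => (inv_pos.2 (hv i x)).le).trans (hC i)
    rw [wickTerm_cons v J R i hi]
    calc _ ≤ ∑ y ∈ J, (v i y)⁻¹ * (C ^ R.length * ‖φ‖ ^ 2) := by
          refine Finset.sum_le_sum fun y _ => mul_le_mul_of_nonneg_left ?_ (inv_pos.2 (hv i y)).le
          refine (ih hR' _ _).trans (mul_le_mul_of_nonneg_left ?_ (pow_nonneg hC0 _))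
          exact pow_le_pow_left₀ (norm_nonneg _) (isCAR_altSpace.norm_annihilate_le i y φ) 2
      _ = (∑ y ∈ J, (v i y)⁻¹) * (C ^ R.length * ‖φ‖ ^ 2) := by rw [Finset.sum_mul]
      _ ≤ C * (C ^ R.length * ‖φ‖ ^ 2) := by
          refine mul_le_mul_of_nonneg_right (hC i) (by positivity)
      _ = _ := by rw [List.length_cons, pow_succ]; ring

/-- This connects the list model with the sums in `form_expansion`. Each species is annihilated on
exactly one side, so the square roots combine to one product over all species. -/
theorem inner_annFold_truncVec (S : Fin n → Prop) [DecidablePred S] {l : Fin n → ℕ}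
    {c : ConfMode (fun i => indOcc S i + l i) → ℂ}
    {d : ConfMode (fun i => indOcc (fun i => ¬ S i) i + l i) → ℂ}
    (hc : IsAntisymmCoef c) (hd : IsAntisymmCoef d) (J : Finset Mode) (β : Fin n → Mode)
    (hβ : ∀ i, β i ∈ J) :
    inner ℂ (annFold ((List.finRange n).filter fun i => S i) β (truncVec hc J))
        (annFold ((List.finRange n).filter fun i => ¬ S i) β (truncVec hd J)) =
      ((∏ i, Real.sqrt (l i + 1) : ℝ) : ℂ) * ∑ A ∈ boxConf J l,
        conj (c (appendConf (constConf S β) A)) *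
          d (appendConf (constConf (fun i => ¬ S i) β) A) := by
  set L₁ := (List.finRange n).filter fun i => S i with hL₁
  set L₂ := (List.finRange n).filter fun i => ¬ S i with hL₂
  have hn₁ : L₁.Nodup := (List.nodup_finRange n).filter _
  have hn₂ : L₂.Nodup := (List.nodup_finRange n).filter _
  have hm₁ : ∀ i, i ∈ L₁ ↔ S i := by simp [hL₁]
  have hm₂ : ∀ i, i ∈ L₂ ↔ ¬ S i := by simp [hL₂]
  have hprod : ∏ i, Real.sqrt (l i + 1) = (∏ i ∈ L₁.toFinset, Real.sqrt (l i + 1)) *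
      ∏ i ∈ L₂.toFinset, Real.sqrt (l i + 1) := by
    rw [← Finset.prod_union]
    · congr 1
      ext i
      simp [hm₁, hm₂, em]
    · rw [Finset.disjoint_left]
      intro i h h'
      exact (hm₂ i).1 (List.mem_toFinset.1 h') ((hm₁ i).1 (List.mem_toFinset.1 h))
  have hbox : ∀ (T : Fin n → Prop) [DecidablePred T] (A : ConfMode l),
      appendConf (constConf T β) A ∈ boxConf J (fun i => indOcc T i + l i) ↔
        A ∈ boxConf J l := by
    intro T _ A
    simp only [mem_boxConf]
    constructor
    · intro h i k
      have := h i (Fin.natAdd _ k)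
      rwa [appendConf, Fin.append_right] at this
    · intro h i k
      refine Fin.addCases (fun k => ?_) (fun k => ?_) k
      · rw [appendConf, Fin.append_left]; exact hβ i
      · rw [appendConf, Fin.append_right]; exact h i k
  rw [inner_altSpace, tsum_listConf (l := l), tsum_eq_sum (s := boxConf J l), Finset.mul_sum]
  · refine Finset.sum_congr rfl fun A hA => ?_
    rw [altFun_annFold L₁ hn₁, altFun_annFold L₂ hn₂, altFun_truncVec, altFun_truncVec,
      ← listConf_append_constConf S β A L₁ hm₁,
      ← listConf_append_constConf (fun i => ¬ S i) β A L₂ hm₂, truncFun_listConf,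
      truncFun_listConf, if_pos ((hbox S A).2 hA), if_pos ((hbox (fun i => ¬ S i) A).2 hA), hprod]
    simp only [length_listConf, map_mul, Complex.conj_ofReal, Complex.ofReal_mul]
    ring
  · intro A hA
    rw [altFun_annFold L₁ hn₁, altFun_truncVec, ← listConf_append_constConf S β A L₁ hm₁,
      truncFun_listConf, if_neg (fun h => hA ((hbox S A).1 h))]
    simp
  · intro A hA
    have h0 : truncFun c J (consOcc L₁ β A) ≠ 0 := by
      intro h0
      refine hA ?_
      rw [altFun_annFold L₁ hn₁, altFun_truncVec, h0]
      simp
    obtain ⟨a, -, ha⟩ := exists_of_truncFun_ne_zero h0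
    refine exists_listConf A fun i => ?_
    have h1 := congrArg List.length (congrFun ha i)
    rw [length_listConf, consOcc] at h1
    by_cases hS : S i
    · rw [if_pos ((hm₁ i).2 hS)] at h1
      simp [indOcc, hS] at h1
      omega
    · rw [if_neg (fun h => hS ((hm₁ i).1 h))] at h1
      simp [indOcc, hS] at h1
      omega

theorem tendsto_boxConf (l : Fin n → ℕ) :
    Filter.Tendsto (fun J => boxConf J l) Filter.atTop Filter.atTop := by
  refine Filter.tendsto_atTop_finset_of_monotone (fun J J' h a ha => ?_) fun a => ?_
  · rw [mem_boxConf] at ha ⊢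
    exact fun i k => h (ha i k)
  · refine ⟨Finset.univ.biUnion fun i => Finset.univ.image (a i), mem_boxConf.2 fun i k => ?_⟩
    rw [Finset.mem_biUnion]
    exact ⟨i, Finset.mem_univ _, Finset.mem_image_of_mem _ (Finset.mem_univ _)⟩

/-- The sectorwise bound of the interaction, in terms of coefficients. -/
theorem norm_form_coef_le (S : Fin n → Prop) [DecidablePred S] {l : Fin n → ℕ} (i₀ : Fin n)
    {v : Fin n → Mode → ℝ} (hv : ∀ i x, 1 ≤ v i x)
    {c : ConfMode (fun i => indOcc S i + l i) → ℂ}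
    {d : ConfMode (fun i => indOcc (fun i => ¬ S i) i + l i) → ℂ}
    (hc : IsAntisymmCoef c) (hd : IsAntisymmCoef d) {P W K : ℝ} (hP : ∀ J, ‖truncVec hc J‖ ^ 2 ≤ P)
    (α : Fin n → Mode) (hK : ∀ J, ∀ R : List (Fin n), R.Nodup → i₀ ∉ R →
      wickTerm v J R α (truncVec hd J) ≤ K) {g : (Fin n → Mode) → ℂ}
    (hW : ∀ s : Finset (Fin n → Mode),
      ∑ β ∈ s, (∏ i ∈ Finset.univ.erase i₀, v i (β i)) * ‖g β‖ ^ 2 ≤ W)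
    {M : (Fin n → Mode) → ℂ}
    (hM : ∀ β, HasSum (fun A : ConfMode l => conj (c (appendConf (constConf S β) A)) *
      d (appendConf (constConf (fun i => ¬ S i) β) A)) (M β))
    {T : ℂ} (hT : HasSum (fun β => g β * M β) T) :
    ‖((∏ i, Real.sqrt (l i + 1) : ℝ) : ℂ) * T‖ ^ 2 ≤ P * (W * (2 ^ n * K)) := by
  classical
  have hP0 : 0 ≤ P := (sq_nonneg _).trans (hP ∅)
  have hW0 : 0 ≤ W := by simpa using hW ∅
  have hK0 : 0 ≤ K := by
    refine le_trans ?_ (hK ∅ [] (by simp) (by simp))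
    simp [wickTerm, boxOn_nil, annFold]
  set ρ : ℂ := ((∏ i, Real.sqrt (l i + 1) : ℝ) : ℂ) with hρ
  -- Two limits are taken: for a finite set `s` of multi-indices the mode cut-off `J` grows first,
  -- then `s` exhausts all multi-indices.
  have hfin : ∀ s : Finset (Fin n → Mode), ‖ρ * ∑ β ∈ s, g β * M β‖ ^ 2 ≤
      P * (W * (2 ^ n * K)) := by
    intro s
    have hlim : Filter.Tendsto (fun J : Finset Mode => ‖ρ * ∑ β ∈ s, g β *
        ∑ A ∈ boxConf J l, conj (c (appendConf (constConf S β) A)) *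
          d (appendConf (constConf (fun i => ¬ S i) β) A)‖ ^ 2) Filter.atTop
        (nhds (‖ρ * ∑ β ∈ s, g β * M β‖ ^ 2)) := by
      refine ((Filter.Tendsto.const_mul _ (tendsto_finsetSum _ fun β _ =>
        Filter.Tendsto.const_mul _ ?_)).norm).pow 2
      exact (hM β).comp (tendsto_boxConf l)
    refine le_of_tendsto hlim ?_
    filter_upwards [Filter.eventually_ge_atTop (s.biUnion fun β => Finset.univ.image β)] with J hJ
    have hs : s ⊆ Fintype.piFinset fun _ => J := by
      intro β hβ
      rw [Fintype.mem_piFinset]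
      intro i
      refine hJ (Finset.mem_biUnion.2 ⟨β, hβ, Finset.mem_image_of_mem _ (Finset.mem_univ _)⟩)
    -- The kernel coefficients are set to zero outside `s`, so the sum over the box of `J` is the
    -- sum over `s`.
    have h := norm_wick_sum_sq_le S J i₀ (fun β => if β ∈ s then g β else 0) hv α
      (truncVec hc J) (truncVec hd J) K (hK J)
    have e1 : ∑ β ∈ Fintype.piFinset fun _ => J, (if β ∈ s then g β else 0) *
        inner ℂ (annFold ((List.finRange n).filter fun i => S i) β (truncVec hc J))
          (annFold ((List.finRange n).filter fun i => ¬ S i) β (truncVec hd J)) =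
        ρ * ∑ β ∈ s, g β *
        ∑ A ∈ boxConf J l, conj (c (appendConf (constConf S β) A)) *
          d (appendConf (constConf (fun i => ¬ S i) β) A) := by
      rw [← Finset.sum_subset hs]
      · rw [Finset.mul_sum]
        refine Finset.sum_congr rfl fun β hβ => ?_
        rw [if_pos hβ, inner_annFold_truncVec S hc hd J β fun i => Fintype.mem_piFinset.1 (hs hβ) i]
        ring
      · intro β _ hβ
        rw [if_neg hβ, zero_mul]
    have e2 : ∑ β ∈ Fintype.piFinset fun _ => J,
        (∏ i ∈ Finset.univ.erase i₀, v i (β i)) * ‖if β ∈ s then g β else 0‖ ^ 2 =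
        ∑ β ∈ s, (∏ i ∈ Finset.univ.erase i₀, v i (β i)) * ‖g β‖ ^ 2 := by
      rw [← Finset.sum_subset hs]
      · refine Finset.sum_congr rfl fun β hβ => ?_
        rw [if_pos hβ]
      · intro β _ hβ
        rw [if_neg hβ]
        simp
    rw [e1, e2] at h
    refine h.trans (mul_le_mul (hP J) ?_ ?_ hP0)
    · exact mul_le_mul_of_nonneg_right (hW s) (by positivity)
    · refine mul_nonneg (Finset.sum_nonneg fun β _ => mul_nonneg (Finset.prod_nonneg fun i _ =>
        zero_le_one.trans (hv _ _)) (sq_nonneg _)) (by positivity)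
  refine le_of_tendsto' (((hT.const_mul _).norm).pow 2) hfin

end Truncation

/-! ### Real interpolation between weighted bounds -/

section Interpolation

/-- The minimum switches at `t = a / b`: below it the integral contributes the factor `1 / (1 - r)`,
above it `1 / r`. -/
theorem lintegral_rpow_mul_min {r : ℝ} (hr₀ : 0 < r) (hr₁ : r < 1) {a b : ℝ} (ha : 0 ≤ a)
    (hb : 0 ≤ b) :
    ∫⁻ t in Set.Ioi 0, ENNReal.ofReal (t ^ (-r - 1)) * ENNReal.ofReal (min a (t * b)) =
      ENNReal.ofReal (1 / (1 - r) + 1 / r) * ENNReal.ofReal (a ^ (1 - r) * b ^ r) := by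
  have h1r : 0 < 1 - r := by linarith
  by_cases h0 : a = 0 ∨ b = 0
  · have e1 : a ^ (1 - r) * b ^ r = 0 := by
      rcases h0 with rfl | rfl
      · rw [Real.zero_rpow h1r.ne', zero_mul]
      · rw [Real.zero_rpow hr₀.ne', mul_zero]
    rw [e1, ENNReal.ofReal_zero, mul_zero]
    refine (setLIntegral_congr_fun (g := fun _ => 0) measurableSet_Ioi fun t ht => ?_).trans
      lintegral_zero
    have ht' : (0 : ℝ) < t := ht
    have : min a (t * b) ≤ 0 := by
      rcases h0 with rfl | rfl
      · exact min_le_left _ _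
      · simp
    simp only [ENNReal.ofReal_of_nonpos this, mul_zero]
  · push Not at h0
    have ha' : 0 < a := lt_of_le_of_ne ha (Ne.symm h0.1)
    have hb' : 0 < b := lt_of_le_of_ne hb (Ne.symm h0.2)
    set T := a / b with hT
    have hT0 : 0 < T := div_pos ha' hb'
    rw [← Set.Ioc_union_Ioi_eq_Ioi hT0.le,
      lintegral_union measurableSet_Ioi (by
        rw [Set.disjoint_left]; rintro t ⟨_, h⟩ h'; exact absurd h' (not_lt.2 h))]
    have e1 : ∫⁻ t in Set.Ioc 0 T, ENNReal.ofReal (t ^ (-r - 1)) *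
        ENNReal.ofReal (min a (t * b)) = ENNReal.ofReal (1 / (1 - r) * (a ^ (1 - r) * b ^ r)) := by
      have : ∫⁻ t in Set.Ioc 0 T, ENNReal.ofReal (t ^ (-r - 1)) *
          ENNReal.ofReal (min a (t * b)) =
          ∫⁻ t in Set.Ioc 0 T, ENNReal.ofReal b * ENNReal.ofReal (t ^ (-r)) := by
        refine setLIntegral_congr_fun measurableSet_Ioc fun t ht => ?_
        have ht0 : 0 < t := ht.1
        have hmin : min a (t * b) = t * b := min_eq_right (by
          rw [← le_div_iff₀ hb']; exact ht.2)
        simp only [hmin]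
        rw [← ENNReal.ofReal_mul (by positivity), ← ENNReal.ofReal_mul hb]
        congr 1
        rw [Real.rpow_sub ht0, Real.rpow_one]
        field_simp
      rw [this, lintegral_const_mul _ (by fun_prop), lintegral_Ioc_rpow (by linarith) hT0.le,
        ← ENNReal.ofReal_mul hb]
      congr 1
      rw [show -r + 1 = 1 - r by ring, hT, Real.div_rpow ha hb]
      have : b ^ r = b / b ^ (1 - r) := by
        rw [eq_div_iff (Real.rpow_pos_of_pos hb' _).ne', ← Real.rpow_add hb']
        simp
      rw [this]
      field_simp
    have e2 : ∫⁻ t in Set.Ioi T, ENNReal.ofReal (t ^ (-r - 1)) *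
        ENNReal.ofReal (min a (t * b)) = ENNReal.ofReal (1 / r * (a ^ (1 - r) * b ^ r)) := by
      have : ∫⁻ t in Set.Ioi T, ENNReal.ofReal (t ^ (-r - 1)) *
          ENNReal.ofReal (min a (t * b)) =
          ∫⁻ t in Set.Ioi T, ENNReal.ofReal a * ENNReal.ofReal (t ^ (-r - 1)) := by
        refine setLIntegral_congr_fun measurableSet_Ioi fun t ht => ?_
        have hmin : min a (t * b) = a := min_eq_left (by
          rw [← div_le_iff₀ hb']; exact (le_of_lt ht))
        simp only [hmin]
        rw [mul_comm]
      rw [this, lintegral_const_mul _ (by fun_prop), lintegral_Ioi_rpow (by linarith) hT0,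
        ← ENNReal.ofReal_mul ha]
      congr 1
      rw [show -r - 1 + 1 = -r by ring, hT, Real.div_rpow ha hb, Real.rpow_neg ha,
        Real.rpow_neg hb, Real.rpow_sub ha', Real.rpow_one]
      have := (Real.rpow_pos_of_pos hb' r).ne'
      have := (Real.rpow_pos_of_pos ha' r).ne'
      field_simp
    rw [e1, e2, ← ENNReal.ofReal_add (by positivity) (by positivity),
      ← ENNReal.ofReal_mul (by positivity)]
    congr 1
    ring

/-- Real interpolation of two weighted bounds for the coefficients of a function `f`, split at the
levels of the weight `w`. -/
theorem tsum_interpolate {ι X : Type*} [Countable ι] [MeasurableSpace X] {μ : Measure X}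
    [SFinite μ]
    {A B : ι → ℝ} (hA : ∀ a, 0 ≤ A a) (hB : ∀ a, 0 ≤ B a) {w : X → ℝ} (hw : Measurable w)
    (hw0 : ∀ x, 0 ≤ w x) {f : X → ℂ} (hf : AEStronglyMeasurable f μ) {c : ι → ℂ}
    {c₀ c₁ : ℝ → ι → ℂ} (hc : ∀ t a, 0 < t → c a = c₀ t a + c₁ t a) {C : ℝ≥0∞}
    (h₀ : ∀ t, 0 < t → ∑' a, ENNReal.ofReal (A a) * ‖c₀ t a‖ₑ ^ 2 ≤
      C * ∫⁻ x, {x | 1 < t * w x}.indicator (fun x => ‖f x‖ₑ ^ 2) x ∂μ)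
    (h₁ : ∀ t, 0 < t → ∑' a, ENNReal.ofReal (B a) * ‖c₁ t a‖ₑ ^ 2 ≤
      C * ∫⁻ x, {x | 1 < t * w x}ᶜ.indicator (fun x => ENNReal.ofReal (w x) * ‖f x‖ₑ ^ 2) x ∂μ)
    {r : ℝ} (hr₀ : 0 < r) (hr₁ : r < 1) :
    ∑' a, ENNReal.ofReal (A a ^ (1 - r) * B a ^ r) * ‖c a‖ₑ ^ 2 ≤
      2 * C * ∫⁻ x, ENNReal.ofReal (w x ^ r) * ‖f x‖ₑ ^ 2 ∂μ := by
  have hf2 : AEMeasurable (fun x => ‖f x‖ₑ ^ 2) μ := hf.enorm.pow_const 2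
  have hmeas : ∀ t, MeasurableSet {x | 1 < t * w x} := fun t =>
    measurableSet_lt measurable_const (by fun_prop)
  -- The two pieces of `f` at level `t` give the bound for the weight `min(A, t B)`: their
  -- integrands combine to `min(1, t w) |f|²`, and the factor `2` comes from squaring the sum.
  have hk : ∀ t, 0 < t → ∑' a, ENNReal.ofReal (min (A a) (t * B a)) * ‖c a‖ₑ ^ 2 ≤
      2 * C * ∫⁻ x, ENNReal.ofReal (min 1 (t * w x)) * ‖f x‖ₑ ^ 2 ∂μ := by
    intro t ht
    calc ∑' a, ENNReal.ofReal (min (A a) (t * B a)) * ‖c a‖ₑ ^ 2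
        ≤ ∑' a, (2 * (ENNReal.ofReal (A a) * ‖c₀ t a‖ₑ ^ 2) +
          2 * (ENNReal.ofReal t * (ENNReal.ofReal (B a) * ‖c₁ t a‖ₑ ^ 2))) := by
          refine ENNReal.tsum_le_tsum fun a => ?_
          rw [hc t a ht]
          refine (mul_le_mul_right (enorm_add_sq_le _ _) _).trans ?_
          rw [mul_add]
          refine add_le_add ?_ ?_
          · rw [mul_left_comm]
            exact mul_le_mul_right (mul_le_mul_left
              (ENNReal.ofReal_le_ofReal (min_le_left _ _)) _) _
          · rw [mul_left_comm, ← mul_assoc (ENNReal.ofReal t), ← ENNReal.ofReal_mul ht.le]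
            exact mul_le_mul_right (mul_le_mul_left
              (ENNReal.ofReal_le_ofReal (min_le_right _ _)) _) _
      _ = 2 * (∑' a, ENNReal.ofReal (A a) * ‖c₀ t a‖ₑ ^ 2) +
          2 * (ENNReal.ofReal t * ∑' a, ENNReal.ofReal (B a) * ‖c₁ t a‖ₑ ^ 2) := by
          rw [ENNReal.tsum_add, ENNReal.tsum_mul_left, ENNReal.tsum_mul_left, ENNReal.tsum_mul_left]
      _ ≤ 2 * (C * ∫⁻ x, {x | 1 < t * w x}.indicator (fun x => ‖f x‖ₑ ^ 2) x ∂μ) +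
          2 * (ENNReal.ofReal t * (C * ∫⁻ x, {x | 1 < t * w x}ᶜ.indicator
            (fun x => ENNReal.ofReal (w x) * ‖f x‖ₑ ^ 2) x ∂μ)) := by
          gcongr
          · exact h₀ t ht
          · exact h₁ t ht
      _ = 2 * C * ∫⁻ x, ENNReal.ofReal (min 1 (t * w x)) * ‖f x‖ₑ ^ 2 ∂μ := by
          rw [mul_left_comm (ENNReal.ofReal t), ← mul_assoc, ← mul_assoc, ← mul_add,
            ← lintegral_const_mul'' (ENNReal.ofReal t), ← lintegral_add_left']
          · congr 1
            refine lintegral_congr fun x => ?_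
            by_cases hx : 1 < t * w x
            · rw [Set.indicator_of_mem (by exact hx), Set.indicator_of_notMem
                (by exact fun h => h hx), min_eq_left hx.le]
              simp
            · rw [Set.indicator_of_notMem (by exact hx), Set.indicator_of_mem (by exact hx),
                min_eq_right (not_lt.1 hx), ENNReal.ofReal_mul ht.le]
              ring
          · exact hf2.indicator (hmeas t)
          · exact (AEMeasurable.mul (by fun_prop) hf2).indicator (hmeas t).compl
  set Cr := ENNReal.ofReal (1 / (1 - r) + 1 / r) with hCr
  have h1r : 0 < 1 - r := by linarith
  have hCr0 : Cr ≠ 0 := by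
    rw [hCr]
    simp only [ne_eq, ENNReal.ofReal_eq_zero, not_le]
    positivity
  have hmk : AEMeasurable (Function.uncurry fun (t : ℝ) (x : X) => ENNReal.ofReal (t ^ (-r - 1)) *
      (ENNReal.ofReal (min 1 (t * w x)) * ‖f x‖ₑ ^ 2)) ((volume.restrict (Set.Ioi 0)).prod μ) := by
    refine (by fun_prop : Measurable fun z : ℝ × X =>
      ENNReal.ofReal (z.1 ^ (-r - 1))).aemeasurable.mul
      ((by fun_prop : Measurable fun z : ℝ × X =>
        ENNReal.ofReal (min 1 (z.1 * w z.2))).aemeasurable.mul ?_)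
    exact hf.comp_snd.enorm.pow_const 2
  have hmk' : AEMeasurable (fun t : ℝ => ∫⁻ x, ENNReal.ofReal (t ^ (-r - 1)) *
      (ENNReal.ofReal (min 1 (t * w x)) * ‖f x‖ₑ ^ 2) ∂μ) (volume.restrict (Set.Ioi 0)) :=
    hmk.lintegral_prod_right'
  -- Integration against `t^(-r-1) dt` produces the same constant `Cr` on both sides; cancelling it
  -- leaves a bound independent of `r`.
  have key : Cr * ∑' a, ENNReal.ofReal (A a ^ (1 - r) * B a ^ r) * ‖c a‖ₑ ^ 2 ≤
      Cr * (2 * C * ∫⁻ x, ENNReal.ofReal (w x ^ r) * ‖f x‖ₑ ^ 2 ∂μ) := by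
    calc _ = ∑' a, ∫⁻ t in Set.Ioi 0, ENNReal.ofReal (t ^ (-r - 1)) *
          (ENNReal.ofReal (min (A a) (t * B a)) * ‖c a‖ₑ ^ 2) := by
          rw [← ENNReal.tsum_mul_left]
          refine tsum_congr fun a => ?_
          rw [← mul_assoc, hCr, ← lintegral_rpow_mul_min hr₀ hr₁ (hA a) (hB a),
            ← lintegral_mul_const _ (by fun_prop)]
          simp only [mul_assoc]
      _ = ∫⁻ t in Set.Ioi 0, ENNReal.ofReal (t ^ (-r - 1)) *
          ∑' a, ENNReal.ofReal (min (A a) (t * B a)) * ‖c a‖ₑ ^ 2 := by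
          rw [← lintegral_tsum]
          · simp only [ENNReal.tsum_mul_left]
          · intro a
            fun_prop
      _ ≤ ∫⁻ t in Set.Ioi 0, ENNReal.ofReal (t ^ (-r - 1)) *
          (2 * C * ∫⁻ x, ENNReal.ofReal (min 1 (t * w x)) * ‖f x‖ₑ ^ 2 ∂μ) :=
          setLIntegral_mono' measurableSet_Ioi fun t ht => mul_le_mul_right (hk t ht) _
      _ = 2 * C * ∫⁻ t in Set.Ioi 0, ∫⁻ x, ENNReal.ofReal (t ^ (-r - 1)) *
          (ENNReal.ofReal (min 1 (t * w x)) * ‖f x‖ₑ ^ 2) ∂μ := by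
          rw [← lintegral_const_mul'' _ hmk']
          refine lintegral_congr fun t => ?_
          rw [lintegral_const_mul' _ _ ENNReal.ofReal_ne_top]
          ring
      _ = 2 * C * ∫⁻ x, (∫⁻ t in Set.Ioi 0, ENNReal.ofReal (t ^ (-r - 1)) *
          (ENNReal.ofReal (min 1 (t * w x)) * ‖f x‖ₑ ^ 2)) ∂μ := by
          rw [lintegral_lintegral_swap hmk]
      _ = 2 * C * ∫⁻ x, Cr * (ENNReal.ofReal (w x ^ r) * ‖f x‖ₑ ^ 2) ∂μ := by
          congr 1
          refine lintegral_congr fun x => ?_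
          simp only [← mul_assoc]
          rw [lintegral_mul_const _ (by fun_prop),
            lintegral_rpow_mul_min hr₀ hr₁ zero_le_one (hw0 x), Real.one_rpow, one_mul]
      _ = _ := by
          rw [lintegral_const_mul' _ _ ENNReal.ofReal_ne_top]
          ring
  exact (ENNReal.mul_le_mul_iff_right hCr0 ENNReal.ofReal_ne_top).1 key

end Interpolation

/-! ### The two endpoint bounds -/

section Energy

variable {n : ℕ}

/-- The endpoint `θ = 1`: each finite partial sum lies in a box, where it is a `wickTerm` of a
truncated vector and the exclusion principle applies. -/
theorem tsum_listWeight_le_of_sum_le {l : Fin n → ℕ} {f : Conf l → ℂ}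
    (hf : MemLp f 2 (confMeasure l)) (ha : IsAntisymm f) {A : Fin n → Mode → ℝ}
    (hA : ∀ i x, 0 < A i x) {C : ℝ} (hC : ∀ i (J : Finset Mode), ∑ x ∈ J, A i x ≤ C)
    (R : List (Fin n)) (hR : R.Nodup) :
    ∑' a, ENNReal.ofReal (∏ i ∈ R.toFinset, listWeight (A i) (listConf a i)) * ‖coef f a‖ₑ ^ 2 ≤
      ENNReal.ofReal (C ^ R.length) * ∫⁻ X, ‖f X‖ₑ ^ 2 ∂confMeasure l := by
  rw [ENNReal.tsum_eq_iSup_sum]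
  refine iSup_le fun s => ?_
  obtain ⟨J, hJ⟩ := ((tendsto_boxConf l).eventually_ge_atTop s).exists
  refine (Finset.sum_le_sum_of_subset hJ).trans ?_
  have hv : ∀ i x, 0 < (A i x)⁻¹ := fun i x => inv_pos.2 (hA i x)
  have h := ofReal_wickTerm_truncVec ha.coef hv J R hR fun _ => (fun _ => 0, false)
  simp only [inv_inv] at h
  rw [← h]
  have h2 := wickTerm_le_of_sum_le hv J (C := C) (by simpa using fun i => hC i J) R hR
    (fun _ => (fun _ => 0, false)) (truncVec ha.coef J)
  refine (ENNReal.ofReal_le_ofReal h2).trans ?_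
  rw [ENNReal.ofReal_mul' (sq_nonneg _), norm_truncVec_sq]
  refine mul_le_mul_right ?_ _
  rw [← (isL2Basis_conf l).tsum_enorm_sq hf]
  exact ENNReal.sum_le_tsum _

/-- The value of a weight at the first entry, `1` if there is none. -/
def headProd {κ : Type*} (u : κ → ℝ≥0∞) {m : ℕ} (a : Fin m → κ) : ℝ≥0∞ :=
  ∏ k, if k.val = 0 then u (a k) else 1

theorem headProd_eq {κ : Type*} (u : κ → ℝ≥0∞) {m : ℕ} (a : Fin m → κ) (h : 0 < m) :
    headProd u a = u (a ⟨0, h⟩) := by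
  rw [headProd, Finset.prod_eq_single ⟨0, h⟩]
  · simp
  · intro k _ hk
    rw [if_neg]
    intro h0
    exact hk (Fin.ext h0)
  · simp

theorem ofReal_listWeight {κ : Type*} {u : κ → ℝ} {m : ℕ} (a : Fin m → κ) :
    ENNReal.ofReal (listWeight u (List.ofFn a)) =
      m * headProd (fun x => ENNReal.ofReal (u x)) a := by
  cases m with
  | zero => simp [listWeight]
  | succ m =>
    rw [headProd_eq _ _ m.succ_pos, List.ofFn_succ, listWeight, List.length_ofFn,
      ENNReal.ofReal_mul (by positivity)]
    congr 1
    rw [← Nat.cast_add_one, ENNReal.ofReal_natCast]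

/-- By permutation symmetry the first particle may be replaced by any other. -/
theorem lintegral_headProd {l : Fin n → ℕ} {f : Conf l → ℂ}
    (hf : AEStronglyMeasurable f (confMeasure l)) (ha : IsAntisymm f) {W : Fin n → Xi → ℝ≥0∞}
    (hW : ∀ i, Measurable (W i)) (R : Finset (Fin n)) (hR : ∀ i ∈ R, 0 < l i) :
    (∏ i ∈ R, (l i : ℝ≥0∞)) * ∫⁻ X, (∏ i ∈ R, headProd (W i) (X i)) * ‖f X‖ₑ ^ 2 ∂confMeasure l =
      ∫⁻ X, (∏ i ∈ R, ∑ k, W i (X i k)) * ‖f X‖ₑ ^ 2 ∂confMeasure l := by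
  have hf2 : AEMeasurable (fun x => ‖f x‖ₑ ^ 2) (confMeasure l) := hf.enorm.pow_const 2
  have e1 : ∀ X : Conf l, (∏ i ∈ R, ∑ k, W i (X i k)) * ‖f X‖ₑ ^ 2 =
      ∑ p : (∀ i : R, Fin (l i)), (∏ i : R, W i (X i (p i))) * ‖f X‖ₑ ^ 2 := by
    intro X
    rw [← Finset.prod_coe_sort, Finset.prod_univ_sum, Fintype.piFinset_univ, Finset.sum_mul]
  have hm : ∀ p : (∀ i : R, Fin (l i)),
      AEMeasurable (fun X : Conf l => (∏ i : R, W i (X i (p i))) * ‖f X‖ₑ ^ 2) (confMeasure l) := by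
    intro p
    refine AEMeasurable.mul (Finset.measurable_prod _ fun i _ => ?_).aemeasurable hf2
    exact (hW i).comp ((measurable_pi_apply (p i)).comp (measurable_pi_apply (i : Fin n)))
  have e2 : ∀ p : (∀ i : R, Fin (l i)),
      ∫⁻ X, (∏ i : R, W i (X i (p i))) * ‖f X‖ₑ ^ 2 ∂confMeasure l =
        ∫⁻ X, (∏ i ∈ R, headProd (W i) (X i)) * ‖f X‖ₑ ^ 2 ∂confMeasure l := by
    intro p
    -- The permutation brings the chosen particle of each species of `R` to the first place;
    -- antisymmetry changes `f` only by a sign.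
    set σ : (i : Fin n) → Equiv.Perm (Fin (l i)) := fun i =>
      if h : i ∈ R then Equiv.swap ⟨0, hR i h⟩ (p ⟨i, h⟩) else 1 with hσ
    rw [← (measurePreserving_permConf σ).lintegral_comp_emb (permEquiv σ).measurableEmbedding
      fun X => (∏ i ∈ R, headProd (W i) (X i)) * ‖f X‖ₑ ^ 2]
    refine lintegral_congr_ae ?_
    filter_upwards [ha σ] with X hX
    have hsign : ‖permSign σ‖ₑ = 1 := by
      have : ‖permSign σ‖ = 1 := by
        rw [permSign, norm_prod]
        refine Finset.prod_eq_one fun i _ => ?_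
        rcases Int.units_eq_one_or (Equiv.Perm.sign (σ i)) with h | h <;> simp [h]
      rw [← ofReal_norm, this, ENNReal.ofReal_one]
    rw [hX, enorm_mul, hsign, one_mul, ← Finset.prod_coe_sort R]
    refine congrArg (· * ‖f X‖ₑ ^ 2) (Finset.prod_congr rfl fun i _ => ?_)
    rw [headProd_eq _ _ (hR i i.2)]
    simp only [permConf, Function.comp, hσ]
    rw [dif_pos i.2, Equiv.swap_apply_left]
  simp only [e1]
  rw [lintegral_finsetSum' _ fun p _ => hm p]
  simp only [e2]
  rw [Finset.sum_const, nsmul_eq_mul, Finset.card_univ, Fintype.card_pi]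
  simp only [Fintype.card_fin]
  rw [Finset.prod_coe_sort R fun i => l i]
  push_cast
  rfl

/-- The endpoint `θ = 0`: the one-particle inequality is applied to the first particle of each
species of `R`. By permutation symmetry, `l i` times the energy of the first particle may be
replaced by the sum over all particles of that species. -/
theorem tsum_listWeight_le_energy {m : Fin n → ℝ} (hm : ∀ i, 0 ≤ m i) {l : Fin n → ℕ}
    {f : Conf l → ℂ} (hf : MemLp f 2 (confMeasure l)) (ha : IsAntisymm f) (R : Finset (Fin n)) :
    ∑' a, ENNReal.ofReal (∏ i ∈ R, listWeight (modeEnergyWeight (m i)) (listConf a i)) *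
        ‖coef f a‖ₑ ^ 2 ≤
      ∫⁻ X, (∏ i ∈ R, ENNReal.ofReal (dispersionConst (m i) * freeEnergy m i l X)) *
        ‖f X‖ₑ ^ 2 ∂confMeasure l := by
  have hpos : ∀ i x, 0 ≤ modeEnergyWeight (m i) x := fun i x => by
    unfold modeEnergyWeight
    split_ifs <;> positivity
  have hD : ∀ i, 0 ≤ dispersionConst (m i) := fun i => by
    unfold dispersionConst
    have := hm i
    split_ifs <;> positivity
  -- If a species of `R` is absent, the left side vanishes. This case is separate because `headProd`
  -- is then an empty product, equal to `1`.
  by_cases hR : ∀ i ∈ R, 0 < l i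
  swap
  · push Not at hR
    obtain ⟨i, hi, h0⟩ := hR
    have h0' : ∀ a : ConfMode l, listConf a i = [] := fun a =>
      List.eq_nil_of_length_eq_zero (by rw [length_listConf]; omega)
    have : ∀ a : ConfMode l, ENNReal.ofReal (∏ i ∈ R,
        listWeight (modeEnergyWeight (m i)) (listConf a i)) * ‖coef f a‖ₑ ^ 2 = 0 := by
      intro a
      rw [Finset.prod_eq_zero hi (by rw [h0', listWeight]), ENNReal.ofReal_zero, zero_mul]
    simp [this]
  set B : Fin n → Mode → ℝ≥0∞ := fun i x => ENNReal.ofReal (modeEnergyWeight (m i) x)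
  set W : Fin n → Xi → ℝ≥0∞ := fun i ξ =>
    ENNReal.ofReal (dispersionConst (m i) * dispersion (m i) ξ.1)
  have hW : ∀ i, Measurable (W i) := fun i => by
    have := measurable_dispersion (m i)
    fun_prop
  -- Weighted inequality for the first particle of each species in `R`, plain Parseval for all the
  -- others.
  have hbes := WeightedBessel.pi (n := n) (X := fun i => Fin (l i) → Xi)
    (κ := fun i => Fin (l i) → Mode)
    (E := fun i (a : Fin (l i) → Mode) x => ∏ k, xiBasis (a k) (x k))
    (B := fun i a => if i ∈ R then headProd (B i) a else 1)
    (W := fun i X => if i ∈ R then headProd (W i) X else 1)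
    (fun i => IsL2Basis.pi fun _ => isL2Basis_xi)
    (fun i => by
      by_cases hi : i ∈ R
      · simp only [hi, if_true]
        unfold headProd
        refine Finset.measurable_prod _ fun k _ => ?_
        split_ifs
        · exact (hW i).comp (measurable_pi_apply k)
        · exact measurable_const
      · simp only [hi, if_false]
        exact measurable_const)
    (fun i => by
      by_cases hi : i ∈ R
      · simp only [hi, if_true]
        refine WeightedBessel.pi (fun _ => isL2Basis_xi)
          (B := fun (k : Fin (l i)) x => if k.val = 0 then B i x else 1)
          (W := fun (k : Fin (l i)) x => if k.val = 0 then W i x else 1) (fun k => ?_) fun k => ?_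
        · split_ifs
          · exact hW i
          · exact measurable_const
        · split_ifs
          · exact weightedBessel_xi (hm i)
          · exact isL2Basis_xi.weightedBessel_one
      · simp only [hi, if_false]
        exact (IsL2Basis.pi fun _ => isL2Basis_xi).weightedBessel_one)
  have h1 := hbes f hf
  simp only [Finset.prod_ite_mem, Finset.univ_inter] at h1
  have e1 : ∀ a : ConfMode l, ENNReal.ofReal (∏ i ∈ R,
      listWeight (modeEnergyWeight (m i)) (listConf a i)) * ‖coef f a‖ₑ ^ 2 =
      (∏ i ∈ R, (l i : ℝ≥0∞)) * ((∏ i ∈ R, headProd (B i) (a i)) * ‖coef f a‖ₑ ^ 2) := by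
    intro a
    rw [ENNReal.ofReal_prod_of_nonneg fun i _ => listWeight_nonneg (hpos i) _, ← mul_assoc,
      ← Finset.prod_mul_distrib]
    congr 1
    exact Finset.prod_congr rfl fun i _ => ofReal_listWeight (a i)
  simp only [e1]
  rw [ENNReal.tsum_mul_left]
  refine (mul_le_mul_right h1 _).trans (le_of_eq ?_)
  refine (lintegral_headProd hf.1 ha hW R hR).trans (lintegral_congr fun X => ?_)
  congr 1
  refine Finset.prod_congr rfl fun i _ => ?_
  rw [freeEnergy, Finset.mul_sum, ENNReal.ofReal_sum_of_nonneg]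
  intro k _
  exact mul_nonneg (hD i) (dispersion_nonneg _ _)

end Energy

/-! ### The weights attached to the oscillator powers -/

section Weights

/-- The exponent of the oscillators of a species of mass `m`. -/
def oscillatorExponent (s θ m : ℝ) : ℝ := if m = 0 then 1 / 12 + θ * (s - 1 / 12) else θ * s

/-- The eigenvalue of the product of the powers of the oscillators of one particle. -/
def modeWeight (s θ m : ℝ) (a : Mode) : ℝ :=
  ∏ j, (2 * a.1 j + 1 : ℝ) ^ oscillatorExponent s θ m

/-- A summable weight. -/
def modeSumWeight (s : ℝ) (a : Mode) : ℝ := ∏ j, (2 * a.1 j + 1 : ℝ) ^ (-(2 * s))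

theorem one_le_modeWeight {s θ : ℝ} (hs : 1 / 2 < s) (hθ₀ : 0 ≤ θ) (m : ℝ) (a : Mode) :
    1 ≤ modeWeight s θ m a := by
  have h0 : 0 ≤ oscillatorExponent s θ m := by
    unfold oscillatorExponent
    split_ifs
    · have : 0 ≤ θ * (s - 1 / 12) := mul_nonneg hθ₀ (by linarith)
      linarith
    · exact mul_nonneg hθ₀ (by linarith)
  have h1 : ∏ _j : Fin 3, (1 : ℝ) ≤ modeWeight s θ m a :=
    Finset.prod_le_prod (fun _ _ => zero_le_one) fun j _ =>
      Real.one_le_rpow (le_add_of_nonneg_left (by positivity)) h0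
  simpa using h1

theorem modeSumWeight_pos (s : ℝ) (a : Mode) : 0 < modeSumWeight s a :=
  Finset.prod_pos fun j _ => by positivity

theorem modeEnergyWeight_pos (m : ℝ) (a : Mode) : 0 < modeEnergyWeight m a := by
  unfold modeEnergyWeight
  split_ifs <;> positivity

/-- In the massless case `-2 (1/12 + θ (s - 1/12)) = -2sθ - (1 - θ) / 6`: the exponent of the
theorem is the interpolation between the two endpoint weights. -/
theorem inv_modeWeight_sq (s θ m : ℝ) (a : Mode) :
    (modeWeight s θ m a ^ 2)⁻¹ = modeSumWeight s a ^ θ * modeEnergyWeight m a ^ (1 - θ) := by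
  have hpos : ∀ j, (0 : ℝ) < 2 * a.1 j + 1 := fun j => by positivity
  unfold modeWeight modeSumWeight modeEnergyWeight oscillatorExponent
  rw [← Real.finsetProd_rpow _ _ fun j _ => by positivity, ← Finset.prod_pow,
    ← Finset.prod_inv_distrib]
  split_ifs with h0
  · rw [← Real.finsetProd_rpow _ _ fun j _ => by positivity, ← Finset.prod_mul_distrib]
    refine Finset.prod_congr rfl fun j _ => ?_
    rw [← Real.rpow_natCast, ← Real.rpow_mul (hpos j).le, ← Real.rpow_neg (hpos j).le,
      ← Real.rpow_mul (hpos j).le, ← Real.rpow_mul (hpos j).le, ← Real.rpow_add (hpos j)]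
    congr 1
    push_cast
    ring
  · rw [Real.one_rpow, mul_one]
    refine Finset.prod_congr rfl fun j _ => ?_
    rw [← Real.rpow_natCast, ← Real.rpow_mul (hpos j).le, ← Real.rpow_neg (hpos j).le,
      ← Real.rpow_mul (hpos j).le]
    congr 1
    push_cast
    ring

theorem exists_sum_modeSumWeight_le {s : ℝ} (hs : 1 / 2 < s) :
    ∃ C : ℝ, 1 ≤ C ∧ ∀ J : Finset Mode, ∑ x ∈ J, modeSumWeight s x ≤ C := by
  have hsum : Summable fun k : ℕ => (2 * k + 1 : ℝ) ^ (-(2 * s)) := by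
    have h1 : Summable fun k : ℕ => ((k + 1 : ℕ) : ℝ) ^ (-(2 * s)) :=
      (summable_nat_add_iff 1).2 (Real.summable_nat_rpow.2 (by linarith))
    refine Summable.of_nonneg_of_le (fun k => by positivity) (fun k => ?_) h1
    refine Real.rpow_le_rpow_of_nonpos (by positivity) ?_ (by linarith)
    push_cast
    have : (0 : ℝ) ≤ k := Nat.cast_nonneg k
    linarith
  set T := ∑' k : ℕ, (2 * k + 1 : ℝ) ^ (-(2 * s)) with hT
  have hT0 : 0 ≤ T := tsum_nonneg fun k => by positivity
  -- One convergent series, as `2s > 1`, for each of the three coordinates, and two spins. The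
  -- maximum with `1` makes powers of the constant increase with the exponent.
  refine ⟨max 1 (2 * T ^ 3), le_max_left _ _, fun J => le_trans ?_ (le_max_right _ _)⟩
  set N := J.sup (fun x => Finset.univ.sup x.1) + 1 with hN
  have hJ : J ⊆ (Fintype.piFinset fun _ : Fin 3 => Finset.range N) ×ˢ (Finset.univ : Finset Bool) := by
    intro x hx
    simp only [Finset.mem_product, Fintype.mem_piFinset, Finset.mem_range, Finset.mem_univ,
      and_true]
    intro j
    have h1 : x.1 j ≤ Finset.univ.sup x.1 := Finset.le_sup (f := x.1) (Finset.mem_univ j)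
    have h2 : Finset.univ.sup x.1 ≤ J.sup fun x => Finset.univ.sup x.1 :=
      Finset.le_sup (f := fun x : Mode => Finset.univ.sup x.1) hx
    omega
  refine (Finset.sum_le_sum_of_subset_of_nonneg hJ fun x _ _ => (modeSumWeight_pos s x).le).trans ?_
  rw [Finset.sum_product]
  simp only [modeSumWeight, Finset.sum_const, Finset.card_univ, Fintype.card_bool, nsmul_eq_mul]
  rw [← Finset.mul_sum]
  have := Finset.prod_univ_sum (fun _ : Fin 3 => Finset.range N)
    fun _ k => (2 * k + 1 : ℝ) ^ (-(2 * s))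
  rw [← this, Finset.prod_const, Finset.card_univ, Fintype.card_fin]
  push_cast
  refine mul_le_mul_of_nonneg_left (pow_le_pow_left₀ (Finset.sum_nonneg fun k _ => by positivity)
    (hsum.sum_le_tsum _ fun k _ => by positivity) 3) (by norm_num)

theorem listWeight_rpow_mul {κ : Type*} {u u' : κ → ℝ} (hu : ∀ x, 0 < u x) (hu' : ∀ x, 0 < u' x)
    (θ : ℝ) (L : List κ) :
    listWeight (fun x => u x ^ θ * u' x ^ (1 - θ)) L =
      listWeight u L ^ θ * listWeight u' L ^ (1 - θ) := by
  cases L with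
  | nil =>
    simp only [listWeight]
    -- With the convention `0 ^ 0 = 1` the right side still vanishes, since `θ` and `1 - θ` are not
    -- both zero.
    by_cases h : θ = 0
    · rw [h]; simp
    · rw [Real.zero_rpow h, zero_mul]
  | cons x L =>
    simp only [listWeight]
    have hl : (0 : ℝ) < L.length + 1 := by positivity
    rw [Real.mul_rpow hl.le (hu x).le, Real.mul_rpow hl.le (hu' x).le]
    have : (L.length + 1 : ℝ) = (L.length + 1 : ℝ) ^ θ * (L.length + 1 : ℝ) ^ (1 - θ) := by
      rw [← Real.rpow_add hl]; simp
    nth_rewrite 1 [this]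
    ring

end Weights

/-! ### Interpolated energy bound for the annihilators -/

section EnergyBound

variable {n : ℕ}

/-- The energy of the particles of the species other than `i₀`. -/
def partialEnergy (m : Fin n → ℝ) (i₀ : Fin n) (l : Fin n → ℕ) (X : Conf l) : ℝ :=
  ∑ i ∈ Finset.univ.erase i₀, freeEnergy m i l X

theorem freeEnergy_nonneg (m : Fin n → ℝ) (i : Fin n) (l : Fin n → ℕ) (X : Conf l) :
    0 ≤ freeEnergy m i l X := Finset.sum_nonneg fun _ _ => dispersion_nonneg _ _

theorem partialEnergy_nonneg (m : Fin n → ℝ) (i₀ : Fin n) (l : Fin n → ℕ) (X : Conf l) :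
    0 ≤ partialEnergy m i₀ l X := Finset.sum_nonneg fun _ _ => freeEnergy_nonneg _ _ _ _

theorem partialEnergy_perm (m : Fin n → ℝ) (i₀ : Fin n) (l : Fin n → ℕ)
    (σ : (i : Fin n) → Equiv.Perm (Fin (l i))) (X : Conf l) :
    partialEnergy m i₀ l (permConf σ X) = partialEnergy m i₀ l X := by
  refine Finset.sum_congr rfl fun i _ => ?_
  exact Equiv.sum_comp (σ i) fun k => dispersion (m i) (X i k).1

theorem measurable_partialEnergy (m : Fin n → ℝ) (i₀ : Fin n) (l : Fin n → ℕ) :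
    Measurable (partialEnergy m i₀ l) := by
  refine Finset.measurable_sum _ fun i _ => Finset.measurable_sum _ fun k _ => ?_
  exact (measurable_dispersion _).comp (measurable_fst.comp
    ((measurable_pi_apply k).comp (measurable_pi_apply i)))

/-- Cutting at a level of the energy, which is permutation invariant, keeps wave functions
antisymmetric, so both endpoint bounds apply to the pieces. -/
theorem IsAntisymm.indicator {l : Fin n → ℕ} {f : Conf l → ℂ} (hf : IsAntisymm f)
    {s : Set (Conf l)} (hs : ∀ σ X, permConf σ X ∈ s ↔ X ∈ s) : IsAntisymm (s.indicator f) := by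
  intro σ
  filter_upwards [hf σ] with X hX
  by_cases h : X ∈ s
  · rw [Set.indicator_of_mem h, Set.indicator_of_mem ((hs σ X).2 h), hX]
  · rw [Set.indicator_of_notMem h, Set.indicator_of_notMem fun h' => h ((hs σ X).1 h'), mul_zero]

theorem coef_add {l : Fin n → ℕ} {f g : Conf l → ℂ} (hf : MemLp f 2 (confMeasure l))
    (hg : MemLp g 2 (confMeasure l)) (a : ConfMode l) :
    coef (fun X => f X + g X) a = coef f a + coef g a := by
  rw [coef, coef, coef, ← integral_add
    (MemLp.integrable_mul_two ((isL2Basis_conf l).memLp a) hf)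
    (MemLp.integrable_mul_two ((isL2Basis_conf l).memLp a) hg)]
  simp only [mul_add]

/-- Every factor is at most `D (e + 1)`, and `R` misses `i₀`, so there are at most `n - 1` of them.
-/
theorem prod_energy_le {m : Fin n → ℝ} {D : ℝ} (hD : ∀ i, dispersionConst (m i) ≤ D)
    (hD1 : 1 ≤ D) (i₀ : Fin n) (R : Finset (Fin n)) (hR : i₀ ∉ R) (l : Fin n → ℕ) (X : Conf l) :
    ∏ i ∈ R, ENNReal.ofReal (dispersionConst (m i) * freeEnergy m i l X) ≤
      ENNReal.ofReal (D ^ n) * ENNReal.ofReal ((partialEnergy m i₀ l X + 1) ^ ((n : ℝ) - 1)) := by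
  set e := partialEnergy m i₀ l X
  have he : 0 ≤ e := partialEnergy_nonneg _ _ _ _
  have h1 : ∏ i ∈ R, ENNReal.ofReal (dispersionConst (m i) * freeEnergy m i l X) ≤
      ∏ _i ∈ R, ENNReal.ofReal (D * (e + 1)) := by
    refine Finset.prod_le_prod' fun i hi => ENNReal.ofReal_le_ofReal ?_
    have h2 : freeEnergy m i l X ≤ e + 1 := by
      have : freeEnergy m i l X ≤ e :=
        Finset.single_le_sum (f := fun i => freeEnergy m i l X)
          (fun i _ => freeEnergy_nonneg _ _ _ _)
          (Finset.mem_erase.2 ⟨fun h => hR (h ▸ hi), Finset.mem_univ i⟩)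
      linarith
    exact mul_le_mul (hD i) h2 (freeEnergy_nonneg _ _ _ _) (by linarith)
  refine h1.trans ?_
  rw [Finset.prod_const, ← ENNReal.ofReal_pow (by positivity), ← ENNReal.ofReal_mul (by positivity)]
  refine ENNReal.ofReal_le_ofReal ?_
  have hcard : R.card + 1 ≤ n := by
    have h3 : R ⊆ Finset.univ.erase i₀ := fun i hi =>
      Finset.mem_erase.2 ⟨fun h => hR (h ▸ hi), Finset.mem_univ i⟩
    have := Finset.card_le_card h3
    rw [Finset.card_erase_of_mem (Finset.mem_univ _), Finset.card_univ, Fintype.card_fin] at this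
    have := i₀.pos
    omega
  rw [mul_pow]
  refine mul_le_mul (pow_le_pow_right₀ hD1 (by omega)) ?_ (by positivity) (by positivity)
  rw [← Real.rpow_natCast]
  refine Real.rpow_le_rpow_of_exponent_le (by linarith) ?_
  have : ((R.card + 1 : ℕ) : ℝ) ≤ n := Nat.cast_le.2 hcard
  push_cast at this
  linarith

/-- The bound of the annihilators of the species other than `i₀` by powers of the energy. -/
theorem exists_tsum_listWeight_le {m : Fin n → ℝ} (hm : ∀ i, 0 ≤ m i) {s θ : ℝ}
    (hs : 1 / 2 < s) (hθ₀ : 0 ≤ θ) (hθ₁ : θ ≤ 1) :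
    ∃ C : ℝ, 0 < C ∧ ∀ (i₀ : Fin n) (l : Fin n → ℕ) (f : Conf l → ℂ), MemLp f 2 (confMeasure l) →
      IsAntisymm f → ∀ R : List (Fin n), R.Nodup → i₀ ∉ R →
      ∑' a, ENNReal.ofReal (∏ i ∈ R.toFinset,
          listWeight (fun x => (modeWeight s θ (m i) x ^ 2)⁻¹) (listConf a i)) * ‖coef f a‖ₑ ^ 2 ≤
        ENNReal.ofReal C * ∫⁻ X, ENNReal.ofReal
          (((partialEnergy m i₀ l X + 1) ^ ((n : ℝ) - 1)) ^ (1 - θ)) * ‖f X‖ₑ ^ 2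
          ∂confMeasure l := by
  obtain ⟨C₀, hC₀, hsum⟩ := exists_sum_modeSumWeight_le hs
  set D : ℝ := 1 + ∑ i, |dispersionConst (m i)| with hDdef
  have hD1 : 1 ≤ D := le_add_of_nonneg_right (Finset.sum_nonneg fun _ _ => abs_nonneg _)
  have hD : ∀ i, dispersionConst (m i) ≤ D := fun i => by
    have := Finset.single_le_sum (f := fun i => |dispersionConst (m i)|)
      (fun _ _ => abs_nonneg _) (Finset.mem_univ i)
    have := le_abs_self (dispersionConst (m i))
    linarith
  refine ⟨2 * (C₀ ^ n + D ^ n), by positivity, fun i₀ l f hf ha R hRn hR => ?_⟩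
  set w : Conf l → ℝ := fun X => (partialEnergy m i₀ l X + 1) ^ ((n : ℝ) - 1) with hw
  have hwm : Measurable w := by
    have := measurable_partialEnergy m i₀ l
    fun_prop
  have hw0 : ∀ X, 0 ≤ w X := fun X =>
    Real.rpow_nonneg (by have := partialEnergy_nonneg m i₀ l X; linarith) _
  set C' : ℝ≥0∞ := ENNReal.ofReal (C₀ ^ n + D ^ n) with hC'
  have hRl : R.length ≤ n := by
    have := hRn.length_le_card
    simpa using this
  set A : ConfMode l → ℝ := fun a => ∏ i ∈ R.toFinset, listWeight (modeSumWeight s) (listConf a i)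
  set B : ConfMode l → ℝ := fun a => ∏ i ∈ R.toFinset,
    listWeight (modeEnergyWeight (m i)) (listConf a i)
  have hA : ∀ a, 0 ≤ A a := fun a => Finset.prod_nonneg fun i _ =>
    listWeight_nonneg (fun x => (modeSumWeight_pos s x).le) _
  have hB : ∀ a, 0 ≤ B a := fun a => Finset.prod_nonneg fun i _ =>
    listWeight_nonneg (fun x => (modeEnergyWeight_pos _ x).le) _
  have hAB : ∀ a : ConfMode l, ∏ i ∈ R.toFinset,
      listWeight (fun x => (modeWeight s θ (m i) x ^ 2)⁻¹) (listConf a i) =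
      A a ^ θ * B a ^ (1 - θ) := by
    intro a
    rw [← Real.finsetProd_rpow _ _ fun i _ =>
        listWeight_nonneg (fun x => (modeSumWeight_pos s x).le) _,
      ← Real.finsetProd_rpow _ _ fun i _ =>
        listWeight_nonneg (fun x => (modeEnergyWeight_pos _ x).le) _, ← Finset.prod_mul_distrib]
    refine Finset.prod_congr rfl fun i _ => ?_
    simp only [inv_modeWeight_sq]
    exact listWeight_rpow_mul (modeSumWeight_pos s) (modeEnergyWeight_pos (m i)) θ _
  have bound₀ : ∀ g : Conf l → ℂ, MemLp g 2 (confMeasure l) → IsAntisymm g →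
      ∑' a, ENNReal.ofReal (A a) * ‖coef g a‖ₑ ^ 2 ≤
        C' * ∫⁻ X, ‖g X‖ₑ ^ 2 ∂confMeasure l := by
    intro g hg hga
    refine (tsum_listWeight_le_of_sum_le hg hga (fun _ => modeSumWeight_pos s)
      (fun _ => hsum) R hRn).trans (mul_le_mul_left (ENNReal.ofReal_le_ofReal ?_) _)
    have : C₀ ^ R.length ≤ C₀ ^ n := pow_le_pow_right₀ hC₀ hRl
    have : 0 ≤ D ^ n := by positivity
    linarith
  have bound₁ : ∀ g : Conf l → ℂ, MemLp g 2 (confMeasure l) → IsAntisymm g →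
      ∑' a, ENNReal.ofReal (B a) * ‖coef g a‖ₑ ^ 2 ≤
        C' * ∫⁻ X, ENNReal.ofReal (w X) * ‖g X‖ₑ ^ 2 ∂confMeasure l := by
    intro g hg hga
    refine (tsum_listWeight_le_energy hm hg hga R.toFinset).trans ?_
    rw [← lintegral_const_mul' _ _ ENNReal.ofReal_ne_top]
    refine lintegral_mono fun X => ?_
    rw [← mul_assoc]
    refine mul_le_mul_left ((prod_energy_le hD hD1 i₀ R.toFinset (by simpa using hR) l X).trans ?_) _
    refine mul_le_mul_left (ENNReal.ofReal_le_ofReal ?_) _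
    have : 0 ≤ C₀ ^ n := by positivity
    linarith
  have hCC : ENNReal.ofReal (2 * (C₀ ^ n + D ^ n)) = 2 * C' := by
    rw [ENNReal.ofReal_mul (by norm_num), ← hC', ENNReal.ofReal_ofNat]
  have hC2 : C' ≤ 2 * C' := by
    rw [two_mul]; exact le_self_add
  simp only [hAB]
  rw [hCC]
  -- Real interpolation requires `0 < r < 1`, so `θ = 0` and `θ = 1` are read off directly from the
  -- endpoint bounds.
  rcases eq_or_lt_of_le hθ₀ with h0 | h0
  · subst h0
    simp only [Real.rpow_zero, one_mul, sub_zero, Real.rpow_one]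
    exact (bound₁ f hf ha).trans (mul_le_mul_left hC2 _)
  rcases eq_or_lt_of_le hθ₁ with h1 | h1
  · subst h1
    simp only [Real.rpow_zero, mul_one, sub_self, Real.rpow_one, ENNReal.ofReal_one, one_mul]
    exact (bound₀ f hf ha).trans (mul_le_mul_left hC2 _)
  have hset : ∀ t : ℝ, MeasurableSet {X : Conf l | 1 < t * w X} := fun t =>
    measurableSet_lt measurable_const (by fun_prop)
  have hinv : ∀ (t : ℝ) (σ : (i : Fin n) → Equiv.Perm (Fin (l i))) (X : Conf l),
      permConf σ X ∈ {X : Conf l | 1 < t * w X} ↔ X ∈ {X : Conf l | 1 < t * w X} := by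
    intro t σ X
    simp only [Set.mem_ofPred_eq, hw, partialEnergy_perm]
  have hI := tsum_interpolate (μ := confMeasure l) hA hB hwm hw0 hf.1 (c := coef f)
    (c₀ := fun t => coef ({X | 1 < t * w X}.indicator f))
    (c₁ := fun t => coef ({X | 1 < t * w X}ᶜ.indicator f)) (C := C')
    (fun t a _ => by
      rw [← coef_add (hf.indicator (hset t)) (hf.indicator (hset t).compl)]
      congr 1
      funext X
      exact (congrFun (Set.indicator_self_add_compl {X | 1 < t * w X} f) X).symm)
    (fun t _ => by
      refine (bound₀ _ (hf.indicator (hset t)) (ha.indicator (hinv t))).trans (le_of_eq ?_)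
      congr 1
      refine lintegral_congr fun X => ?_
      by_cases hX : X ∈ {X | 1 < t * w X}
      · rw [Set.indicator_of_mem hX, Set.indicator_of_mem hX]
      · rw [Set.indicator_of_notMem hX, Set.indicator_of_notMem hX]; simp)
    (fun t _ => by
      refine (bound₁ _ (hf.indicator (hset t).compl)
        (ha.indicator fun σ X => not_congr (hinv t σ X))).trans (le_of_eq ?_)
      congr 1
      refine lintegral_congr fun X => ?_
      by_cases hX : X ∈ {X | 1 < t * w X}ᶜ
      · rw [Set.indicator_of_mem hX, Set.indicator_of_mem hX]
      · rw [Set.indicator_of_notMem hX, Set.indicator_of_notMem hX]; simp)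
    (r := 1 - θ) (by linarith) (by linarith)
  rw [sub_sub_cancel] at hI
  exact hI

end EnergyBound

/-! ### Oscillator powers act diagonally on coefficients -/

section Oscillator

theorem measurePreserving_act_outer {Y R Z : Type*} [MeasurableSpace Y] [MeasurableSpace R]
    [MeasurableSpace Z] {μ : Measure Y} {ρ : Measure R} {ν : Measure Z} [SigmaFinite μ]
    [SigmaFinite ρ] [SigmaFinite ν] {τ : Y × Z → Y × Z}
    (hτ : MeasurePreserving τ (μ.prod ν) (μ.prod ν)) :
    MeasurePreserving (fun z : (Y × R) × Z => (((τ (z.1.1, z.2)).1, z.1.2), (τ (z.1.1, z.2)).2))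
      ((μ.prod ρ).prod ν) ((μ.prod ρ).prod ν) := by
  have h1 : MeasurePreserving (Prod.map (Prod.swap : Y × R → R × Y) (id : Z → Z))
      ((μ.prod ρ).prod ν) ((ρ.prod μ).prod ν) :=
    Measure.measurePreserving_swap.prod (MeasurePreserving.id ν)
  have h2 := measurePreserving_prodAssoc ρ μ ν
  have h3 : MeasurePreserving (Prod.map (id : R → R) τ) (ρ.prod (μ.prod ν)) (ρ.prod (μ.prod ν)) :=
    (MeasurePreserving.id ρ).prod hτ
  have h4 : MeasurePreserving (Prod.map (Prod.swap : R × Y → Y × R) (id : Z → Z))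
      ((ρ.prod μ).prod ν) ((μ.prod ρ).prod ν) :=
    Measure.measurePreserving_swap.prod (MeasurePreserving.id ν)
  exact h4.comp ((h2.symm _).comp (h3.comp (h2.comp h1)))

theorem measurePreserving_act_pi {n : ℕ} (i : Fin n) {Y Z : Type} [MeasurableSpace Y]
    [MeasurableSpace Z] {μ : Measure Y} {ν : Measure Z} [SigmaFinite μ] [SigmaFinite ν]
    {τ : Y × Z → Y × Z} (hτ : MeasurePreserving τ (μ.prod ν) (μ.prod ν)) :
    MeasurePreserving (fun z : (Fin n → Y) × Z =>
      (Function.update z.1 i (τ (z.1 i, z.2)).1, (τ (z.1 i, z.2)).2))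
      ((Measure.pi fun _ => μ).prod ν) ((Measure.pi fun _ => μ).prod ν) := by
  cases n with
  | zero => exact i.elim0
  | succ n =>
    have h1 := measurePreserving_piFinSuccAbove (fun _ : Fin (n + 1) => μ) i
    have h2 := measurePreserving_act_outer (ρ := Measure.pi fun _ : Fin n => μ) hτ
    have h3 := ((h1.symm _).prod (MeasurePreserving.id ν)).comp
      (h2.comp (h1.prod (MeasurePreserving.id ν)))
    convert h3 using 1
    funext z
    refine Prod.ext ?_ rfl
    exact (Fin.insertNth_removeNth i (τ (z.1 i, z.2)).1 z.1).symm

variable {n : ℕ}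

/-- Exchange the coordinate `k_{i,j}` with an auxiliary variable. -/
def swapCoord (i : Fin n) (j : Fin 3) (z : (Fin n → Xi) × ℝ) : (Fin n → Xi) × ℝ :=
  (setCoord z.1 i j z.2, (z.1 i).1 j)

theorem measurePreserving_swapCoord (i : Fin n) (j : Fin 3) :
    MeasurePreserving (swapCoord i j) ((kernelMeasure n).prod volume)
      ((kernelMeasure n).prod volume) := by
  have h1 := measurePreserving_act_pi j
    (Measure.measurePreserving_swap (μ := (volume : Measure ℝ)) (ν := (volume : Measure ℝ)))
  rw [← volume_pi] at h1
  exact measurePreserving_act_pi i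
    (measurePreserving_act_outer (ρ := (Measure.count : Measure Bool)) h1)

theorem swapCoord_involutive (i : Fin n) (j : Fin 3) : Function.Involutive (swapCoord i j) := by
  rintro ⟨ξ, x⟩
  simp [swapCoord, setCoord]

theorem exists_kernelBasis_setCoord (β : Fin n → Mode) (i : Fin n) (j : Fin 3) (ξ : Fin n → Xi) :
    ∃ c : ℝ, ∀ x, kernelBasis β (setCoord ξ i j x) = hermiteN ((β i).1 j) x * c := by
  refine ⟨((∏ j' ∈ Finset.univ.erase j, hermiteN ((β i).1 j') ((ξ i).1 j')) *
    (if (ξ i).2 = (β i).2 then 1 else 0)) * ∏ i' ∈ Finset.univ.erase i, xiBasis (β i') (ξ i'),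
    fun x => ?_⟩
  rw [kernelBasis, ← Finset.mul_prod_erase _ _ (Finset.mem_univ i)]
  have e1 : ∏ i' ∈ Finset.univ.erase i, xiBasis (β i') (setCoord ξ i j x i') =
      ∏ i' ∈ Finset.univ.erase i, xiBasis (β i') (ξ i') := by
    refine Finset.prod_congr rfl fun i' hi' => ?_
    rw [setCoord, Function.update_of_ne (Finset.ne_of_mem_erase hi')]
  have e2 : xiBasis (β i) (setCoord ξ i j x i) = hermiteN ((β i).1 j) x *
      ((∏ j' ∈ Finset.univ.erase j, hermiteN ((β i).1 j') ((ξ i).1 j')) *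
        (if (ξ i).2 = (β i).2 then 1 else 0)) := by
    rw [setCoord, Function.update_self, xiBasis, ← Finset.mul_prod_erase _ _ (Finset.mem_univ j)]
    simp only [Function.update_self]
    rw [mul_assoc]
    congr 2
    refine Finset.prod_congr rfl fun j' hj' => ?_
    rw [Function.update_of_ne (Finset.ne_of_mem_erase hj')]
  rw [e1, e2]
  ring

/-- The definition of the oscillator power concerns integrals over `k_{i,j}` for almost every full
`ξ`, in which the coordinate `k_{i,j}` of `ξ` is redundant. An auxiliary variable with the
normalised weight `hermiteN 0 ²` is adjoined and exchanged with `k_{i,j}`, so the weight integrates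
out the redundant coordinate. -/
theorem kernelCoef_eq_setCoord (β : Fin n → Mode) (i : Fin n) (j : Fin 3)
    {F : (Fin n → Xi) → ℂ} (hF : MemLp F 2 (kernelMeasure n)) :
    kernelCoef F β = ∫ ξ, (∫ x, (kernelBasis β (setCoord ξ i j x) : ℂ) * F (setCoord ξ i j x)) *
      ((hermiteN 0 ((ξ i).1 j) : ℂ) * hermiteN 0 ((ξ i).1 j)) ∂kernelMeasure n := by
  have hi1 : Integrable (fun ξ => (kernelBasis β ξ : ℂ) * F ξ) (kernelMeasure n) :=
    MemLp.integrable_mul_two (isL2Basis_kernel.memLp β) hF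
  have hi2 : Integrable fun x => (hermiteN 0 x : ℂ) * hermiteN 0 x :=
    MemLp.integrable_mul_two (isL2Basis_hermite.memLp 0) (isL2Basis_hermite.memLp 0)
  have hi := hi1.mul_prod hi2
  set T : (Fin n → Xi) × ℝ ≃ᵐ (Fin n → Xi) × ℝ :=
    MeasurableEquiv.ofInvolutive (swapCoord i j) (swapCoord_involutive i j)
      (measurePreserving_swapCoord i j).measurable
  have hT : MeasurePreserving T ((kernelMeasure n).prod volume) ((kernelMeasure n).prod volume) :=
    measurePreserving_swapCoord i j
  have e1 : kernelCoef F β = ∫ z : (Fin n → Xi) × ℝ, ((kernelBasis β z.1 : ℂ) * F z.1) *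
      ((hermiteN 0 z.2 : ℂ) * hermiteN 0 z.2) ∂((kernelMeasure n).prod volume) := by
    rw [integral_prod_mul (fun ξ => (kernelBasis β ξ : ℂ) * F ξ)
      fun x => (hermiteN 0 x : ℂ) * hermiteN 0 x, isL2Basis_hermite.norm 0, mul_one]
    rfl
  have e2 := hT.integral_comp' fun z : (Fin n → Xi) × ℝ => ((kernelBasis β z.1 : ℂ) * F z.1) *
      ((hermiteN 0 z.2 : ℂ) * hermiteN 0 z.2)
  have hi' := hT.integrable_comp_of_integrable hi
  refine e1.trans (e2.symm.trans ((integral_prod _ hi').trans ?_))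
  refine integral_congr_ae (Filter.Eventually.of_forall fun ξ => ?_)
  simp only
  rw [← integral_mul_const]
  rfl

/-- The defining relation is used for the Hermite eigenfunction of eigenvalue `2k + 1`; along the
coordinate `k_{i,j}` the product basis is a multiple of that function. -/
theorem IsOscillatorPow.kernelCoef {i : Fin n} {j : Fin 3} {a : ℝ} {G F : Kernel n}
    (h : IsOscillatorPow i j a G F) (β : Fin n → Mode) :
    kernelCoef F β = (((2 * (β i).1 j + 1 : ℝ) ^ a : ℝ) : ℂ) * kernelCoef G β := by
  have h1 := h (hermiteC ((β i).1 j)) (2 * (β i).1 j + 1) fun x => by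
    rw [harmonicOscillator_hermiteC]
  rw [kernelCoef_eq_setCoord β i j (Lp.memLp F), kernelCoef_eq_setCoord β i j (Lp.memLp G),
    ← integral_const_mul]
  refine integral_congr_ae ?_
  filter_upwards [h1] with ξ hξ
  obtain ⟨c, hc⟩ := exists_kernelBasis_setCoord β i j ξ
  have e : ∀ H : (Fin n → Xi) → ℂ, ∫ x, (kernelBasis β (setCoord ξ i j x) : ℂ) *
      H (setCoord ξ i j x) = c * ∫ x, conj (hermiteC ((β i).1 j) x) * H (setCoord ξ i j x) := by
    intro H
    rw [← integral_const_mul]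
    refine integral_congr_ae (Filter.Eventually.of_forall fun x => ?_)
    simp only [hc, hermiteC_apply, Complex.conj_ofReal]
    push_cast
    ring
  rw [e, e, hξ]
  ring

theorem IsOscillatorProd.kernelCoef {a : ℝ} {L : List (Fin n × Fin 3)} {G F : Kernel n}
    (h : IsOscillatorProd a L G F) (β : Fin n → Mode) :
    kernelCoef F β =
      (((L.map fun t => (2 * (β t.1).1 t.2 + 1 : ℝ) ^ a).prod : ℝ) : ℂ) * kernelCoef G β := by
  induction L generalizing F with
  | nil =>
    obtain rfl : F = G := h
    simp
  | cons t L ih =>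
    obtain ⟨F', h1, h2⟩ := h
    rw [h2.kernelCoef β, ih h1, List.map_cons, List.prod_cons]
    push_cast
    ring

theorem prod_map_product {P : Fin n → Prop} [DecidablePred P] (f : Fin n × Fin 3 → ℝ) :
    (((((List.finRange n).filter fun i => P i).product (List.finRange 3)).map f).prod : ℝ) =
      ∏ i ∈ Finset.univ.filter P, ∏ j, f (i, j) := by
  rw [← List.prod_toFinset]
  · rw [← Finset.prod_product']
    refine Finset.prod_congr ?_ fun _ _ => rfl
    ext ⟨i, j⟩
    simp
  · exact ((List.nodup_finRange n).filter _).product (List.nodup_finRange 3)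

theorem IsWeighted.kernelCoef {m : Fin n → ℝ} (hm : ∀ i, 0 ≤ m i) {i₀ : Fin n} {s θ : ℝ}
    {G F : Kernel n} (h : IsWeighted m i₀ s θ G F) (β : Fin n → Mode) :
    kernelCoef F β =
      ((∏ i ∈ Finset.univ.erase i₀, modeWeight s θ (m i) (β i) : ℝ) : ℂ) * kernelCoef G β := by
  obtain ⟨F', h1, h2⟩ := h
  rw [h2.kernelCoef β, h1.kernelCoef β, massivePairs, masslessPairs, prod_map_product,
    prod_map_product, ← mul_assoc, ← Complex.ofReal_mul]
  congr 2
  have e1 : ∏ i ∈ Finset.univ.filter (fun i => i ≠ i₀ ∧ 0 < m i), ∏ j : Fin 3,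
      (2 * (β i).1 j + 1 : ℝ) ^ (θ * s) =
      ∏ i ∈ Finset.univ.filter (fun i => i ≠ i₀ ∧ 0 < m i), modeWeight s θ (m i) (β i) := by
    refine Finset.prod_congr rfl fun i hi => ?_
    rw [modeWeight, oscillatorExponent, if_neg (Finset.mem_filter.1 hi).2.2.ne']
  have e2 : ∏ i ∈ Finset.univ.filter (fun i => i ≠ i₀ ∧ m i = 0), ∏ j : Fin 3,
      (2 * (β i).1 j + 1 : ℝ) ^ (1 / 12 + θ * (s - 1 / 12)) =
      ∏ i ∈ Finset.univ.filter (fun i => i ≠ i₀ ∧ m i = 0), modeWeight s θ (m i) (β i) := by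
    refine Finset.prod_congr rfl fun i hi => ?_
    rw [modeWeight, oscillatorExponent, if_pos (Finset.mem_filter.1 hi).2.2]
  rw [e1, e2, ← Finset.prod_union]
  · refine Finset.prod_congr ?_ fun _ _ => rfl
    ext i
    have := (hm i).lt_or_eq
    simp only [Finset.mem_union, Finset.mem_filter, Finset.mem_univ, true_and, Finset.mem_erase,
      and_true]
    constructor
    · rintro (h | h) <;> exact h.1
    · intro h
      rcases this with h' | h'
      · exact Or.inl ⟨h, h'⟩
      · exact Or.inr ⟨h, h'.symm⟩
  · rw [Finset.disjoint_left]
    intro i hi hi'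
    exact (Finset.mem_filter.1 hi).2.2.ne' (Finset.mem_filter.1 hi').2.2

end Oscillator

/-! ### Completeness of the sectors and the bound of the form in each of them -/

section Sectors

variable {n : ℕ}

/-- Composition with a permutation is an isometry, so the sector is an intersection of closed sets.
Its completeness makes the Fock space complete, as the Riesz theorem requires. -/
theorem isClosed_sector (l : Fin n → ℕ) : IsClosed (sector l : Set (Lp ℂ 2 (confMeasure l))) := by
  have h : (sector l : Set (Lp ℂ 2 (confMeasure l))) =
      ⋂ σ : (i : Fin n) → Equiv.Perm (Fin (l i)),
        {f | Lp.compMeasurePreservingₗᵢ ℂ (permConf σ) (measurePreserving_permConf σ) f =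
          permSign σ • f} := by
    ext f
    rw [Set.mem_iInter]
    refine forall_congr' fun σ => ?_
    have e1 := Lp.coeFn_compMeasurePreserving f (measurePreserving_permConf σ)
    have e2 := Lp.coeFn_smul (permSign σ) f
    constructor
    · intro h
      refine Lp.ext ?_
      filter_upwards [e1, e2, h] with X h1 h2 h3
      rw [h2]
      exact h1.trans h3
    · intro h
      have h' := congrArg (fun g : Lp ℂ 2 (confMeasure l) => (g : Conf l → ℂ)) h
      filter_upwards [e1, e2] with X h1 h2
      have h3 := congrFun h' X
      exact h1.symm.trans (h3.trans h2)
  rw [h]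
  exact isClosed_iInter fun σ => isClosed_eq (LinearIsometry.continuous _)
    (continuous_const_smul _)

instance (l : Fin n → ℕ) : CompleteSpace (sector l) := (isClosed_sector l).completeSpace_coe

theorem memLp_wave (φ : Fock n) (l : Fin n → ℕ) : MemLp (wave φ l) 2 (confMeasure l) :=
  Lp.memLp _

theorem isAntisymm_wave (φ : Fock n) (l : Fin n → ℕ) : IsAntisymm (wave φ l) := (φ l).2

theorem ofReal_norm_Lp_sq {X : Type*} [MeasurableSpace X] {μ : Measure X} (f : Lp ℂ 2 μ) :
    ENNReal.ofReal (‖f‖ ^ 2) = ∫⁻ x, ‖f x‖ₑ ^ 2 ∂μ := by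
  rw [ENNReal.ofReal_pow (norm_nonneg _), ofReal_norm, Lp.enorm_def,
    eLpNorm_eq_lintegral_rpow_enorm_toReal (by norm_num) (by norm_num), ← ENNReal.rpow_natCast,
    ← ENNReal.rpow_mul]
  simp

theorem ofReal_norm_sector_sq (φ : Fock n) (l : Fin n → ℕ) :
    ENNReal.ofReal (‖φ l‖ ^ 2) = ∫⁻ X, ‖wave φ l X‖ₑ ^ 2 ∂confMeasure l :=
  ofReal_norm_Lp_sq _

theorem hasSum_norm_sector_sq (φ : Fock n) : HasSum (fun l => ‖φ l‖ ^ 2) (‖φ‖ ^ 2) := by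
  have := lp.hasSum_norm (p := 2) (by norm_num) φ
  simpa using this

/-- Bound of the form of the interaction in one sector. -/
theorem exists_norm_form_le {m : Fin n → ℝ} (hm : ∀ i, 0 ≤ m i) {s θ : ℝ}
    (hs : 1 / 2 < s) (hθ₀ : 0 ≤ θ) (hθ₁ : θ ≤ 1) :
    ∃ C : ℝ, 0 < C ∧ ∀ (p : ℕ) (i₀ : Fin n) (G F : Kernel n), IsWeighted m i₀ s θ G F →
      ∀ φ η : Fock n, IsEnergyPow m i₀ 1 (((n : ℝ) - 1) / 2 * (1 - θ)) φ η → ∀ (ψ : Fock n) l,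
      Integrable (formIntegrand p G ψ φ l) ((kernelMeasure n).prod (confMeasure l)) ∧
      ‖∫ z, formIntegrand p G ψ φ l z ∂((kernelMeasure n).prod (confMeasure l))‖ ≤
        C * ‖F‖ * (‖ψ fun i => indOcc (fun i : Fin n => i.val < p) i + l i‖ *
          ‖η fun i => indOcc (fun i : Fin n => ¬ i.val < p) i + l i‖) := by
  obtain ⟨C, hC, hbound⟩ := exists_tsum_listWeight_le hm hs hθ₀ hθ₁
  refine ⟨Real.sqrt (2 ^ n * C), by positivity, fun p i₀ G F hGF φ η hη ψ l => ?_⟩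
  set S : Fin n → Prop := fun i => i.val < p with hS
  set lψ : Fin n → ℕ := fun i => indOcc S i + l i with hlψ
  set lφ : Fin n → ℕ := fun i => indOcc (fun i => ¬ S i) i + l i with hlφ
  obtain ⟨c, hc, hform⟩ := exists_formIntegrand_eq p l
  obtain ⟨hInt, M, hM, hT⟩ := form_expansion S l (Lp.memLp G) (memLp_wave ψ lψ) (memLp_wave φ lφ)
  have hfun : formIntegrand p G ψ φ l = fun z => c * ((∏ i, Real.sqrt (l i + 1) : ℝ) : ℂ) *
      (G z.1 * (conj (wave ψ lψ (appendConf (constConf S z.1) z.2)) *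
        wave φ lφ (appendConf (constConf (fun i => ¬ S i) z.1) z.2))) := funext (hform G ψ φ)
  refine ⟨by rw [hfun]; exact hInt.const_mul _, ?_⟩
  have hψa := (isAntisymm_wave ψ lψ).coef
  have hφa := (isAntisymm_wave φ lφ).coef
  have hP : ∀ J, ‖truncVec hψa J‖ ^ 2 ≤ ‖ψ lψ‖ ^ 2 := by
    intro J
    rw [← ENNReal.ofReal_le_ofReal_iff (sq_nonneg _), norm_truncVec_sq, ofReal_norm_sector_sq,
      ← (isL2Basis_conf lψ).tsum_enorm_sq (memLp_wave ψ lψ)]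
    exact ENNReal.sum_le_tsum _
  set v : Fin n → Mode → ℝ := fun i x => modeWeight s θ (m i) x ^ 2 with hv
  have hv1 : ∀ i x, 1 ≤ v i x := fun i x => one_le_pow₀ (one_le_modeWeight hs hθ₀ _ _)
  -- The squared multiplier has exponent `(n - 1)(1 - θ)`, twice that of the energy power defining
  -- `η`.
  have hηeq : ∫⁻ X, ENNReal.ofReal (((partialEnergy m i₀ lφ X + 1) ^ ((n : ℝ) - 1)) ^ (1 - θ)) *
      ‖wave φ lφ X‖ₑ ^ 2 ∂confMeasure lφ = ENNReal.ofReal (‖η lφ‖ ^ 2) := by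
    rw [ofReal_norm_sector_sq]
    refine lintegral_congr_ae ?_
    filter_upwards [hη lφ] with X hX
    have he : 0 ≤ partialEnergy m i₀ lφ X + 1 := by
      have := partialEnergy_nonneg m i₀ lφ X
      linarith
    have hX' : wave η lφ X = (((partialEnergy m i₀ lφ X + 1) ^ (((n : ℝ) - 1) / 2 * (1 - θ)) : ℝ) :
        ℂ) * wave φ lφ X := hX
    rw [hX', enorm_mul, mul_pow]
    congr 1
    rw [← ofReal_norm, Complex.norm_real, Real.norm_of_nonneg (Real.rpow_nonneg he _),
      ← ENNReal.ofReal_pow (Real.rpow_nonneg he _), ← Real.rpow_mul he, ← Real.rpow_natCast,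
      ← Real.rpow_mul he]
    congr 2
    push_cast
    ring
  have hK : ∀ J, ∀ R : List (Fin n), R.Nodup → i₀ ∉ R →
      wickTerm v J R (fun _ => (fun _ => 0, false)) (truncVec hφa J) ≤ C * ‖η lφ‖ ^ 2 := by
    intro J R hR hi
    rw [← ENNReal.ofReal_le_ofReal_iff (by positivity),
      ofReal_wickTerm_truncVec hφa (fun i x => zero_lt_one.trans_le (hv1 i x)) J R hR,
      ENNReal.ofReal_mul hC.le, ← hηeq]
    exact (ENNReal.sum_le_tsum _).trans
      (hbound i₀ lφ _ (memLp_wave φ lφ) (isAntisymm_wave φ lφ) R hR hi)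
  -- The weights are the squared eigenvalues of the oscillator product, so the sum is part of
  -- Parseval's sum for `F`.
  have hW : ∀ t : Finset (Fin n → Mode), ∑ β ∈ t, (∏ i ∈ Finset.univ.erase i₀, v i (β i)) *
      ‖kernelCoef G β‖ ^ 2 ≤ ‖F‖ ^ 2 := by
    intro t
    have e : ∀ β, (∏ i ∈ Finset.univ.erase i₀, v i (β i)) * ‖kernelCoef G β‖ ^ 2 =
        ‖kernelCoef F β‖ ^ 2 := by
      intro β
      rw [hGF.kernelCoef hm β, norm_mul, mul_pow, Complex.norm_real, Real.norm_eq_abs, sq_abs,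
        Finset.prod_pow]
    have e2 : ∫ x, ‖F x‖ ^ 2 ∂kernelMeasure n = ‖F‖ ^ 2 := by
      have h1 := ofReal_norm_Lp_sq F
      rw [← ofReal_integral_norm_sq (Lp.memLp F)] at h1
      exact ((ENNReal.ofReal_eq_ofReal_iff (sq_nonneg _)
        (integral_nonneg fun _ => sq_nonneg _)).1 h1).symm
    simp only [e]
    rw [← e2]
    exact sum_le_hasSum _ (fun _ _ => sq_nonneg _) (isL2Basis_kernel.hasSum_norm_sq (Lp.memLp F))
  have hmain := norm_form_coef_le S i₀ hv1 hψa hφa hP _ hK hW hM hT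
  have hnorm : ‖∫ z, formIntegrand p G ψ φ l z ∂((kernelMeasure n).prod (confMeasure l))‖ ^ 2 ≤
      ‖ψ lψ‖ ^ 2 * (‖F‖ ^ 2 * (2 ^ n * (C * ‖η lφ‖ ^ 2))) := by
    refine le_trans (le_of_eq ?_) hmain
    rw [hfun, integral_const_mul, mul_assoc, norm_mul, hc, one_mul]
  refine abs_le_of_sq_le_sq' ?_ (by positivity) |>.2
  refine hnorm.trans (le_of_eq ?_)
  rw [mul_pow, mul_pow, mul_pow, Real.sq_sqrt (by positivity)]
  ring

/-- The domain of a power of the energy does not change when `1` is added to the energy. -/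
theorem exists_energyPow_one {m : Fin n → ℝ} {i₀ : Fin n} {α : ℝ} (hα : 0 ≤ α) {φ η₀ : Fock n}
    (h : IsEnergyPow m i₀ 0 α φ η₀) : ∃ η, IsEnergyPow m i₀ 1 α φ η := by
  set k : (l : Fin n → ℕ) → Conf l → ℝ := fun l X => (partialEnergy m i₀ l X + 1) ^ α with hk
  have hkm : ∀ l, Measurable (k l) := fun l => by
    have := measurable_partialEnergy m i₀ l
    fun_prop
  have hk0 : ∀ l X, 0 ≤ k l X := fun l X =>
    Real.rpow_nonneg (by have := partialEnergy_nonneg m i₀ l X; linarith) _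
  -- For `e ≤ 1` the left side is at most `2^α`; for `e ≥ 1`, `e + 1 ≤ 2 e`.
  have hle : ∀ l X, k l X ≤ 2 ^ α * (partialEnergy m i₀ l X ^ α + 1) := by
    intro l X
    have he := partialEnergy_nonneg m i₀ l X
    set e := partialEnergy m i₀ l X
    have h0 : 0 ≤ e ^ α := Real.rpow_nonneg he _
    rcases le_total e 1 with h1 | h1
    · calc (e + 1) ^ α ≤ 2 ^ α := Real.rpow_le_rpow (by linarith) (by linarith) hα
        _ ≤ 2 ^ α * (e ^ α + 1) := le_mul_of_one_le_right (by positivity) (by linarith)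
    · calc (e + 1) ^ α ≤ (2 * e) ^ α := Real.rpow_le_rpow (by linarith) (by linarith) hα
        _ = 2 ^ α * e ^ α := Real.mul_rpow (by norm_num) he
        _ ≤ 2 ^ α * (e ^ α + 1) := mul_le_mul_of_nonneg_left (by linarith) (by positivity)
  have hbd : ∀ l, ∀ᵐ X ∂confMeasure l, ‖((k l X : ℝ) : ℂ) * wave φ l X‖ ≤
      ‖((2 ^ α : ℝ) : ℂ) • ((‖wave η₀ l X‖ : ℂ) + (‖wave φ l X‖ : ℂ))‖ := by
    intro l
    filter_upwards [h l] with X hX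
    have he := partialEnergy_nonneg m i₀ l X
    have hX' : ‖wave η₀ l X‖ = partialEnergy m i₀ l X ^ α * ‖wave φ l X‖ := by
      have hX₀ : wave η₀ l X = (((partialEnergy m i₀ l X + 0) ^ α : ℝ) : ℂ) * wave φ l X := hX
      rw [hX₀, norm_mul, Complex.norm_real, add_zero, Real.norm_of_nonneg (Real.rpow_nonneg he α)]
    rw [norm_mul, Complex.norm_real, Real.norm_of_nonneg (hk0 l X), norm_smul, Complex.norm_real,
      Real.norm_of_nonneg (by positivity), ← Complex.ofReal_add, Complex.norm_real,
      Real.norm_of_nonneg (by positivity), hX']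
    have := mul_le_mul_of_nonneg_right (hle l X) (norm_nonneg (wave φ l X))
    refine this.trans (le_of_eq ?_)
    ring
  have hdom : ∀ l, MemLp (fun X => ((2 ^ α : ℝ) : ℂ) •
      ((‖wave η₀ l X‖ : ℂ) + (‖wave φ l X‖ : ℂ))) 2 (confMeasure l) := by
    intro l
    have h1 : MemLp (fun X => ((‖wave η₀ l X‖ : ℝ) : ℂ)) 2 (confMeasure l) :=
      (memLp_wave η₀ l).norm.ofReal
    have h2 : MemLp (fun X => ((‖wave φ l X‖ : ℝ) : ℂ)) 2 (confMeasure l) :=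
      (memLp_wave φ l).norm.ofReal
    exact (h1.add h2).const_smul ((2 ^ α : ℝ) : ℂ)
  have hmem : ∀ l, MemLp (fun X => ((k l X : ℝ) : ℂ) * wave φ l X) 2 (confMeasure l) := fun l =>
    (hdom l).of_le ((Complex.measurable_ofReal.comp (hkm l)).aestronglyMeasurable.mul
      (memLp_wave φ l).1) (hbd l)
  have hsec : ∀ l, (hmem l).toLp _ ∈ sector l := by
    intro l σ
    have h0 := (hmem l).coeFn_toLp
    filter_upwards [h0, (measurePreserving_permConf σ).quasiMeasurePreserving.ae h0,
      isAntisymm_wave φ l σ] with X h1 h2 h3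
    rw [h1, h2, h3]
    have : k l (permConf σ X) = k l X := by simp only [hk, partialEnergy_perm]
    rw [this]
    ring
  have hnorm : ∀ l, ‖(hmem l).toLp _‖ ^ 2 ≤
      (2 ^ α) ^ 2 * (2 * ‖η₀ l‖ ^ 2 + 2 * ‖φ l‖ ^ 2) := by
    intro l
    rw [← ENNReal.ofReal_le_ofReal_iff (by positivity), ofReal_norm_Lp_sq]
    have e1 : ∫⁻ X, ‖(hmem l).toLp _ X‖ₑ ^ 2 ∂confMeasure l ≤
        ∫⁻ X, ENNReal.ofReal ((2 ^ α) ^ 2) * (2 * ‖wave η₀ l X‖ₑ ^ 2 + 2 * ‖wave φ l X‖ₑ ^ 2)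
          ∂confMeasure l := by
      refine lintegral_mono_ae ?_
      filter_upwards [(hmem l).coeFn_toLp, hbd l] with X h1 h2
      rw [h1]
      refine (pow_le_pow_left' (enorm_le_iff_norm_le.2 h2) 2).trans ?_
      rw [enorm_smul, mul_pow]
      refine mul_le_mul' (le_of_eq ?_) ?_
      · rw [← ofReal_norm, Complex.norm_real, Real.norm_of_nonneg (by positivity),
          ENNReal.ofReal_pow (by positivity)]
      · refine (enorm_add_sq_le _ _).trans (le_of_eq ?_)
        rw [← ofReal_norm ((‖wave η₀ l X‖ : ℝ) : ℂ), ← ofReal_norm ((‖wave φ l X‖ : ℝ) : ℂ),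
          Complex.norm_real, Complex.norm_real, norm_norm, norm_norm, ofReal_norm, ofReal_norm]
    refine e1.trans (le_of_eq ?_)
    have m1 : AEMeasurable (fun X => ‖wave η₀ l X‖ₑ ^ 2) (confMeasure l) :=
      (memLp_wave η₀ l).1.enorm.pow_const 2
    rw [lintegral_const_mul' _ _ ENNReal.ofReal_ne_top, lintegral_add_left' (m1.const_mul _),
      lintegral_const_mul' _ _ (by norm_num), lintegral_const_mul' _ _ (by norm_num),
      ← ofReal_norm_sector_sq, ← ofReal_norm_sector_sq, ENNReal.ofReal_mul (by positivity),
      ENNReal.ofReal_add (by positivity) (by positivity), ENNReal.ofReal_mul (by norm_num),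
      ENNReal.ofReal_mul (by norm_num), ENNReal.ofReal_ofNat]
  have hℓ : Memℓp (fun l => (⟨(hmem l).toLp _, hsec l⟩ : sector l)) 2 := by
    refine memℓp_gen ?_
    have hsum : Summable fun l => (2 ^ α) ^ 2 * (2 * ‖η₀ l‖ ^ 2 + 2 * ‖φ l‖ ^ 2) :=
      (((hasSum_norm_sector_sq η₀).summable.mul_left 2).add
        ((hasSum_norm_sector_sq φ).summable.mul_left 2)).mul_left _
    refine Summable.of_nonneg_of_le (fun l => by positivity) (fun l => ?_) hsum
    have := hnorm l
    simpa using this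
  refine ⟨⟨_, hℓ⟩, fun l => ?_⟩
  filter_upwards [(hmem l).coeFn_toLp] with X hX
  exact hX

end Sectors

/-! ### From sector bounds to a vector -/

section Interaction

variable {n : ℕ}

/-- Linearity of wave functions holds only almost everywhere; this carries the null sets back to the
product space on which the form is integrated. -/
theorem quasiMeasurePreserving_append_const (S : Fin n → Prop) [DecidablePred S] (l : Fin n → ℕ) :
    Measure.QuasiMeasurePreserving
      (fun z : (Fin n → Xi) × Conf l => appendConf (constConf S z.1) z.2)
      ((kernelMeasure n).prod (confMeasure l)) (confMeasure fun i => indOcc S i + l i) := by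
  have h1 := ((measurePreserving_splitKernel S).prod
    (MeasurePreserving.id (confMeasure l))).quasiMeasurePreserving
  have h2 := (Measure.measurePreserving_swap (μ := confMeasure (indOcc S))
    (ν := confMeasure (indOcc fun i => ¬ S i))).prod (MeasurePreserving.id (confMeasure l))
  have h3 := Measure.quasiMeasurePreserving_snd.comp
    ((measurePreserving_prodAssoc (confMeasure (indOcc fun i => ¬ S i)) (confMeasure (indOcc S))
      (confMeasure l)).quasiMeasurePreserving.comp h2.quasiMeasurePreserving)
  have h4 := ((measurePreserving_cutConf (indOcc S) l).symm _).quasiMeasurePreserving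
  have h := h4.comp (h3.comp h1)
  convert h using 1
  funext z
  simp only [Function.comp_apply, cutConf_symm_apply]
  have e : splitKernel S z.1 = _ := splitKernel_apply S z.1
  simp only [Prod.map, e]
  rfl

theorem wave_add (ψ₁ ψ₂ : Fock n) (l : Fin n → ℕ) :
    ∀ᵐ X ∂confMeasure l, wave (ψ₁ + ψ₂) l X = wave ψ₁ l X + wave ψ₂ l X :=
  Lp.coeFn_add (ψ₁ l : Lp ℂ 2 (confMeasure l)) (ψ₂ l : Lp ℂ 2 (confMeasure l))

theorem wave_smul (c : ℂ) (ψ : Fock n) (l : Fin n → ℕ) :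
    ∀ᵐ X ∂confMeasure l, wave (c • ψ) l X = c * wave ψ l X :=
  Lp.coeFn_smul c (ψ l : Lp ℂ 2 (confMeasure l))

theorem formIntegrand_add (p : ℕ) (G : Kernel n) (ψ₁ ψ₂ φ : Fock n) (l : Fin n → ℕ) :
    ∀ᵐ z ∂(kernelMeasure n).prod (confMeasure l), formIntegrand p G (ψ₁ + ψ₂) φ l z =
      formIntegrand p G ψ₁ φ l z + formIntegrand p G ψ₂ φ l z := by
  obtain ⟨c, -, h⟩ := exists_formIntegrand_eq p l
  filter_upwards [(quasiMeasurePreserving_append_const (fun i : Fin n => i.val < p) l).ae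
    (wave_add ψ₁ ψ₂ _)] with z hz
  rw [h, h, h, hz, map_add]
  ring

theorem formIntegrand_smul (p : ℕ) (G : Kernel n) (a : ℂ) (ψ φ : Fock n) (l : Fin n → ℕ) :
    ∀ᵐ z ∂(kernelMeasure n).prod (confMeasure l), formIntegrand p G (a • ψ) φ l z =
      conj a * formIntegrand p G ψ φ l z := by
  obtain ⟨c, -, h⟩ := exists_formIntegrand_eq p l
  filter_upwards [(quasiMeasurePreserving_append_const (fun i : Fin n => i.val < p) l).ae
    (wave_smul a ψ _)] with z hz
  rw [h, h, hz, map_mul]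
  ring

/-- The Riesz representation of a bounded antilinear functional. -/
theorem exists_inner_eq_of_norm_le {H : Type*} [NormedAddCommGroup H] [InnerProductSpace ℂ H]
    [CompleteSpace H] {Λ : H → ℂ} {K : ℝ} (hK : 0 ≤ K) (hadd : ∀ x y, Λ (x + y) = Λ x + Λ y)
    (hsmul : ∀ (a : ℂ) x, Λ (a • x) = conj a * Λ x) (hle : ∀ x, ‖Λ x‖ ≤ K * ‖x‖) :
    ∃ χ : H, (∀ x, inner ℂ x χ = Λ x) ∧ ‖χ‖ ≤ K := by
  let f : H →ₗ[ℂ] ℂ :=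
    { toFun := fun x => conj (Λ x)
      map_add' := fun x y => by rw [hadd, map_add]
      map_smul' := fun a x => by simp [hsmul] }
  have hf : ∀ x, ‖f x‖ ≤ K * ‖x‖ := fun x => (RCLike.norm_conj (Λ x)).trans_le (hle x)
  refine ⟨(InnerProductSpace.toDual ℂ H).symm (f.mkContinuous K hf), fun x => ?_, ?_⟩
  · rw [← inner_conj_symm, InnerProductSpace.toDual_symm_apply]
    exact Complex.conj_conj (Λ x)
  · rw [LinearIsometryEquiv.norm_map]
    exact f.mkContinuous_norm_le hK hf

/-- Cauchy–Schwarz over the sectors; translating occupation numbers is injective, so each shifted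
sum of squares is at most the full norm. -/
theorem summable_of_norm_le_shift {f : (Fin n → ℕ) → ℂ} {K : ℝ} (hK : 0 ≤ K) (a b : Fin n → ℕ)
    (ψ η : Fock n)
    (hf : ∀ l, ‖f l‖ ≤ K * (‖ψ fun i => a i + l i‖ * ‖η fun i => b i + l i‖)) :
    Summable f ∧ ‖∑' l, f l‖ ≤ K * (‖ψ‖ * ‖η‖) := by
  have hshift : ∀ (c : Fin n → ℕ) (φ : Fock n), 
      Summable (fun l : Fin n → ℕ => ‖φ fun i => c i + l i‖ ^ 2) ∧
      ∑' l : Fin n → ℕ, ‖φ fun i => c i + l i‖ ^ 2 ≤ ‖φ‖ ^ 2 := by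
    intro c φ
    have hinj : Function.Injective fun (l : Fin n → ℕ) i => c i + l i := fun l l' h =>
      funext fun i => Nat.add_left_cancel (congrFun h i)
    have hs := hasSum_norm_sector_sq φ
    have hs' : Summable (fun l : Fin n → ℕ => ‖φ fun i => c i + l i‖ ^ 2) :=
      hs.summable.comp_injective hinj
    refine ⟨hs', ?_⟩
    rw [← hs.tsum_eq]
    exact hs'.tsum_le_tsum_of_inj _ hinj (fun _ _ => sq_nonneg _) (fun _ => le_rfl) hs.summable
  obtain ⟨hψ, hψ'⟩ := hshift a ψ
  obtain ⟨hη, hη'⟩ := hshift b η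
  have hcs := Real.summable_and_inner_le_Lp_mul_Lq_tsum_of_nonneg
    (f := fun l : Fin n → ℕ => ‖ψ fun i => a i + l i‖)
    (g := fun l : Fin n → ℕ => ‖η fun i => b i + l i‖) Real.HolderConjugate.two_two
    (fun _ => norm_nonneg _) (fun _ => norm_nonneg _) (by simpa using hψ) (by simpa using hη)
  simp only [Real.rpow_two, ← Real.sqrt_eq_rpow] at hcs
  have hsum := hcs.1.mul_left K
  have hn : Summable fun l => ‖f l‖ := Summable.of_nonneg_of_le (fun _ => norm_nonneg _) hf hsum
  refine ⟨hn.of_norm, (norm_tsum_le_tsum_norm hn).trans ((hn.tsum_le_tsum hf hsum).trans ?_)⟩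
  rw [tsum_mul_left]
  refine mul_le_mul_of_nonneg_left (hcs.2.trans ?_) hK
  exact mul_le_mul (Real.sqrt_le_iff.2 ⟨norm_nonneg _,  hψ'⟩) (Real.sqrt_le_iff.2 ⟨norm_nonneg _,  hη'⟩)
    (Real.sqrt_nonneg _) (norm_nonneg _)

end Interaction

end FermionFields

end

/-! ### The estimate for the interaction operator -/

theorem proposition2p5 (n : ℕ) (m : Fin n → ℝ) (hm : ∀ i, 0 ≤ m i)
    (s θ : ℝ) (hs : 1 / 2 < s) (hθ₀ : 0 ≤ θ) (hθ₁ : θ ≤ 1) :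
    ∃ C : ℝ, 0 < C ∧ ∀ (p : ℕ), p ≤ n → ∀ (i₀ : Fin n)
      (G F : FermionFields.Kernel n), FermionFields.IsWeighted m i₀ s θ G F →
      ∀ φ : FermionFields.Fock n,
        (∃ η, FermionFields.IsEnergyPow m i₀ 0 (((n : ℝ) - 1) / 2 * (1 - θ)) φ η) →
        ∃ η χ : FermionFields.Fock n,
          FermionFields.IsEnergyPow m i₀ 1 (((n : ℝ) - 1) / 2 * (1 - θ)) φ η ∧
          FermionFields.IsInteraction p G φ χ ∧
          ‖χ‖ ≤ C * ‖F‖ * ‖η‖ := by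
  obtain ⟨C, hC, hform⟩ := FermionFields.exists_norm_form_le hm hs hθ₀ hθ₁
  refine ⟨C, hC, fun p _ i₀ G F hGF φ ⟨η₀, hη₀⟩ => ?_⟩
  -- The existence of `i₀` forces `n ≥ 1`, so the exponent of the energy is non-negative.
  have hn : (1 : ℝ) ≤ n := by exact_mod_cast i₀.pos
  obtain ⟨η, hη⟩ := FermionFields.exists_energyPow_one
    (mul_nonneg (div_nonneg (by linarith) (by norm_num)) (by linarith)) hη₀
  have hInt := fun ψ l => (hform p i₀ G F hGF φ η hη ψ l).1
  have hsum := fun ψ => FermionFields.summable_of_norm_le_shift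
    (mul_nonneg hC.le (norm_nonneg F)) _ _ ψ η fun l => (hform p i₀ G F hGF φ η hη ψ l).2
  -- The sector bounds hold for every `ψ`, so the form extends to a bounded antilinear functional on
  -- the whole space and the Riesz theorem applies directly.
  let Λ : FermionFields.Fock n → ℂ := fun ψ => ∑' l, ∫ z, FermionFields.formIntegrand p G ψ φ l z
    ∂((FermionFields.kernelMeasure n).prod (FermionFields.confMeasure l))
  have hadd : ∀ ψ₁ ψ₂, Λ (ψ₁ + ψ₂) = Λ ψ₁ + Λ ψ₂ := by
    intro ψ₁ ψ₂
    refine Eq.trans ?_ ((hsum ψ₁).1.tsum_add (hsum ψ₂).1)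
    refine tsum_congr fun l => ?_
    rw [← MeasureTheory.integral_add (hInt ψ₁ l) (hInt ψ₂ l)]
    exact MeasureTheory.integral_congr_ae (FermionFields.formIntegrand_add p G ψ₁ ψ₂ φ l)
  have hsmul : ∀ (a : ℂ) ψ, Λ (a • ψ) = (starRingEnd ℂ) a * Λ ψ := by
    intro a ψ
    refine Eq.trans ?_ tsum_mul_left
    refine tsum_congr fun l => ?_
    rw [← MeasureTheory.integral_const_mul]
    exact MeasureTheory.integral_congr_ae (FermionFields.formIntegrand_smul p G a ψ φ l)
  obtain ⟨χ, hχ, hle⟩ := FermionFields.exists_inner_eq_of_norm_le (K := C * ‖F‖ * ‖η‖)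
    (by positivity) hadd hsmul fun ψ => (hsum ψ).2.trans (le_of_eq (by ring))
  exact ⟨η, χ, hη, fun ψ _ => ⟨hInt ψ, by rw [hχ]; exact (hsum ψ).1.hasSum⟩, hle⟩
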